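/- Let $n\ge 3$ and index everything below by $i,j\in\mathbb Z/n$. Let $q,d\in\mathbb C^\times$, put $q_1=d/q$, $q_2=q^2$, $q_3=1/(dq)$, and assume that these are generic: if $q_1^aq_2^bq_3^c=1$ with $a,b,c\in\mathbb Z$ then $a=b=c$. Let $a_{ii}=2$, $a_{i,i\pm1}=-1$, $m_{i-1,i}=-1$, $m_{i,i-1}=1$, and let all other $a_{ij}$, $m_{ij}$ be $0$. **The algebra.** $\mathcal E_n$ is the associative unital $\mathbb C$-algebra with generators $E_{i,r},F_{i,r}$ ($r\in\mathbb Z$), $H_{i,l}$ ($l\in\mathbb Z\setminus\{0\}$), $K_i^{\pm1}$. Put $E_i(z)=\sum_r E_{i,r}z^{-r}$, $F_i(z)=\sum_rF_{i,r}z^{-r}$, $K_i^\pm(z)=K_i^{\pm1}\exp\bigl(\pm(q-q^{-1})\sum_{l\ge1}H_{i,\pm l}z^{\mp l}\bigr)$ and $\delta(z)=\sum_{r\in\mathbb Z}z^r$. The defining relations are: $K_iK_i^{-1}=K_i^{-1}K_i=1$; all coefficients of the series $K_i^{\pm}(z)$ (for all $i$ and both signs) commute with each other; and $$(q^{a_{ij}}w-d^{m_{ij}}z)K_i^\pm(z)E_j(w)=(w-d^{m_{ij}}q^{a_{ij}}z)E_j(w)K_i^\pm(z),$$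 $$(w-d^{m_{ij}}q^{a_{ij}}z)K_i^\pm(z)F_j(w)=(q^{a_{ij}}w-d^{m_{ij}}z)F_j(w)K_i^\pm(z),$$ $$[E_i(z),F_j(w)]=\frac{\delta_{ij}}{q-q^{-1}}\bigl(\delta(w/z)K_i^+(w)-\delta(z/w)K_i^-(z)\bigr),$$ $$(d^{m_{ij}}z-q^{a_{ij}}w)E_i(z)E_j(w)=(d^{m_{ij}}q^{a_{ij}}z-w)E_j(w)E_i(z),$$ $$(d^{m_{ij}}z-q^{-a_{ij}}w)F_i(z)F_j(w)=(d^{m_{ij}}q^{-a_{ij}}z-w)F_j(w)F_i(z),$$ $[E_i(z),E_j(w)]=[F_i(z),F_j(w)]=0$ for $i\ne j,j\pm1$; and, for $X=E$ and for $X=F$, the expression $$X_i(z_1)X_i(z_2)X_{i\pm1}(w)-(q+q^{-1})X_i(z_1)X_{i\pm1}(w)X_i(z_2)+X_{i\pm1}(w)X_i(z_1)X_i(z_2)$$ plus the same expression with $z_1,z_2$ exchanged is $0$. The algebra is $\mathbb Z^n$-graded by $\deg E_{i,r}=1_i$, $\deg F_{i,r}=-1_i$, $\deg H_{i,l}=\deg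 K_i^{\pm1}=0$. **Modules.** A vector $v$ is singular if $F_{i,r}v=0$ for all $i,r$. It has weight $(\phi_i^\pm(z))_i$, where $\phi_i^\pm(z)\in\mathbb C[[z^{\mp1}]]$, if $K_i^\pm(z)v=\phi_i^\pm(z)v$ for all $i$; for a rational function $\phi_i$, $\phi_i^+$ and $\phi_i^-$ denote its expansions at $z=\infty$ and at $z=0$. A module is lowest weight of lowest weight $\phi$ if it is generated by a singular vector of weight $\phi$; weighted if it is the sum of its spaces of vectors of a given weight; tame if it is weighted and each of these spaces has dimension at most $1$; of level $c$ if $\prod_iK_i^{-1}$ acts by the constant $c$. **The Fock space.** Let $k\in\mathbb Z/n$, $u\in\mathbb C^\times$, and $\psi(z)=\dfrac{q-q^{-1}z}{1-z}$. Let $\mathcal F^{(k)}(u)$ be the complex vector space with basis $|\lambda\rangle$, where $\lambda=(\lambda_1\ge\lambda_2\ge\cdots)$ runs over all partitions. Write $\lambda+\mathbf 1_j$ for $\lambda$ with $\lambda_j$ increased by one. Below, $\equiv$ is congruence modulo $n$. For a set $S$ of rows put $$B_{i,j}(\lambda;S)=\prod_{s\in S,\ \lambda_s+i\equiv s+k}\psi(q_1^{\lambda_s-\lambda_j-1}q_3^{s-j})\prod_{s\in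 S,\ \lambda_s+i+1\equiv s+k}\psi(q_1^{\lambda_j-\lambda_s}q_3^{j-s}).$$ Whenever $\lambda$ and $\lambda+\mathbf 1_j$ are partitions and $i+\lambda_j+1\equiv j+k$, set $$\langle\lambda+\mathbf 1_j|E_i(z)|\lambda\rangle=B_{i,j}(\lambda;\{s<j\})\,\delta(q_1^{\lambda_j}q_3^{j-1}u/z),$$ $$\langle\lambda|F_i(z)|\lambda+\mathbf 1_j\rangle=B_{i,j}(\lambda;\{s>j\})\,\delta(q_1^{\lambda_j}q_3^{j-1}u/z);$$ for all $\lambda$ and $i$, set $$\langle\lambda|K_i^\pm(z)|\lambda\rangle=\prod_{s\ge1,\ \lambda_s+i\equiv s+k}\psi(q_1^{\lambda_s-1}q_3^{s-1}u/z)\prod_{s\ge1,\ \lambda_s+i+1\equiv s+k}\psi(q_1^{\lambda_s-1}q_3^{s-2}u/z)^{-1},$$ expanded at $z=\infty$ for $K_i^+$ and at $z=0$ for $K_i^-$; all other matrix coefficients are $0$. The infinite products stand for finite ones: if $\lambda_r=0$ and $i\equiv r+k$ (and $r>j$ in the formula for $F_i$), the factors with $s\ge r$ cancel in pairs because $\psi(q_2z)\psi(1/z)=1$,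 and the product is taken over $s<r$ only; any such $r$ may be used. Grade the space by $$\deg|\lambda\rangle=\sum_{r\ge1}\bigl(\deg[u]_{\lambda_r-r}-\deg[u]_{-r}\bigr),$$ where $\deg[u]_{mn+t}=m(1_0+\dots+1_{n-1})+1_k+1_{k-1}+\dots+1_{k-t}$ for $m\in\mathbb Z$, $0\le t<n$. **Proposition.** These formulas define an action of $\mathcal E_n$ on $\mathcal F^{(k)}(u)$. With it, $\mathcal F^{(k)}(u)$ is an irreducible, tame, lowest weight $\mathcal E_n$-module, $\mathbb Z^n$-graded by the grading above, of level $q$ and of lowest weight $\bigl(\psi(q_2u/z)^{-\delta_{ik}}\bigr)_{i}$. -/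

import Mathlib

noncomputable section

namespace QuantumToroidal

/-! ### The algebra -/

/-- The parameters `q₁ = d / q`, `q₂ = q²`, `q₃ = 1 / (d q)`; thus `q₁ q₂ q₃ = 1`. -/
def q₁ (q d : ℂ) : ℂ := d / q

/-- See `q₁`. -/
def q₂ (q : ℂ) : ℂ := q ^ 2

/-- See `q₁`. -/
def q₃ (q d : ℂ) : ℂ := 1 / (d * q)

/-- The parameters are generic: `q₁ ^ a * q₂ ^ b * q₃ ^ c = 1` only if `a = b = c`. -/
def IsGeneric (q d : ℂ) : Prop :=
  ∀ a b c : ℤ, q₁ q d ^ a * q₂ q ^ b * q₃ q d ^ c = 1 → a = b ∧ b = c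

/-- The Cartan matrix of type `A^{(1)}_{n-1}`, with rows and columns indexed cyclically
(`3 ≤ n`). -/
def cartan {n : ℕ} (i j : ZMod n) : ℤ :=
  if i = j then 2 else if j = i + 1 ∨ i = j + 1 then -1 else 0

/-- The matrix with `m_{i-1,i} = -1`, `m_{i,i-1} = 1` and all other entries zero. -/
def mMatrix {n : ℕ} (i j : ZMod n) : ℤ :=
  if j = i + 1 then -1 else if i = j + 1 then 1 else 0

/-- The generators `E_{i,k}`, `F_{i,k}`, `H_{i,l}` (`l ≠ 0`), `K_i`, `K_i⁻¹`. -/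
inductive Gen (n : ℕ) : Type
  | E (i : ZMod n) (k : ℤ)
  | F (i : ZMod n) (k : ℤ)
  | H (i : ZMod n) (l : {l : ℤ // l ≠ 0})
  | K (i : ZMod n)
  | Kinv (i : ZMod n)

/-- The free associative algebra on the generators. -/
abbrev Free (n : ℕ) : Type := FreeAlgebra ℂ (Gen n)

namespace Free

variable {n : ℕ}

/-- `E_{i,k}` in the free algebra; `E_i(z) = ∑ₖ E_{i,k} z^{-k}`. -/
def E (i : ZMod n) (k : ℤ) : Free n := FreeAlgebra.ι ℂ (Gen.E i k)

/-- `F_{i,k}` in the free algebra; `F_i(z) = ∑ₖ F_{i,k} z^{-k}`. -/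
def F (i : ZMod n) (k : ℤ) : Free n := FreeAlgebra.ι ℂ (Gen.F i k)

/-- `K_i` in the free algebra. -/
def K (i : ZMod n) : Free n := FreeAlgebra.ι ℂ (Gen.K i)

/-- `K_i⁻¹` in the free algebra. -/
def Kinv (i : ZMod n) : Free n := FreeAlgebra.ι ℂ (Gen.Kinv i)

/-- `H_{i,l}` in the free algebra, with `0` at the index `l = 0` (no such generator). -/
def H (i : ZMod n) (l : ℤ) : Free n :=
  if h : l ≠ 0 then FreeAlgebra.ι ℂ (Gen.H i ⟨l, h⟩) else 0

end Free

/-- `exp f = ∑ᵣ f ^ r / r!` for a power series `f` without constant term over a (possibly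
noncommutative) algebra: only the terms `r ≤ l` contribute to the coefficient of degree `l`. -/
def expSeries {A : Type} [Ring A] [Algebra ℂ A] (f : PowerSeries A) : PowerSeries A :=
  PowerSeries.mk fun l =>
    ∑ r ∈ Finset.range (l + 1), ((r.factorial : ℂ)⁻¹) • PowerSeries.coeff l (f ^ r)

/-- The coefficient of `z^{-r}` in
`K_i^+(z) = K_i exp ((q - q⁻¹) ∑_{l ≥ 1} H_{i,l} z^{-l})`; it is zero for `r < 0`. -/
def Free.Kplus {n : ℕ} (q : ℂ) (i : ZMod n) (r : ℤ) : Free n :=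
  if 0 ≤ r then
    Free.K i * PowerSeries.coeff r.toNat
      (expSeries (PowerSeries.mk fun l : ℕ => (q - q⁻¹) • Free.H i (l : ℤ)))
  else 0

/-- The coefficient of `z^{-r}` in
`K_i^-(z) = K_i⁻¹ exp (-(q - q⁻¹) ∑_{l ≥ 1} H_{i,-l} z^{l})`; it is zero for `r > 0`. -/
def Free.Kminus {n : ℕ} (q : ℂ) (i : ZMod n) (r : ℤ) : Free n :=
  if r ≤ 0 then
    Free.Kinv i * PowerSeries.coeff (-r).toNat
      (expSeries (PowerSeries.mk fun l : ℕ => (-(q - q⁻¹)) • Free.H i (-(l : ℤ))))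
  else 0

/-- For a family `x r` (`r ∈ ℤ`) of coefficients of `X(z) = ∑ᵣ x r z^{-r}` and `y` likewise,
the coefficient of `z₁^{-r} z₂^{-s} w^{-t}` in
`X(z₁) X(z₂) Y(w) - (q + q⁻¹) X(z₁) Y(w) X(z₂) + Y(w) X(z₁) X(z₂)`. -/
def serreTerm {A : Type} [Ring A] [Algebra ℂ A] (q : ℂ) (x y : ℤ → A) (r s t : ℤ) : A :=
  x r * x s * y t - (q + q⁻¹) • (x r * y t * x s) + y t * x r * x s

/-- The defining relations of `ℰ_n`, that is, those of the quantum toroidal algebra at central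
charge `q^{c/2} = 1`. Each relation between currents is written as the family of the relations
between its coefficients; the relation between the currents is recalled above it. -/
inductive Rel (n : ℕ) (q d : ℂ) : Free n → Free n → Prop
  | K_Kinv (i : ZMod n) : Rel n q d (Free.K i * Free.Kinv i) 1
  | Kinv_K (i : ZMod n) : Rel n q d (Free.Kinv i * Free.K i) 1
  /-- `K_i^+(z) K_j^+(w) = K_j^+(w) K_i^+(z)` -/
  | Kplus_Kplus (i j : ZMod n) (r s : ℤ) :
      Rel n q d (Free.Kplus q i r * Free.Kplus q j s) (Free.Kplus q j s * Free.Kplus q i r)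
  /-- `K_i^-(z) K_j^-(w) = K_j^-(w) K_i^-(z)` -/
  | Kminus_Kminus (i j : ZMod n) (r s : ℤ) :
      Rel n q d (Free.Kminus q i r * Free.Kminus q j s) (Free.Kminus q j s * Free.Kminus q i r)
  /-- `K_i^-(z) K_j^+(w) = K_j^+(w) K_i^-(z)` -/
  | Kminus_Kplus (i j : ZMod n) (r s : ℤ) :
      Rel n q d (Free.Kminus q i r * Free.Kplus q j s) (Free.Kplus q j s * Free.Kminus q i r)
  /-- `(q^{a_{ij}} w - d^{m_{ij}} z) K_i^+(z) E_j(w) = (w - d^{m_{ij}} q^{a_{ij}} z) E_j(w) K_i^+(z)` -/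
  | Kplus_E (i j : ZMod n) (r s : ℤ) :
      Rel n q d
        (q ^ cartan i j • (Free.Kplus q i r * Free.E j (s + 1)) -
          d ^ mMatrix i j • (Free.Kplus q i (r + 1) * Free.E j s))
        (Free.E j (s + 1) * Free.Kplus q i r -
          (d ^ mMatrix i j * q ^ cartan i j) • (Free.E j s * Free.Kplus q i (r + 1)))
  /-- `(q^{a_{ij}} w - d^{m_{ij}} z) K_i^-(z) E_j(w) = (w - d^{m_{ij}} q^{a_{ij}} z) E_j(w) K_i^-(z)` -/
  | Kminus_E (i j : ZMod n) (r s : ℤ) :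
      Rel n q d
        (q ^ cartan i j • (Free.Kminus q i r * Free.E j (s + 1)) -
          d ^ mMatrix i j • (Free.Kminus q i (r + 1) * Free.E j s))
        (Free.E j (s + 1) * Free.Kminus q i r -
          (d ^ mMatrix i j * q ^ cartan i j) • (Free.E j s * Free.Kminus q i (r + 1)))
  /-- `(w - d^{m_{ij}} q^{a_{ij}} z) K_i^+(z) F_j(w) = (q^{a_{ij}} w - d^{m_{ij}} z) F_j(w) K_i^+(z)` -/
  | Kplus_F (i j : ZMod n) (r s : ℤ) :
      Rel n q d
        (Free.Kplus q i r * Free.F j (s + 1) -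
          (d ^ mMatrix i j * q ^ cartan i j) • (Free.Kplus q i (r + 1) * Free.F j s))
        (q ^ cartan i j • (Free.F j (s + 1) * Free.Kplus q i r) -
          d ^ mMatrix i j • (Free.F j s * Free.Kplus q i (r + 1)))
  /-- `(w - d^{m_{ij}} q^{a_{ij}} z) K_i^-(z) F_j(w) = (q^{a_{ij}} w - d^{m_{ij}} z) F_j(w) K_i^-(z)` -/
  | Kminus_F (i j : ZMod n) (r s : ℤ) :
      Rel n q d
        (Free.Kminus q i r * Free.F j (s + 1) -
          (d ^ mMatrix i j * q ^ cartan i j) • (Free.Kminus q i (r + 1) * Free.F j s))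
        (q ^ cartan i j • (Free.F j (s + 1) * Free.Kminus q i r) -
          d ^ mMatrix i j • (Free.F j s * Free.Kminus q i (r + 1)))
  /-- `[E_i(z), F_j(w)] = δ_{ij} (q - q⁻¹)⁻¹ (δ(w/z) K_i^+(w) - δ(z/w) K_i^-(z))` -/
  | E_F (i j : ZMod n) (r s : ℤ) :
      Rel n q d
        (Free.E i r * Free.F j s - Free.F j s * Free.E i r)
        (if i = j then
          (q - q⁻¹)⁻¹ • (Free.Kplus q i (r + s) - Free.Kminus q i (r + s)) else 0)
  /-- `(d^{m_{ij}} z - q^{a_{ij}} w) E_i(z) E_j(w) = (d^{m_{ij}} q^{a_{ij}} z - w) E_j(w) E_i(z)` -/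
  | E_E (i j : ZMod n) (r s : ℤ) :
      Rel n q d
        (d ^ mMatrix i j • (Free.E i (r + 1) * Free.E j s) -
          q ^ cartan i j • (Free.E i r * Free.E j (s + 1)))
        ((d ^ mMatrix i j * q ^ cartan i j) • (Free.E j s * Free.E i (r + 1)) -
          Free.E j (s + 1) * Free.E i r)
  /-- `(d^{m_{ij}} z - q^{-a_{ij}} w) F_i(z) F_j(w) = (d^{m_{ij}} q^{-a_{ij}} z - w) F_j(w) F_i(z)` -/
  | F_F (i j : ZMod n) (r s : ℤ) :
      Rel n q d
        (d ^ mMatrix i j • (Free.F i (r + 1) * Free.F j s) -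
          q ^ (-cartan i j) • (Free.F i r * Free.F j (s + 1)))
        ((d ^ mMatrix i j * q ^ (-cartan i j)) • (Free.F j s * Free.F i (r + 1)) -
          Free.F j (s + 1) * Free.F i r)
  /-- `[E_i(z), E_j(w)] = 0` for `i ≢ j, j ± 1` -/
  | E_E_far (i j : ZMod n) (hij : i ≠ j) (h₁ : i ≠ j + 1) (h₂ : i ≠ j - 1) (r s : ℤ) :
      Rel n q d (Free.E i r * Free.E j s) (Free.E j s * Free.E i r)
  /-- `[F_i(z), F_j(w)] = 0` for `i ≢ j, j ± 1` -/
  | F_F_far (i j : ZMod n) (hij : i ≠ j) (h₁ : i ≠ j + 1) (h₂ : i ≠ j - 1) (r s : ℤ) :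
      Rel n q d (Free.F i r * Free.F j s) (Free.F j s * Free.F i r)
  /-- the cubic relation between `E_i(z₁)`, `E_i(z₂)`, `E_{i±1}(w)`, symmetrized in `z₁`, `z₂` -/
  | serre_E (i j : ZMod n) (hj : j = i + 1 ∨ j = i - 1) (r s t : ℤ) :
      Rel n q d
        (serreTerm q (Free.E i) (Free.E j) r s t + serreTerm q (Free.E i) (Free.E j) s r t) 0
  /-- the cubic relation between `F_i(z₁)`, `F_i(z₂)`, `F_{i±1}(w)`, symmetrized in `z₁`, `z₂` -/
  | serre_F (i j : ZMod n) (hj : j = i + 1 ∨ j = i - 1) (r s t : ℤ) :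
      Rel n q d
        (serreTerm q (Free.F i) (Free.F j) r s t + serreTerm q (Free.F i) (Free.F j) s r t) 0

end QuantumToroidal

/-- The quantum toroidal algebra `ℰ_n = ℰ_n(q, d)` of type `gl_n`, at `q^{c/2} = 1`. -/
abbrev QToroidal (n : ℕ) (q d : ℂ) : Type := RingQuot (QuantumToroidal.Rel n q d)

namespace QToroidal

open QuantumToroidal

variable (n : ℕ) (q d : ℂ)

/-- The projection of the free algebra on `ℰ_n`. -/
def proj : Free n →ₐ[ℂ] QToroidal n q d := RingQuot.mkAlgHom ℂ (Rel n q d)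

/-- `E_{i,k}`. -/
def E (i : ZMod n) (k : ℤ) : QToroidal n q d := proj n q d (Free.E i k)

/-- `F_{i,k}`. -/
def F (i : ZMod n) (k : ℤ) : QToroidal n q d := proj n q d (Free.F i k)

/-- `K_i⁻¹`. -/
def Kinv (i : ZMod n) : QToroidal n q d := proj n q d (Free.Kinv i)

/-- The coefficient of `z^{-r}` in `K_i^+(z)`, for `r : ℕ`. -/
def Kplus (i : ZMod n) (r : ℕ) : QToroidal n q d := proj n q d (Free.Kplus q i (r : ℤ))

/-- The coefficient of `z^{r}` in `K_i^-(z)`, for `r : ℕ`. -/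
def Kminus (i : ZMod n) (r : ℕ) : QToroidal n q d := proj n q d (Free.Kminus q i (-(r : ℤ)))

/-- The element `κ⁻¹ = ∏ᵢ K_i⁻¹` (the factors commute). -/
def kappaInv : QToroidal n q d :=
  ((List.range n).map fun i : ℕ => Kinv n q d (i : ZMod n)).prod

/-- The `ℤ^n`-degree of a generator: `1_i` for `E_{i,k}`, `-1_i` for `F_{i,k}`, otherwise `0`. -/
def genDeg {n : ℕ} : Gen n → (ZMod n → ℤ)
  | Gen.E i _ => Pi.single i 1
  | Gen.F i _ => -Pi.single i 1
  | Gen.H _ _ => 0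
  | Gen.K _ => 0
  | Gen.Kinv _ => 0

/-- The component of `ℰ_n` of degree `α`: the span of the products of generators whose degrees
add up to `α`. -/
def homogeneous (α : ZMod n → ℤ) : Submodule ℂ (QToroidal n q d) :=
  Submodule.span ℂ {x | ∃ l : List (Gen n), (l.map genDeg).sum = α ∧
    x = (l.map fun g => proj n q d (FreeAlgebra.ι ℂ g)).prod}

/-! ### Modules over the algebra -/

/-- A weight: for every `i` a series `φ_i^+(z)` in `z⁻¹` and a series `φ_i^-(z)` in `z`.
The coefficient of degree `r` of `plus i` is that of `z^{-r}`, the coefficient of degree `r` of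
`minus i` is that of `z^{r}`. -/
structure Weight (n : ℕ) : Type where
  /-- the series `φ_i^+(z)` -/
  plus : ZMod n → PowerSeries ℂ
  /-- the series `φ_i^-(z)` -/
  minus : ZMod n → PowerSeries ℂ

section Modules

variable (V : Type) [AddCommGroup V] [Module ℂ V] [Module (QToroidal n q d) V]

/-- `v` has weight `φ`: `K_i^±(z) v = φ_i^±(z) v` for all `i`. -/
def HasWeight (φ : Weight n) (v : V) : Prop :=
  ∀ (i : ZMod n) (r : ℕ),
    Kplus n q d i r • v = PowerSeries.coeff r (φ.plus i) • v ∧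
    Kminus n q d i r • v = PowerSeries.coeff r (φ.minus i) • v

/-- The span of the vectors of weight `φ` (when the actions of `ℂ` and `ℰ_n` are compatible,
these vectors already form a subspace). -/
def weightSpace (φ : Weight n) : Submodule ℂ V :=
  Submodule.span ℂ {v | HasWeight n q d V φ v}

/-- Weighted module: the series `K_i^±(z)` are simultaneously diagonalizable. -/
def IsWeighted : Prop := ⨆ φ : Weight n, weightSpace n q d V φ = ⊤

/-- Tame module: weighted, and the joint spectrum of the series `K_i^±(z)` is simple. -/
def IsTame : Prop :=
  IsWeighted n q d V ∧ ∀ φ : Weight n, Module.rank ℂ (weightSpace n q d V φ) ≤ 1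

/-- `v` is singular: it is killed by all coefficients of the series `F_i(z)`. -/
def IsSingular (v : V) : Prop := ∀ (i : ZMod n) (r : ℤ), F n q d i r • v = 0

/-- Lowest weight module of lowest weight `φ`: generated by a singular vector of weight `φ`. -/
def IsLowestWeight (φ : Weight n) : Prop :=
  ∃ v : V, IsSingular n q d V v ∧ HasWeight n q d V φ v ∧
    Submodule.span (QToroidal n q d) {v} = ⊤

/-- Module of level `c`: `κ⁻¹` acts by the constant `c`. -/
def HasLevel (c : ℂ) : Prop := ∀ v : V, kappaInv n q d • v = c • v

open Classical in
/-- The subspaces `𝒱 β`, `β ∈ ℤ^n`, make `V` a `ℤ^n`-graded module. -/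
def IsGradedBy (𝒱 : (ZMod n → ℤ) → Submodule ℂ V) : Prop :=
  DirectSum.IsInternal 𝒱 ∧
    ∀ (α β : ZMod n → ℤ), ∀ x ∈ homogeneous n q d α, ∀ v ∈ 𝒱 β, x • v ∈ 𝒱 (α + β)

end Modules

end QToroidal

/-! ### The Fock space -/

namespace Fock

open QuantumToroidal

/-- Partitions `λ₁ ≥ λ₂ ≥ …` with finitely many nonzero parts. The rows are numbered from `0`:
`lam t` is the part `λ_{t+1}`. -/
abbrev Partition : Type := {f : ℕ →₀ ℕ // Antitone f}

/-- The space with basis `|λ⟩`, `λ` a partition. -/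
abbrev Space : Type := Partition →₀ ℂ

/-- The basis vector `|λ⟩`. The matrix coefficient `⟨μ|x|λ⟩` is `(x • ket lam) mu`. -/
def ket (lam : Partition) : Space := Finsupp.single lam 1

/-- The function `ψ(z) = (q - q⁻¹ z) / (1 - z)`. -/
def psi (q z : ℂ) : ℂ := (q - q⁻¹ * z) / (1 - z)

/-- The expansion at `z = ∞`, a power series in `X = z⁻¹`, of
`ψ(a/z) = (q - q⁻¹ a z⁻¹) / (1 - a z⁻¹)`. -/
def psiAtInfty (q a : ℂ) : PowerSeries ℂ :=
  (PowerSeries.C q - PowerSeries.C (q⁻¹ * a) * PowerSeries.X) *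
    (1 - PowerSeries.C a * PowerSeries.X)⁻¹

/-- The expansion at `z = 0`, a power series in `X = z`, of
`ψ(a/z) = (q z - q⁻¹ a) / (z - a)`, for `a ≠ 0`. -/
def psiAtZero (q a : ℂ) : PowerSeries ℂ :=
  (PowerSeries.C q * PowerSeries.X - PowerSeries.C (q⁻¹ * a)) *
    (PowerSeries.X - PowerSeries.C a)⁻¹

variable (n : ℕ) (q d u : ℂ) (k : ZMod n)

/-- The congruence `λ_s + i ≡ s + k` for the row `s = t + 1`. -/
def CondA (lam : Partition) (i : ZMod n) (t : ℕ) : Prop :=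
  (lam.1 t : ZMod n) + i = ((t + 1 : ℕ) : ZMod n) + k

/-- The congruence `λ_s + i + 1 ≡ s + k` for the row `s = t + 1`. -/
def CondB (lam : Partition) (i : ZMod n) (t : ℕ) : Prop :=
  (lam.1 t : ZMod n) + i + 1 = ((t + 1 : ℕ) : ZMod n) + k

open Classical in
/-- The product
`∏_{s ∈ S, λ_s + i ≡ s + k} ψ(q₁^{λ_s-λ_j-1} q₃^{s-j}) ∏_{s ∈ S, λ_s + i + 1 ≡ s + k} ψ(q₁^{λ_j-λ_s} q₃^{j-s})`
over a finite set `S` of rows. -/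
def boxFactor (lam : Partition) (i : ZMod n) (j : ℕ) (S : Finset ℕ) : ℂ :=
  (∏ s ∈ S with CondA n k lam i s,
      psi q (q₁ q d ^ ((lam.1 s : ℤ) - lam.1 j - 1) * q₃ q d ^ ((s : ℤ) - j))) *
    ∏ s ∈ S with CondB n k lam i s,
      psi q (q₁ q d ^ ((lam.1 j : ℤ) - lam.1 s) * q₃ q d ^ ((j : ℤ) - s))

/-- The position `q₁^{λ_j} q₃^{j-1} u` of the box added to row `j`. -/
def boxPos (lam : Partition) (j : ℕ) : ℂ := q₁ q d ^ lam.1 j * q₃ q d ^ j * u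

open Classical in
/-- For a series `Ψ a` standing for an expansion of `ψ(a/z)`, the product
`∏_{s ∈ S, λ_s + i ≡ s + k} ψ(q₁^{λ_s-1} q₃^{s-1} u/z) ∏_{s ∈ S, λ_s + i + 1 ≡ s + k} ψ(q₁^{λ_s-1} q₃^{s-2} u/z)⁻¹`
over a finite set `S` of rows. -/
def cartanFactor (Ψ : ℂ → PowerSeries ℂ) (lam : Partition) (i : ZMod n) (S : Finset ℕ) :
    PowerSeries ℂ :=
  (∏ s ∈ S with CondA n k lam i s,
      Ψ (q₁ q d ^ ((lam.1 s : ℤ) - 1) * q₃ q d ^ (s : ℤ) * u)) *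
    ∏ s ∈ S with CondB n k lam i s,
      (Ψ (q₁ q d ^ ((lam.1 s : ℤ) - 1) * q₃ q d ^ ((s : ℤ) - 1) * u))⁻¹

/-- `r` is a row at which the infinite products of color `i` may be cut off: `λ_r = 0` and
`i ≡ r + k`. From the row `r` on, the factors of these products cancel in pairs because of
`ψ(q₂ z) ψ(1/z) = 1`. There are arbitrarily large such rows. -/
def IsCutoff (lam : Partition) (i : ZMod n) (r : ℕ) : Prop :=
  lam.1 r = 0 ∧ i = ((r + 1 : ℕ) : ZMod n) + k

/-- The partition `mu` is `lam + 1_j`, and the box added in row `j` has color `i`: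
`i + λ_j + 1 ≡ j + k`. -/
def AddsBox (i : ZMod n) (lam mu : Partition) (j : ℕ) : Prop :=
  mu.1 = lam.1 + Finsupp.single j 1 ∧
    i + (lam.1 j : ZMod n) + 1 = ((j + 1 : ℕ) : ZMod n) + k

/-- The action of `ℰ_n` on the space has the matrix coefficients that define `ℱ^{(k)}(u)`.
The coefficient of `z^{-m}` in `δ(a/z)` is `a ^ m`. The infinite products are finite products cut
off as described at `IsCutoff`; every admissible cut-off gives the value. -/
structure IsFockAction [Module (QToroidal n q d) Space] : Prop where
  E_add : ∀ (i : ZMod n) (m : ℤ) (lam mu : Partition) (j : ℕ), AddsBox n k i lam mu j →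
    (QToroidal.E n q d i m • ket lam) mu =
      boxFactor n q d k lam i j (Finset.range j) * boxPos q d u lam j ^ m
  E_other : ∀ (i : ZMod n) (m : ℤ) (lam mu : Partition), (∀ j, ¬ AddsBox n k i lam mu j) →
    (QToroidal.E n q d i m • ket lam) mu = 0
  F_remove : ∀ (i : ZMod n) (m : ℤ) (lam mu : Partition) (j : ℕ), AddsBox n k i lam mu j →
    ∀ r, j < r → IsCutoff n k lam i r →
      (QToroidal.F n q d i m • ket mu) lam =
        boxFactor n q d k lam i j (Finset.Ico (j + 1) r) * boxPos q d u lam j ^ m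
  F_other : ∀ (i : ZMod n) (m : ℤ) (lam mu : Partition), (∀ j, ¬ AddsBox n k i lam mu j) →
    (QToroidal.F n q d i m • ket mu) lam = 0
  Kplus_diag : ∀ (i : ZMod n) (m : ℕ) (lam : Partition) (r : ℕ), IsCutoff n k lam i r →
    (QToroidal.Kplus n q d i m • ket lam) lam =
      PowerSeries.coeff m (cartanFactor n q d u k (psiAtInfty q) lam i (Finset.range r))
  Kplus_other : ∀ (i : ZMod n) (m : ℕ) (lam mu : Partition), mu ≠ lam →
    (QToroidal.Kplus n q d i m • ket lam) mu = 0
  Kminus_diag : ∀ (i : ZMod n) (m : ℕ) (lam : Partition) (r : ℕ), IsCutoff n k lam i r →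
    (QToroidal.Kminus n q d i m • ket lam) lam =
      PowerSeries.coeff m (cartanFactor n q d u k (psiAtZero q) lam i (Finset.range r))
  Kminus_other : ∀ (i : ZMod n) (m : ℕ) (lam mu : Partition), mu ≠ lam →
    (QToroidal.Kminus n q d i m • ket lam) mu = 0

/-- The degree of the basis vector `[u]_j^{(k)}` of the vector representation: for `j = m n + r`
with `0 ≤ r < n` it is `m (1_0 + ⋯ + 1_{n-1}) + 1_k + 1_{k-1} + ⋯ + 1_{k-r}`. -/
def vectorDeg (j : ℤ) : ZMod n → ℤ :=
  (fun _ => j / n) + ∑ t ∈ Finset.range ((j % n).toNat + 1), Pi.single (k - (t : ZMod n)) 1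

/-- The degree of `|λ⟩`: `∑ᵣ (deg [u]_{λ_r - r} - deg [u]_{-r})`, a sum over the nonzero parts. -/
def deg (lam : Partition) : ZMod n → ℤ :=
  ∑ t ∈ lam.1.support,
    (vectorDeg n k ((lam.1 t : ℤ) - (t + 1)) - vectorDeg n k (-((t : ℤ) + 1)))

/-- The component of degree `β` of the space: the span of the `|λ⟩` of degree `β`. -/
def component (β : ZMod n → ℤ) : Submodule ℂ Space :=
  Submodule.span ℂ {v | ∃ lam : Partition, deg n k lam = β ∧ v = ket lam}

/-- The weight `(ψ(q₂ u / z)^{-δ_{ik}})ᵢ`, expanded at `z = ∞` and at `z = 0`. -/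
def lowestWeight : QToroidal.Weight n where
  plus i := if i = k then (psiAtInfty q (q₂ q * u))⁻¹ else 1
  minus i := if i = k then (psiAtZero q (q₂ q * u))⁻¹ else 1

end Fock

end

noncomputable section

open QuantumToroidal

/-- The parameters of a Fock space, together with the conditions on them. -/
structure FockDatum (n : ℕ) where
  q : ℂ
  d : ℂ
  u : ℂ
  k : ZMod n
  three_le : 3 ≤ n
  q_ne : q ≠ 0
  d_ne : d ≠ 0
  u_ne : u ≠ 0
  generic : IsGeneric q d

namespace FockDatum

variable {n : ℕ} (D : FockDatum n)

/-! ### Colors -/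

include D in
theorem one_ne_zero' : (1 : ZMod n) ≠ 0 := by
  have h := D.three_le
  intro h0
  have : ((1 : ℕ) : ZMod n) = 0 := by simpa using h0
  rw [ZMod.natCast_eq_zero_iff] at this
  have := Nat.le_of_dvd one_pos this
  omega

include D in
theorem two_ne_zero' : (1 + 1 : ZMod n) ≠ 0 := by
  have h := D.three_le
  intro h0
  have : ((2 : ℕ) : ZMod n) = 0 := by
    push_cast; rw [← h0]; norm_num
  rw [ZMod.natCast_eq_zero_iff] at this
  have := Nat.le_of_dvd two_pos this
  omega

include D in
theorem add_one_ne (i : ZMod n) : i + 1 ≠ i := fun h => D.one_ne_zero' (by simpa using h)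

include D in
theorem add_one_add_one_ne (i : ZMod n) : i + 1 + 1 ≠ i := fun h =>
  D.two_ne_zero' (by rw [add_assoc] at h; simpa using h)

/-! ### The parameters -/

/-- The parameter `q₁`. -/
def p₁ : ℂ := q₁ D.q D.d

/-- The parameter `q₃`. -/
def p₃ : ℂ := q₃ D.q D.d

theorem p₁_ne : D.p₁ ≠ 0 := div_ne_zero D.d_ne D.q_ne

theorem p₃_ne : D.p₃ ≠ 0 := one_div_ne_zero (mul_ne_zero D.d_ne D.q_ne)

theorem q_sq_ne : D.q ^ 2 ≠ 1 := by
  intro h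
  have := D.generic 0 1 0 (by simpa [q₂] using h)
  omega

theorem q_pow_four_ne : D.q ^ 4 ≠ 1 := by
  intro h
  have := D.generic 0 2 0 (by
    have : q₂ D.q ^ (2 : ℤ) = D.q ^ 4 := by
      rw [q₂]; norm_cast; ring
    simpa [this] using h)
  omega

theorem q_sub_inv_ne : D.q - D.q⁻¹ ≠ 0 := by
  intro h
  apply D.q_sq_ne
  have := D.q_ne
  field_simp at h
  linear_combination h

theorem zpow_mul_zpow_eq_one {a c : ℤ} (h : D.p₁ ^ a * D.p₃ ^ c = 1) : a = 0 ∧ c = 0 := by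
  have := D.generic a 0 c (by simpa [p₁, p₃] using h)
  omega

/-- The position of the box added to a row `s` of length `v`. -/
def pos (s : ℕ) (v : ℤ) : ℂ := D.p₁ ^ v * D.p₃ ^ s * D.u

/-- The color of the box added to a row `s` of length `v`. -/
def col (s : ℕ) (v : ℤ) : ZMod n := D.k + s - v

theorem col_add_one (s : ℕ) (v : ℤ) : D.col s (v + 1) + 1 = D.col s v := by
  simp only [col]; push_cast; ring

theorem col_succ (s : ℕ) (v : ℤ) : D.col (s + 1) v = D.col s v + 1 := by
  simp only [col]; push_cast; ring

theorem col_sub_one (s : ℕ) (v : ℤ) : D.col s (v - 1) = D.col s v + 1 := by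
  simp only [col]; push_cast; ring

theorem pos_ne_zero (s : ℕ) (v : ℤ) : D.pos s v ≠ 0 :=
  mul_ne_zero (mul_ne_zero (zpow_ne_zero _ D.p₁_ne) (pow_ne_zero _ D.p₃_ne)) D.u_ne

theorem pos_add_one (s : ℕ) (v : ℤ) : D.pos s (v + 1) = D.p₁ * D.pos s v := by
  simp only [pos, zpow_add_one₀ D.p₁_ne]; ring

theorem pos_sub_one (s : ℕ) (v : ℤ) : D.pos s (v - 1) = D.pos s v / D.p₁ := by
  rw [eq_div_iff D.p₁_ne, mul_comm, ← pos_add_one, sub_add_cancel]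

theorem pos_succ (s : ℕ) (v : ℤ) : D.pos (s + 1) v = D.p₃ * D.pos s v := by
  simp only [pos, pow_succ]; ring

theorem pos_div_pos (s s' : ℕ) (v v' : ℤ) :
    D.pos s v / D.pos s' v' = D.p₁ ^ (v - v') * D.p₃ ^ ((s : ℤ) - s') := by
  have h1 := D.u_ne
  have h2 := zpow_ne_zero v' D.p₁_ne
  have h3 := pow_ne_zero s' D.p₃_ne
  rw [zpow_sub₀ D.p₁_ne, zpow_sub₀ D.p₃_ne, zpow_natCast, zpow_natCast]
  simp only [pos]
  field_simp

theorem pos_inj {s s' : ℕ} {v v' : ℤ} (h : D.pos s v = D.pos s' v') : s = s' ∧ v = v' := by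
  have h1 := D.pos_div_pos s s' v v'
  rw [h, div_self (D.pos_ne_zero _ _)] at h1
  have := D.zpow_mul_zpow_eq_one h1.symm
  omega

theorem pos_ne {s s' : ℕ} (h : s ≠ s') (v v' : ℤ) : D.pos s v ≠ D.pos s' v' :=
  fun h' => h (D.pos_inj h').1

theorem p₁_mul_p₃ : D.p₁ * D.p₃ = (D.q ^ 2)⁻¹ := by
  have := D.q_ne; have := D.d_ne
  simp only [p₁, p₃, q₁, q₃]; field_simp

/-! ### The function `ψ` -/

/-- The function `ψ` with the parameter `q` of the Fock space. -/
def psi (z : ℂ) : ℂ := Fock.psi D.q z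

theorem psi_def (z : ℂ) : D.psi z = (D.q - D.q⁻¹ * z) / (1 - z) := rfl

theorem psi_sq : D.psi (D.q ^ 2) = 0 := by
  have := D.q_ne
  rw [psi_def, div_eq_zero_iff]; left; field_simp; ring

theorem psi_eq_zero_iff {z : ℂ} (hz : z ≠ 1) : D.psi z = 0 ↔ z = D.q ^ 2 := by
  have h := D.q_ne
  have h1 : 1 - z ≠ 0 := sub_ne_zero.2 (Ne.symm hz)
  rw [psi_def, div_eq_zero_iff, or_iff_left h1]
  constructor
  · intro h2; field_simp at h2; linear_combination -h2
  · rintro rfl; field_simp; ring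

theorem psi_div {z w : ℂ} (hw : w ≠ 0) :
    D.psi (z / w) = (D.q * w - D.q⁻¹ * z) / (w - z) := by
  rw [psi_def]
  by_cases h : w = z
  · subst h; simp [hw]
  · have h1 : w - z ≠ 0 := sub_ne_zero.2 h
    have h2 : 1 - z / w ≠ 0 := by
      rw [one_sub_div hw]; exact div_ne_zero h1 hw
    field_simp

theorem psi_mul_psi {z : ℂ} (h0 : z ≠ 0) (h1 : z ≠ 1) (h2 : D.q ^ 2 * z ≠ 1) :
    D.psi (D.q ^ 2 * z) * D.psi (1 / z) = 1 := by
  have h := D.q_ne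
  have h3 : 1 - D.q ^ 2 * z ≠ 0 := sub_ne_zero.2 (Ne.symm h2)
  have h4 : z - 1 ≠ 0 := sub_ne_zero.2 h1
  have h5 : 1 - 1 / z ≠ 0 := by rw [one_sub_div h0]; exact div_ne_zero h4 h0
  rw [psi_def, psi_def, div_mul_div_comm, div_eq_one_iff_eq (mul_ne_zero h3 h5)]
  field_simp
  ring

theorem psi_add_psi {z w : ℂ} (hz : z ≠ 0) (hw : w ≠ 0) (h : z ≠ w) :
    D.psi (z / w) + D.psi (w / z) = D.q + D.q⁻¹ := by
  have h1 : w - z ≠ 0 := sub_ne_zero.2 (Ne.symm h)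
  have h2 : z - w ≠ 0 := sub_ne_zero.2 h
  have := D.q_ne
  rw [psi_div D hw, psi_div D hz]
  field_simp
  ring

/-! ### The factor of a row -/

/-- The contribution of the last box of a row. -/
def rowA (i : ZMod n) (s : ℕ) (v : ℤ) (z : ℂ) : ℂ :=
  if i = D.col s v + 1 then D.psi (D.pos s (v - 1) / z) else 1

/-- The contribution of the box that can be added to a row. -/
def rowB (i : ZMod n) (s : ℕ) (v : ℤ) (z : ℂ) : ℂ :=
  if i = D.col s v then D.psi (z / D.pos s v) else 1

/-- The contribution of a row. -/
def rowG (i : ZMod n) (s : ℕ) (v : ℤ) (z : ℂ) : ℂ := D.rowA i s v z * D.rowB i s v z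

theorem rowA_mul_rowB_succ (i : ZMod n) (s : ℕ) (v : ℤ) {z : ℂ} (hz : z ≠ 0)
    (h1 : z ≠ D.pos s (v - 1)) (h2 : z ≠ D.pos (s + 1) v) :
    D.rowA i s v z * D.rowB i (s + 1) v z = 1 := by
  rw [rowA, rowB, col_succ]
  split_ifs with h
  · have hx := D.pos_ne_zero (s + 1) v
    have key : D.pos s (v - 1) = D.q ^ 2 * D.pos (s + 1) v := by
      have := D.p₁_mul_p₃
      have hp := D.p₁_ne
      have hq := D.q_ne
      rw [pos_succ, pos_sub_one]
      field_simp at this ⊢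
      linear_combination -D.pos s v * this
    have := D.psi_mul_psi (z := D.pos (s + 1) v / z) (div_ne_zero hx hz)
      (fun h => h2 ((div_eq_one_iff_eq hz).1 h).symm)
      (fun h => h1 (by
        rw [key]; rw [mul_div_assoc', div_eq_one_iff_eq hz] at h; exact h.symm))
    rw [key]
    rw [one_div_div] at this
    rw [mul_div_assoc]
    exact this
  · simp

/-- The factor picked up by the second of two added boxes in different rows, the first of
color `j` at the position `w`, the second of color `i` at the position `z`. -/
def bef (i j : ZMod n) (z w : ℂ) : ℂ :=
  if j = i then D.psi (w / z) else if j = i + 1 then D.psi (z / (D.p₁ * w)) else 1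

theorem rowG_eq_bef (j : ZMod n) (s : ℕ) (v : ℤ) (w : ℂ) :
    D.rowG j s v w = D.bef (D.col s v) j (D.pos s v) w := by
  have h1 := D.add_one_ne (D.col s v)
  rw [rowG, rowA, rowB, bef, pos_sub_one]
  by_cases h : j = D.col s v
  · subst h
    rw [if_neg (Ne.symm h1)]; simp
  · rw [if_neg h, if_neg h, mul_one, div_div]

theorem rowG_add_one_eq_bef (j : ZMod n) (s : ℕ) (v : ℤ) (w : ℂ) :
    D.rowG j s (v + 1) w = D.bef j (D.col s v) w (D.pos s v) := by
  have h1 := D.add_one_ne j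
  rw [rowG, rowA, rowB, bef, col_add_one, add_sub_cancel_right, pos_add_one]
  by_cases h : j = D.col s v
  · subst h
    rw [if_pos rfl, if_pos rfl, if_neg, mul_one]
    intro h2
    have := D.col_add_one s v
    rw [← h2] at this
    exact h1 this
  · rw [if_neg h, if_neg (Ne.symm h), one_mul]
    have : j = D.col s (v + 1) ↔ D.col s v = j + 1 := by
      rw [← D.col_add_one s v]
      exact ⟨fun h => by rw [h], fun h => (add_right_cancel h).symm⟩
    simp only [this]

theorem bef_exchange (i j : ZMod n) {z w : ℂ} (hz : z ≠ 0) (hw : w ≠ 0) (h0 : z ≠ w)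
    (h1 : z ≠ D.p₁ * w) (h2 : w ≠ D.p₁ * z) :
    (D.d ^ mMatrix i j * z - D.q ^ cartan i j * w) * D.bef i j z w =
      (D.d ^ mMatrix i j * D.q ^ cartan i j * z - w) * D.bef j i w z := by
  have hq := D.q_ne
  have hd := D.d_ne
  have hp := D.p₁_ne
  have e1 := D.add_one_ne
  have e2 := D.add_one_add_one_ne
  have g0 : z - w ≠ 0 := sub_ne_zero.2 h0
  have g0' : w - z ≠ 0 := sub_ne_zero.2 h0.symm
  have hp' : D.p₁ = D.d / D.q := rfl
  by_cases hij : j = i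
  · subst hij
    simp only [mMatrix, cartan, bef, if_true, if_neg (Ne.symm (e1 j)), D.psi_div hz, D.psi_div hw]
    rw [zpow_zero]
    field_simp
    ring
  · have hji : ¬ i = j := fun h => hij h.symm
    by_cases hs : j = i + 1
    · subst hs
      simp only [mMatrix, cartan, bef, if_true, true_or, if_neg (e1 i), if_neg hji,
        if_neg (Ne.symm (e2 i)), D.psi_div (mul_ne_zero hp hw)]
      rw [zpow_neg_one, zpow_neg_one, mul_one]
      have g3 : D.d * w - z * D.q ≠ 0 := by
        intro h
        apply h1
        rw [hp']; field_simp; linear_combination -h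
      rw [hp']
      field_simp
      ring
    · by_cases hs' : i = j + 1
      · subst hs'
        simp only [mMatrix, cartan, bef, if_true, or_true, if_neg (e1 j), if_neg hij,
          if_neg (Ne.symm (e2 j)), D.psi_div (mul_ne_zero hp hz)]
        rw [zpow_one, zpow_neg_one, mul_one]
        have g3 : D.d * z - D.q * w ≠ 0 := by
          intro h
          apply h2
          rw [hp']; field_simp; linear_combination -h
        rw [hp']
        field_simp
      · simp only [mMatrix, cartan, bef, if_neg hji,
          false_or, hij, hs, hs', if_false]
        simp

theorem bef_of_far {i j : ZMod n} (h0 : i ≠ j) (h1 : i ≠ j + 1) (h2 : i ≠ j - 1) (z w : ℂ) :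
    D.bef i j z w = 1 := by
  rw [bef, if_neg (Ne.symm h0), if_neg]
  rintro rfl
  exact h2 (by simp)

end FockDatum

/-- Sequences of integers with finitely many nonzero terms: the lengths of the rows. -/
abbrev RowSeq : Type := ℕ →₀ ℤ

/-- Add a box to the row `a`. -/
def RowSeq.inc (lam : RowSeq) (a : ℕ) : RowSeq := lam + Finsupp.single a 1

namespace RowSeq

theorem inc_self (lam : RowSeq) (a : ℕ) : lam.inc a a = lam a + 1 := by simp [inc]

theorem inc_of_ne (lam : RowSeq) {a b : ℕ} (h : a ≠ b) : lam.inc a b = lam b := by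
  simp [inc, h]

theorem inc_comm (lam : RowSeq) (a b : ℕ) : (lam.inc a).inc b = (lam.inc b).inc a := by
  simp [inc, add_right_comm]

/-- All rows from `N` on are empty. -/
def Bdd (lam : RowSeq) (N : ℕ) : Prop := ∀ s, N ≤ s → lam s = 0

theorem exists_bdd (lam : RowSeq) : ∃ N, lam.Bdd N := by
  refine ⟨lam.support.sup id + 1, fun s hs => ?_⟩
  by_contra h
  have := Finset.le_sup (f := id) (Finsupp.mem_support_iff.2 h)
  simp only [id] at this
  omega

theorem Bdd.mono {lam : RowSeq} {N M : ℕ} (h : lam.Bdd N) (hM : N ≤ M) : lam.Bdd M :=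
  fun s hs => h s (hM.trans hs)

end RowSeq

/-- Coefficients of the operators adding a box to a row, where the coefficient for the row `a`
is a product of contributions of the rows preceding `a` with respect to some order. -/
structure Dressing {n : ℕ} (D : FockDatum n) where
  lt : ℕ → ℕ → Prop
  coef : ZMod n → RowSeq → ℕ → ℂ
  tri : ∀ a b, a ≠ b → (lt a b ∧ ¬ lt b a) ∨ (lt b a ∧ ¬ lt a b)
  coef_zero : ∀ i lam a, D.col a (lam a) ≠ i → coef i lam a = 0
  coef_eq : ∀ N i a, ∃ (S : Finset ℕ) (C : ℂ → ℂ), (∀ s ∈ S, lt s a) ∧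
    (∀ s, lt s a → s < N → s ∈ S) ∧ ∀ lam : RowSeq, lam.Bdd N → D.col a (lam a) = i →
      coef i lam a = C (D.pos a (lam a)) * ∏ s ∈ S, D.rowG i s (lam s) (D.pos a (lam a))

namespace Dressing

variable {n : ℕ} {D : FockDatum n} (X : Dressing D)

open Classical in
/-- The contribution of the row `b` of length `v` to the coefficient for the row `a`. -/
def theta (i : ZMod n) (b a : ℕ) (v : ℤ) (z : ℂ) : ℂ :=
  if X.lt b a then D.rowG i b v z else 1

theorem coef_agree (i : ZMod n) (lam : RowSeq) {a b c : ℕ} (hb : b ≠ a) (hc : c ≠ a)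
    (hbc : b ≠ c) : ∃ R : ℂ, ∀ mu : RowSeq, (∀ s, s ≠ b → s ≠ c → mu s = lam s) →
      X.coef i mu a = R * (X.theta i b a (mu b) (D.pos a (lam a)) *
        X.theta i c a (mu c) (D.pos a (lam a))) := by
  classical
  by_cases hcol : D.col a (lam a) = i
  swap
  · refine ⟨0, fun mu h => ?_⟩
    rw [zero_mul]
    apply X.coef_zero
    rwa [h a hb.symm hc.symm]
  obtain ⟨N, hN⟩ := lam.exists_bdd
  obtain ⟨S, C, hS1, hS2, hS⟩ := X.coef_eq (N + b + c + 1) i a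
  set z := D.pos a (lam a) with hz
  refine ⟨C z * ∏ s ∈ (S.erase b).erase c, D.rowG i s (lam s) z, fun mu h => ?_⟩
  have hmem : ∀ s, s < N + b + c + 1 → (s ∈ S ↔ X.lt s a) :=
    fun s hs => ⟨hS1 s, fun h => hS2 s h hs⟩
  have ha := h a hb.symm hc.symm
  rw [hS mu (fun s hs => by rw [h s (by omega) (by omega)]; exact hN s (by omega))
    (by rw [ha]; exact hcol), ha, ← hz]
  have e1 : ∀ (T : Finset ℕ) (x : ℕ), ∏ s ∈ T, D.rowG i s (mu s) z =
      (if x ∈ T then D.rowG i x (mu x) z else 1) * ∏ s ∈ T.erase x, D.rowG i s (mu s) z := by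
    intro T x
    split_ifs with hx
    · rw [Finset.mul_prod_erase _ (fun s => D.rowG i s (mu s) z) hx]
    · rw [Finset.erase_eq_of_notMem hx, one_mul]
  rw [e1 S b, e1 (S.erase b) c]
  have e2 : ∏ s ∈ (S.erase b).erase c, D.rowG i s (mu s) z =
      ∏ s ∈ (S.erase b).erase c, D.rowG i s (lam s) z := by
    refine Finset.prod_congr rfl fun s hs => ?_
    simp only [Finset.mem_erase] at hs
    rw [h s hs.2.1 hs.1]
  simp only [Finset.mem_erase, hbc.symm, ne_eq, not_false_eq_true, true_and]
  simp only [e2, theta, hmem b (by omega), hmem c (by omega)]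
  ring

theorem theta_mul_theta {a b : ℕ} (hab : a ≠ b) {i j : ZMod n} {v w : ℤ}
    (hi : D.col a v = i) (hj : D.col b w = j) :
    X.theta j a b (v + 1) (D.pos b w) * X.theta i b a w (D.pos a v) =
      D.bef j i (D.pos b w) (D.pos a v) := by
  rcases X.tri a b hab with ⟨h, h'⟩ | ⟨h, h'⟩
  · rw [theta, theta, if_pos h, if_neg h', mul_one, D.rowG_add_one_eq_bef, hi]
  · rw [theta, theta, if_pos h, if_neg h', one_mul, D.rowG_eq_bef, hj]

/-- The coefficient of `z^{-m}` in the operator of color `i`. -/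
def term (i : ZMod n) (m : ℤ) (lam : RowSeq) (a : ℕ) : ℂ :=
  X.coef i lam a * D.pos a (lam a) ^ m

theorem term_zero {i : ZMod n} {lam : RowSeq} {a : ℕ} (h : D.col a (lam a) ≠ i) (m : ℤ) :
    X.term i m lam a = 0 := by
  rw [term, X.coef_zero i lam a h, zero_mul]

theorem coef_mul_coef (i j : ZMod n) (lam : RowSeq) {a b : ℕ} (hab : a ≠ b)
    (hi : D.col a (lam a) = i) (hj : D.col b (lam b) = j) :
    ∃ R : ℂ, X.coef j lam b * X.coef i (lam.inc b) a =
        R * D.bef i j (D.pos a (lam a)) (D.pos b (lam b)) ∧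
      X.coef i lam a * X.coef j (lam.inc a) b =
        R * D.bef j i (D.pos b (lam b)) (D.pos a (lam a)) := by
  have hc1 : a + b + 1 ≠ a := by omega
  have hc2 : a + b + 1 ≠ b := by omega
  obtain ⟨Ra, hRa⟩ := X.coef_agree i lam hab.symm hc1 hc2.symm
  obtain ⟨Rb, hRb⟩ := X.coef_agree j lam hab hc2 hc1.symm
  have h1 := X.theta_mul_theta hab hi hj
  have h2 := X.theta_mul_theta hab.symm hj hi
  refine ⟨Ra * X.theta i (a + b + 1) a (lam (a + b + 1)) (D.pos a (lam a)) *
    (Rb * X.theta j (a + b + 1) b (lam (a + b + 1)) (D.pos b (lam b))), ?_, ?_⟩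
  · rw [hRa (lam.inc b) (fun s h _ => lam.inc_of_ne h.symm), hRb lam (fun _ _ _ => rfl),
      lam.inc_self, lam.inc_of_ne hc2.symm, ← h2]
    ring
  · rw [hRb (lam.inc a) (fun s h _ => lam.inc_of_ne h.symm), hRa lam (fun _ _ _ => rfl),
      lam.inc_self, lam.inc_of_ne hc1.symm, ← h1]
    ring

theorem exchange (i j : ZMod n) (r s : ℤ) (lam : RowSeq) (a c : ℕ) :
    D.d ^ mMatrix i j * (X.term j s lam c * X.term i (r + 1) (lam.inc c) a) -
      D.q ^ cartan i j * (X.term j (s + 1) lam c * X.term i r (lam.inc c) a) =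
    D.d ^ mMatrix i j * D.q ^ cartan i j *
        (X.term i (r + 1) lam a * X.term j s (lam.inc a) c) -
      X.term i r lam a * X.term j (s + 1) (lam.inc a) c := by
  have hq := D.q_ne
  have hd := D.d_ne
  have hp' : D.p₁ = D.d / D.q := rfl
  by_cases hac : a = c
  · subst hac
    have hx := D.pos_ne_zero a (lam a)
    have hx' := D.pos_ne_zero a (lam a + 1)
    have e1 : D.d ^ mMatrix i j * (X.term j s lam a * X.term i (r + 1) (lam.inc a) a) -
        D.q ^ cartan i j * (X.term j (s + 1) lam a * X.term i r (lam.inc a) a) = 0 := by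
      by_cases h1 : D.col a (lam a) = j
      swap
      · simp [X.term_zero h1]
      by_cases h2 : D.col a (lam a + 1) = i
      swap
      · have : D.col a (lam.inc a a) ≠ i := by rwa [lam.inc_self]
        simp [X.term_zero this]
      have h3 : j = i + 1 := by rw [← h1, ← h2, D.col_add_one]
      subst h3
      simp only [term, lam.inc_self, mMatrix, cartan, true_or, if_true,
        if_neg (Ne.symm (D.add_one_ne i))]
      rw [zpow_add_one₀ hx, zpow_add_one₀ hx', D.pos_add_one, zpow_neg_one, zpow_neg_one, hp']
      field_simp
      ring
    have e2 : D.d ^ mMatrix i j * D.q ^ cartan i j *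
        (X.term i (r + 1) lam a * X.term j s (lam.inc a) a) -
        X.term i r lam a * X.term j (s + 1) (lam.inc a) a = 0 := by
      by_cases h1 : D.col a (lam a) = i
      swap
      · simp [X.term_zero h1]
      by_cases h2 : D.col a (lam a + 1) = j
      swap
      · have : D.col a (lam.inc a a) ≠ j := by rwa [lam.inc_self]
        simp [X.term_zero this]
      have h3 : i = j + 1 := by rw [← h1, ← h2, D.col_add_one]
      subst h3
      simp only [term, lam.inc_self, mMatrix, cartan, or_true, if_true,
        if_neg (D.add_one_ne j), if_neg (Ne.symm (D.add_one_add_one_ne j))]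
      rw [zpow_add_one₀ hx, zpow_add_one₀ hx', D.pos_add_one, zpow_one, zpow_neg_one, hp']
      field_simp
      ring
    rw [e1, e2]
  · have ea : lam.inc c a = lam a := lam.inc_of_ne (Ne.symm hac)
    have ec : lam.inc a c = lam c := lam.inc_of_ne hac
    by_cases hi : D.col a (lam a) = i
    swap
    · have hi' : D.col a (lam.inc c a) ≠ i := by rwa [ea]
      simp [X.term_zero hi, X.term_zero hi']
    by_cases hj : D.col c (lam c) = j
    swap
    · have hj' : D.col c (lam.inc a c) ≠ j := by rwa [ec]
      simp [X.term_zero hj, X.term_zero hj']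
    obtain ⟨R, h1, h2⟩ := X.coef_mul_coef i j lam hac hi hj
    have hz := D.pos_ne_zero a (lam a)
    have hw := D.pos_ne_zero c (lam c)
    have h3 := D.bef_exchange i j hz hw (D.pos_ne hac _ _)
      (by rw [← D.pos_add_one]; exact D.pos_ne hac _ _)
      (by rw [← D.pos_add_one]; exact D.pos_ne (Ne.symm hac) _ _)
    simp only [term, ea, ec]
    rw [zpow_add_one₀ hz, zpow_add_one₀ hw]
    linear_combination
      (D.d ^ mMatrix i j * D.pos a (lam a) - D.q ^ cartan i j * D.pos c (lam c)) *
        D.pos a (lam a) ^ r * D.pos c (lam c) ^ s * h1 -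
      (D.d ^ mMatrix i j * D.q ^ cartan i j * D.pos a (lam a) - D.pos c (lam c)) *
        D.pos a (lam a) ^ r * D.pos c (lam c) ^ s * h2 +
      R * D.pos a (lam a) ^ r * D.pos c (lam c) ^ s * h3

theorem commute_of_far {i j : ZMod n} (h0 : i ≠ j) (h1 : i ≠ j + 1) (h2 : i ≠ j - 1) (r s : ℤ)
    (lam : RowSeq) (a c : ℕ) :
    X.term j s lam c * X.term i r (lam.inc c) a = X.term i r lam a * X.term j s (lam.inc a) c := by
  by_cases hac : a = c
  · subst hac
    have e : ∀ {i j : ZMod n}, j ≠ i + 1 → ∀ r s : ℤ,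
        X.term j s lam a * X.term i r (lam.inc a) a = 0 := by
      intro i j hij r s
      by_cases h1 : D.col a (lam a) = j
      swap
      · simp [X.term_zero h1]
      by_cases h2 : D.col a (lam a + 1) = i
      swap
      · have : D.col a (lam.inc a a) ≠ i := by rwa [lam.inc_self]
        simp [X.term_zero this]
      exact absurd (by rw [← h1, ← h2, D.col_add_one]) hij
    rw [e (fun h => h2 (by rw [h]; ring)), e h1]
  · have ea : lam.inc c a = lam a := lam.inc_of_ne (Ne.symm hac)
    have ec : lam.inc a c = lam c := lam.inc_of_ne hac
    by_cases hi : D.col a (lam a) = i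
    swap
    · have hi' : D.col a (lam.inc c a) ≠ i := by rwa [ea]
      simp [X.term_zero hi, X.term_zero hi']
    by_cases hj : D.col c (lam c) = j
    swap
    · have hj' : D.col c (lam.inc a c) ≠ j := by rwa [ec]
      simp [X.term_zero hj, X.term_zero hj']
    obtain ⟨R, e1, e2⟩ := X.coef_mul_coef i j lam hac hi hj
    rw [D.bef_of_far h0 h1 h2] at e1
    rw [D.bef_of_far h0.symm (fun h => h2 (by rw [h]; ring)) (fun h => h1 (by rw [h]; ring))] at e2
    simp only [term, ea, ec]
    linear_combination D.pos a (lam a) ^ r * D.pos c (lam c) ^ s * (e1 - e2)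

end Dressing

namespace FockDatum

variable {n : ℕ} (D : FockDatum n)

theorem bef_param (i j : ZMod n) (ha : (D.q ^ cartan i j) ^ 2 ≠ 1) {z w : ℂ} (hz : z ≠ 0)
    (hw : w ≠ 0) (h0 : z ≠ w) (h1 : z ≠ D.p₁ * w) (h2 : w ≠ D.p₁ * z) :
    ∃ N : ℂ, D.bef i j z w = N * (D.d ^ mMatrix i j * D.q ^ cartan i j * z - w) ∧
      D.bef j i w z = N * (D.d ^ mMatrix i j * z - D.q ^ cartan i j * w) := by
  have h := D.bef_exchange i j hz hw h0 h1 h2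
  by_cases h3 : D.d ^ mMatrix i j * z - D.q ^ cartan i j * w = 0
  · have h4 : D.d ^ mMatrix i j * D.q ^ cartan i j * z - w ≠ 0 := by
      intro h4
      apply ha
      apply mul_right_cancel₀ hw
      linear_combination h4 - D.q ^ cartan i j * h3
    refine ⟨D.bef i j z w / (D.d ^ mMatrix i j * D.q ^ cartan i j * z - w), ?_, ?_⟩
    · field_simp
    · rw [h3, zero_mul] at h
      rw [h3, mul_zero]
      exact (mul_eq_zero.1 h.symm).resolve_left h4
  · refine ⟨D.bef j i w z / (D.d ^ mMatrix i j * z - D.q ^ cartan i j * w), ?_, ?_⟩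
    · field_simp
      linear_combination h
    · field_simp

theorem cartan_self (i : ZMod n) : cartan i i = 2 := by simp [cartan]

include D in
theorem mMatrix_self (i : ZMod n) : mMatrix i i = 0 := by
  have := D.add_one_ne i
  simp [mMatrix, this.symm]

include D in
theorem cartan_adj {i j : ZMod n} (h : j = i + 1 ∨ j = i - 1) : cartan i j = -1 := by
  have h1 := D.add_one_ne i
  have h2 := D.add_one_ne j
  rcases h with rfl | h
  · simp [cartan, Ne.symm h1]
  · have : i = j + 1 := by rw [h]; ring
    subst this
    simp [cartan, h2]

theorem bef_serre {i j : ZMod n} (hj : j = i + 1 ∨ j = i - 1) {x y w : ℂ} (hx : x ≠ 0)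
    (hy : y ≠ 0) (hw : w ≠ 0) (h1 : x ≠ y) (h2 : x ≠ D.p₁ * y) (h3 : y ≠ D.p₁ * x)
    (h4 : x ≠ w) (h5 : x ≠ D.p₁ * w) (h6 : w ≠ D.p₁ * x)
    (h7 : y ≠ w) (h8 : y ≠ D.p₁ * w) (h9 : w ≠ D.p₁ * y) :
    D.bef i i x y * D.bef i j x w * D.bef i j y w
      - (D.q + D.q⁻¹) * (D.bef i i x y * D.bef i j x w * D.bef j i w y)
      + D.bef i i x y * D.bef j i w x * D.bef j i w y
      + (D.bef i i y x * D.bef i j x w * D.bef i j y w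
      - (D.q + D.q⁻¹) * (D.bef i i y x * D.bef j i w x * D.bef i j y w)
      + D.bef i i y x * D.bef j i w x * D.bef j i w y) = 0 := by
  have hq := D.q_ne
  have g1 : (D.q ^ cartan i i) ^ 2 ≠ 1 := by
    rw [cartan_self]; norm_cast; rw [← pow_mul]; exact D.q_pow_four_ne
  have g2 : (D.q ^ cartan i j) ^ 2 ≠ 1 := by
    rw [D.cartan_adj hj, zpow_neg_one, inv_pow]
    exact fun h => D.q_sq_ne (inv_eq_one.1 h)
  obtain ⟨N₁, a1, b1⟩ := D.bef_param i i g1 hx hy h1 h2 h3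
  obtain ⟨N₂, a2, b2⟩ := D.bef_param i j g2 hx hw h4 h5 h6
  obtain ⟨N₃, a3, b3⟩ := D.bef_param i j g2 hy hw h7 h8 h9
  rw [a1, b1, a2, b2, a3, b3, D.cartan_adj hj, cartan_self, D.mMatrix_self, zpow_neg_one,
    zpow_zero, zpow_ofNat]
  generalize D.d ^ mMatrix i j = δ
  field_simp
  ring

end FockDatum

namespace Dressing

variable {n : ℕ} {D : FockDatum n} (X : Dressing D)

theorem coef_agree_two (i : ZMod n) (lam : RowSeq) {a b : ℕ} (hb : b ≠ a) :
    ∃ R : ℂ, ∀ mu : RowSeq, (∀ s, s ≠ b → mu s = lam s) →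
      X.coef i mu a = R * X.theta i b a (mu b) (D.pos a (lam a)) := by
  have hc1 : a + b + 1 ≠ a := by omega
  have hc2 : a + b + 1 ≠ b := by omega
  obtain ⟨R, hR⟩ := X.coef_agree i lam hb hc1 hc2.symm
  refine ⟨R * X.theta i (a + b + 1) a (lam (a + b + 1)) (D.pos a (lam a)), fun mu h => ?_⟩
  rw [hR mu (fun s h1 _ => h s h1), h _ hc2]
  ring

theorem term_mul_zero {i j : ZMod n} {lam mu : RowSeq} {a : ℕ} (hmu : mu a = lam a + 1)
    (h : j ≠ i + 1) (r s : ℤ) : X.term j s lam a * X.term i r mu a = 0 := by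
  by_cases h1 : D.col a (lam a) = j
  · have h2 : D.col a (mu a) ≠ i := by
      rintro rfl
      rw [hmu, D.col_add_one] at h
      exact h h1.symm
    rw [X.term_zero h2, mul_zero]
  · rw [X.term_zero h1, zero_mul]

theorem serre_distinct {i j : ZMod n} (hj : j = i + 1 ∨ j = i - 1) (r s t : ℤ) (lam : RowSeq)
    {a b c : ℕ} (hab : a ≠ b) (hac : a ≠ c) (hbc : b ≠ c) :
    X.term j t lam c * X.term i s (lam.inc c) b * X.term i r ((lam.inc c).inc b) a
      - (D.q + D.q⁻¹) *
        (X.term i s lam b * X.term j t (lam.inc b) c * X.term i r ((lam.inc b).inc c) a)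
      + X.term i s lam b * X.term i r (lam.inc b) a * X.term j t ((lam.inc b).inc a) c
      + (X.term j t lam c * X.term i r (lam.inc c) a * X.term i s ((lam.inc c).inc a) b
      - (D.q + D.q⁻¹) *
        (X.term i r lam a * X.term j t (lam.inc a) c * X.term i s ((lam.inc a).inc c) b)
      + X.term i r lam a * X.term i s (lam.inc a) b * X.term j t ((lam.inc a).inc b) c) = 0 := by
  have hba := hab.symm
  have hca := hac.symm
  have hcb := hbc.symm
  have v : ∀ (mu : RowSeq) {x y : ℕ}, x ≠ y → mu.inc x y = mu y := fun mu _ _ h => mu.inc_of_ne h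
  by_cases hA : D.col a (lam a) = i
  swap
  · simp [X.term_zero, v, hA, hba, hca]
  by_cases hB : D.col b (lam b) = i
  swap
  · simp [X.term_zero, v, hB, hab, hcb]
  by_cases hC : D.col c (lam c) = j
  swap
  · simp [X.term_zero, v, hC, hac, hbc]
  obtain ⟨Ra, hRa⟩ := X.coef_agree i lam hba hca hbc
  obtain ⟨Rb, hRb⟩ := X.coef_agree i lam hab hcb hac
  obtain ⟨Rc, hRc⟩ := X.coef_agree j lam hac hbc hab
  have ab := X.theta_mul_theta hab hA hB
  have ba := X.theta_mul_theta hba hB hA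
  have ac := X.theta_mul_theta hac hA hC
  have ca := X.theta_mul_theta hca hC hA
  have bc := X.theta_mul_theta hbc hB hC
  have cb := X.theta_mul_theta hcb hC hB
  have key := D.bef_serre hj (D.pos_ne_zero a (lam a)) (D.pos_ne_zero b (lam b))
    (D.pos_ne_zero c (lam c)) (D.pos_ne hab _ _)
    (by rw [← D.pos_add_one]; exact D.pos_ne hab _ _)
    (by rw [← D.pos_add_one]; exact D.pos_ne hba _ _) (D.pos_ne hac _ _)
    (by rw [← D.pos_add_one]; exact D.pos_ne hac _ _)
    (by rw [← D.pos_add_one]; exact D.pos_ne hca _ _) (D.pos_ne hbc _ _)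
    (by rw [← D.pos_add_one]; exact D.pos_ne hbc _ _)
    (by rw [← D.pos_add_one]; exact D.pos_ne hcb _ _)
  rw [← ab, ← ba, ← ac, ← ca, ← bc, ← cb] at key
  have w : ∀ (mu : RowSeq) (x : ℕ), mu.inc x x = mu x + 1 := fun mu x => mu.inc_self x
  simp only [term]
  rw [hRc lam (fun _ _ _ => rfl), hRb lam (fun _ _ _ => rfl), hRa lam (fun _ _ _ => rfl),
    hRb (lam.inc c) (fun s h1 h2 => v _ h2.symm), hRa (lam.inc c) (fun s h1 h2 => v _ h2.symm),
    hRa (lam.inc b) (fun s h1 h2 => v _ h1.symm), hRc (lam.inc b) (fun s h1 h2 => v _ h2.symm),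
    hRb (lam.inc a) (fun s h1 h2 => v _ h1.symm), hRc (lam.inc a) (fun s h1 h2 => v _ h1.symm),
    hRa ((lam.inc c).inc b) (fun s h1 h2 => by rw [v _ h1.symm, v _ h2.symm]),
    hRa ((lam.inc b).inc c) (fun s h1 h2 => by rw [v _ h2.symm, v _ h1.symm]),
    hRc ((lam.inc b).inc a) (fun s h1 h2 => by rw [v _ h1.symm, v _ h2.symm]),
    hRb ((lam.inc c).inc a) (fun s h1 h2 => by rw [v _ h1.symm, v _ h2.symm]),
    hRb ((lam.inc a).inc c) (fun s h1 h2 => by rw [v _ h2.symm, v _ h1.symm]),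
    hRc ((lam.inc a).inc b) (fun s h1 h2 => by rw [v _ h2.symm, v _ h1.symm])]
  simp only [v _ hab, v _ hba, v _ hac, v _ hca, v _ hbc, v _ hcb, w]
  linear_combination Ra * Rb * Rc * D.pos a (lam a) ^ r * D.pos b (lam b) ^ s *
    D.pos c (lam c) ^ t * key

theorem serre_same {i j : ZMod n} (hj : j = i + 1 ∨ j = i - 1) (r s t : ℤ) (lam : RowSeq)
    {a b : ℕ} (hab : a ≠ b) :
    X.term j t lam a * X.term i s (lam.inc a) b * X.term i r ((lam.inc a).inc b) a
      - (D.q + D.q⁻¹) *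
        (X.term i s lam b * X.term j t (lam.inc b) a * X.term i r ((lam.inc b).inc a) a)
      + X.term i s lam b * X.term i r (lam.inc b) a * X.term j t ((lam.inc b).inc a) a
      + (X.term j t lam a * X.term i r (lam.inc a) a * X.term i s ((lam.inc a).inc a) b
      - (D.q + D.q⁻¹) *
        (X.term i r lam a * X.term j t (lam.inc a) a * X.term i s ((lam.inc a).inc a) b)
      + X.term i r lam a * X.term i s (lam.inc a) b * X.term j t ((lam.inc a).inc b) a) = 0 := by
  have hba := hab.symm
  have hq := D.q_ne
  have v : ∀ (mu : RowSeq) {x y : ℕ}, x ≠ y → mu.inc x y = mu y := fun mu _ _ h => mu.inc_of_ne h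
  have w : ∀ (mu : RowSeq) (x : ℕ), mu.inc x x = mu x + 1 := fun mu x => mu.inc_self x
  by_cases hB : D.col b (lam b) = i
  swap
  · simp [X.term_zero, v, hB, hab]
  obtain ⟨Rb, hRb⟩ := X.coef_agree_two i lam hab
  have hxy := D.pos_ne hba (lam b) (lam a)
  have hxy' := D.pos_ne hba (lam b) (lam a + 1)
  have hx := D.pos_ne_zero b (lam b)
  have hy := D.pos_ne_zero a (lam a)
  have hy' := D.pos_ne_zero a (lam a + 1)
  have ha1 : ∀ mu : RowSeq, (∀ s, s ≠ b → mu s = lam.inc a s) → mu a = lam a + 1 :=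
    fun mu h => by rw [h a hab, w]
  have e2 := D.add_one_add_one_ne
  have e1 := D.add_one_ne
  have hp := D.p₁_ne
  rcases hj with rfl | hj
  · have z1 := X.term_mul_zero (i := i + 1) (j := i) (w (lam.inc b) a)
      (Ne.symm (e2 i)) t r
    have z2 := X.term_mul_zero (i := i + 1) (j := i) (w lam a)
      (Ne.symm (e2 i)) t r
    have z3 := X.term_mul_zero (i := i + 1) (j := i) (lam := lam) (mu := (lam.inc a).inc b) (a := a)
      (by rw [v _ hba, w]) (Ne.symm (e2 i)) t r
    by_cases hA : D.col a (lam a) = i + 1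
    swap
    · have : X.term (i + 1) t (lam.inc b) a = 0 := X.term_zero (by rwa [v _ hba]) _
      rw [X.term_zero hA, this]
      linear_combination X.term i s lam b * z1 - (D.q + D.q⁻¹) *
        X.term i s ((lam.inc a).inc a) b * z2 + X.term i s (lam.inc a) b * z3
    have hA' : D.col a (lam a + 1) = i := by
      have := D.col_add_one a (lam a)
      rw [hA] at this
      exact add_right_cancel this
    obtain ⟨Rj, hRj⟩ := X.coef_agree_two (i + 1) lam hba
    obtain ⟨Ri, hRi⟩ := X.coef_agree_two i (lam.inc a) hba
    have key := D.psi_add_psi hx hy' hxy'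
    have main : X.coef (i + 1) lam a * X.coef i (lam.inc a) b * X.coef i ((lam.inc a).inc b) a
      - (D.q + D.q⁻¹) *
        (X.coef i lam b * X.coef (i + 1) (lam.inc b) a * X.coef i ((lam.inc b).inc a) a)
      + X.coef (i + 1) lam a * X.coef i (lam.inc a) a * X.coef i ((lam.inc a).inc a) b = 0 := by
      rw [hRj lam (fun _ _ => rfl), hRj (lam.inc b) (fun s h => v _ h.symm),
        hRi (lam.inc a) (fun _ _ => rfl), hRi ((lam.inc a).inc b) (fun s h => v _ h.symm),
        hRi ((lam.inc b).inc a) (fun s h => by rw [lam.inc_comm, v _ h.symm]),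
        hRb lam (fun _ _ => rfl), hRb (lam.inc a) (fun s h => v _ h.symm),
        hRb ((lam.inc a).inc a) (fun s h => by rw [v _ h.symm, v _ h.symm])]
      simp only [w, v _ hab]
      rcases X.tri a b hab with ⟨h, h'⟩ | ⟨h, h'⟩
      · simp only [theta, if_pos h, if_neg h', D.rowG_add_one_eq_bef]
        rw [D.rowG_eq_bef, hA, hA', FockDatum.bef, FockDatum.bef, FockDatum.bef,
          if_neg (Ne.symm (e1 i)), if_neg (Ne.symm (e2 i)), if_neg (e1 i), if_pos rfl, if_pos rfl,
          ← D.pos_add_one]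
        linear_combination Rj * Ri * Rb * key
      · simp only [theta, if_pos h, if_neg h', D.rowG_add_one_eq_bef, D.rowG_eq_bef, hB]
        simp only [FockDatum.bef, if_pos, if_neg (Ne.symm (e1 i)), if_neg (Ne.symm (e2 i)),
          if_neg (e1 i), ← D.pos_add_one]
        linear_combination Rj * Ri * Rb * D.psi (D.pos b (lam b) / D.pos a (lam a + 1)) * key
    simp only [term, w, v _ hab, v _ hba] at z1 z2 z3 ⊢
    linear_combination D.pos b (lam b) ^ s * (X.coef i lam b * z1 -
      (D.q + D.q⁻¹) * X.coef i ((lam.inc a).inc a) b * z2 + X.coef i (lam.inc a) b * z3) +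
      D.pos a (lam a) ^ t * D.pos b (lam b) ^ s * D.pos a (lam a + 1) ^ r * main
  · have hi : i = j + 1 := by rw [hj]; ring
    subst hi
    have z1 := X.term_mul_zero (i := j + 1) (j := j) (w (lam.inc b) a)
      (Ne.symm (e2 j)) r t
    have z2 := X.term_mul_zero (i := j + 1) (j := j) (w lam a)
      (Ne.symm (e2 j)) r t
    have z3 := X.term_mul_zero (i := j + 1) (j := j) (lam := lam) (mu := (lam.inc a).inc b) (a := a)
      (by rw [v _ hba, w]) (Ne.symm (e2 j)) r t
    by_cases hA : D.col a (lam a) = j + 1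
    swap
    · have : X.term (j + 1) r (lam.inc b) a = 0 := X.term_zero (by rwa [v _ hba]) _
      rw [X.term_zero hA, this]
      linear_combination X.term (j + 1) s (lam.inc a) b * z3 - (D.q + D.q⁻¹) *
        X.term (j + 1) s lam b * z1 + X.term (j + 1) s ((lam.inc a).inc a) b * z2
    have hA' : D.col a (lam a + 1) = j := by
      have := D.col_add_one a (lam a)
      rw [hA] at this
      exact add_right_cancel this
    obtain ⟨Ri, hRi⟩ := X.coef_agree_two (j + 1) lam hba
    obtain ⟨Rj, hRj⟩ := X.coef_agree_two j (lam.inc a) hba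
    have key := D.psi_add_psi hx hy hxy
    have main :
      X.coef (j + 1) lam b * X.coef (j + 1) (lam.inc b) a * X.coef j ((lam.inc b).inc a) a
      - (D.q + D.q⁻¹) *
        (X.coef (j + 1) lam a * X.coef j (lam.inc a) a * X.coef (j + 1) ((lam.inc a).inc a) b)
      + X.coef (j + 1) lam a * X.coef (j + 1) (lam.inc a) b * X.coef j ((lam.inc a).inc b) a
      = 0 := by
      rw [hRi lam (fun _ _ => rfl), hRi (lam.inc b) (fun s h => v _ h.symm),
        hRj (lam.inc a) (fun _ _ => rfl), hRj ((lam.inc a).inc b) (fun s h => v _ h.symm),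
        hRj ((lam.inc b).inc a) (fun s h => by rw [lam.inc_comm, v _ h.symm]),
        hRb lam (fun _ _ => rfl), hRb (lam.inc a) (fun s h => v _ h.symm),
        hRb ((lam.inc a).inc a) (fun s h => by rw [v _ h.symm, v _ h.symm])]
      simp only [w, v _ hab]
      rcases X.tri a b hab with ⟨h, h'⟩ | ⟨h, h'⟩
      · simp only [theta, if_pos h, if_neg h']
        rw [D.rowG_add_one_eq_bef (j + 1) a (lam a + 1), D.rowG_add_one_eq_bef, D.rowG_eq_bef, hA,
          hA', FockDatum.bef, FockDatum.bef, FockDatum.bef,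
          if_neg (Ne.symm (e1 j)), if_neg (Ne.symm (e2 j)), if_pos rfl, if_pos rfl]
        linear_combination Ri * Rj * Rb * key
      · simp only [theta, if_pos h, if_neg h', D.rowG_add_one_eq_bef, D.rowG_eq_bef, hB]
        simp only [FockDatum.bef, if_pos, if_neg (Ne.symm (e1 j)), if_neg (Ne.symm (e2 j)),
          if_neg (e1 j), D.pos_add_one, mul_div_mul_left _ _ hp]
        linear_combination Rj * Ri * Rb * D.psi (D.pos a (lam a) / D.pos b (lam b)) * key
    simp only [term, w, v _ hab, v _ hba] at z1 z2 z3 ⊢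
    linear_combination D.pos b (lam b) ^ s * (X.coef (j + 1) (lam.inc a) b * z3 -
      (D.q + D.q⁻¹) * X.coef (j + 1) lam b * z1 + X.coef (j + 1) ((lam.inc a).inc a) b * z2) +
      D.pos a (lam a) ^ r * D.pos b (lam b) ^ s * D.pos a (lam a + 1) ^ t * main

theorem serre {i j : ZMod n} (hj : j = i + 1 ∨ j = i - 1) (r s t : ℤ) (lam : RowSeq)
    (a b c : ℕ) :
    X.term j t lam c * X.term i s (lam.inc c) b * X.term i r ((lam.inc c).inc b) a
      - (D.q + D.q⁻¹) *
        (X.term i s lam b * X.term j t (lam.inc b) c * X.term i r ((lam.inc b).inc c) a)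
      + X.term i s lam b * X.term i r (lam.inc b) a * X.term j t ((lam.inc b).inc a) c
      + (X.term j t lam c * X.term i r (lam.inc c) a * X.term i s ((lam.inc c).inc a) b
      - (D.q + D.q⁻¹) *
        (X.term i r lam a * X.term j t (lam.inc a) c * X.term i s ((lam.inc a).inc c) b)
      + X.term i r lam a * X.term i s (lam.inc a) b * X.term j t ((lam.inc a).inc b) c) = 0 := by
  by_cases hab : a = b
  · subst hab
    have h1 : ∀ (mu : RowSeq) (r s : ℤ), X.term i s mu a * X.term i r (mu.inc a) a = 0 :=
      fun mu r s => X.term_mul_zero (mu.inc_self a) (Ne.symm (D.add_one_ne i)) r s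
    have h2 : ∀ r s : ℤ, X.term i s lam a * X.term j t (lam.inc a) c *
        X.term i r ((lam.inc a).inc c) a = 0 := by
      intro r s
      by_cases hac : a = c
      · subst hac
        by_cases h1 : D.col a (lam a) = i
        · have : D.col a (((lam.inc a).inc a) a) ≠ i := by
            rw [RowSeq.inc_self, RowSeq.inc_self, ← h1, ← D.col_add_one a (lam a),
              ← D.col_add_one a (lam a + 1)]
            exact Ne.symm (D.add_one_add_one_ne _)
          rw [X.term_zero this, mul_zero]
        · rw [X.term_zero h1]; ring
      · have := X.term_mul_zero (lam := lam) (mu := (lam.inc a).inc c) (a := a)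
          (by rw [RowSeq.inc_of_ne _ (Ne.symm hac), RowSeq.inc_self])
          (Ne.symm (D.add_one_ne i)) r s
        linear_combination X.term j t (lam.inc a) c * this
    linear_combination X.term j t lam c * h1 (lam.inc c) r s -
      (D.q + D.q⁻¹) * h2 r s + X.term j t ((lam.inc a).inc a) c * h1 lam r s +
      X.term j t lam c * h1 (lam.inc c) s r -
      (D.q + D.q⁻¹) * h2 s r + X.term j t ((lam.inc a).inc a) c * h1 lam s r
  by_cases hac : a = c
  · subst hac
    exact X.serre_same hj r s t lam hab
  by_cases hbc : b = c
  · subst hbc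
    have := X.serre_same hj s r t lam (Ne.symm hab)
    linear_combination this
  exact X.serre_distinct hj r s t lam hab hac hbc

end Dressing

/-- If `A s * B (s + 1) = 1` from `N` on, then the product of the `A s * B s`, corrected by the
last `B`, does not depend on where it is cut off. -/
theorem prod_Ico_mul_tail {M : Type*} [CommMonoid M] (A B : ℕ → M) (N : ℕ)
    (h : ∀ s, N ≤ s → A s * B (s + 1) = 1) {N' : ℕ} (hN : N ≤ N') :
    (∏ s ∈ Finset.Ico N N', A s * B s) * B N' = B N := by
  induction N', hN using Nat.le_induction with
  | base => simp
  | succ m hm ih =>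
    rw [Finset.prod_Ico_succ_top hm, mul_assoc, mul_right_comm (A m), h m hm, one_mul, ih]

namespace RowSeq

/-- Remove a box from the row `a`. -/
def dec (lam : RowSeq) (a : ℕ) : RowSeq := lam - Finsupp.single a 1

theorem inc_dec (lam : RowSeq) (a : ℕ) : (lam.inc a).dec a = lam := by simp [inc, dec]

theorem dec_inc (lam : RowSeq) (a : ℕ) : (lam.dec a).inc a = lam := by simp [inc, dec]

theorem dec_comm (lam : RowSeq) (a b : ℕ) : (lam.dec a).dec b = (lam.dec b).dec a := by
  simp [dec, sub_right_comm]

theorem inc_dec_comm (lam : RowSeq) (a b : ℕ) : (lam.inc a).dec b = (lam.dec b).inc a := by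
  simp [inc, dec, sub_add_eq_add_sub]

theorem dec_self (lam : RowSeq) (a : ℕ) : lam.dec a a = lam a - 1 := by simp [dec]

theorem dec_of_ne (lam : RowSeq) {a b : ℕ} (h : a ≠ b) : lam.dec a b = lam b := by
  simp [dec, h]

theorem Bdd.inc {lam : RowSeq} {N : ℕ} (h : lam.Bdd N) {a : ℕ} (ha : a < N) :
    (lam.inc a).Bdd N := fun s hs => by rw [inc_of_ne _ (by omega)]; exact h s hs

theorem Bdd.dec {lam : RowSeq} {N : ℕ} (h : lam.Bdd N) {a : ℕ} (ha : a < N) :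
    (lam.dec a).Bdd N := fun s hs => by rw [dec_of_ne _ (by omega)]; exact h s hs

end RowSeq

namespace FockDatum

variable {n : ℕ} (D : FockDatum n)

/-- The product of the contributions of the rows below `a`, cut off at `N`. -/
def tail (i : ZMod n) (lam : RowSeq) (a N : ℕ) (z : ℂ) : ℂ :=
  (∏ s ∈ Finset.Ico (a + 1) N, D.rowG i s (lam s) z) * D.rowB i N 0 z

theorem tail_eq (i : ZMod n) {lam : RowSeq} {a N N' : ℕ} (hN : lam.Bdd N) (ha : a < N)
    (h : N ≤ N') (v : ℤ) : D.tail i lam a N' (D.pos a v) = D.tail i lam a N (D.pos a v) := by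
  have h1 := prod_Ico_mul_tail (fun s => D.rowA i s 0 (D.pos a v))
    (fun s => D.rowB i s 0 (D.pos a v)) N (fun s hs => D.rowA_mul_rowB_succ i s 0
      (D.pos_ne_zero _ _) (D.pos_ne (by omega) _ _) (D.pos_ne (by omega) _ _)) h
  rw [tail, tail, ← h1, ← mul_assoc]
  congr 1
  rw [← Finset.prod_Ico_consecutive _ (show a + 1 ≤ N by omega) h]
  congr 1
  refine Finset.prod_congr rfl fun s hs => ?_
  rw [hN s (Finset.mem_Ico.1 hs).1]
  rfl

/-- The coefficients of the operators `E`. -/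
def dressE : Dressing D where
  lt s a := s < a
  coef i lam a := if D.col a (lam a) = i then
    ∏ s ∈ Finset.range a, D.rowG i s (lam s) (D.pos a (lam a)) else 0
  tri a b h := by omega
  coef_zero i lam a h := if_neg h
  coef_eq N i a := ⟨Finset.range a, fun _ => 1, fun s hs => Finset.mem_range.1 hs,
    fun s hs _ => Finset.mem_range.2 hs, fun lam _ h => by rw [if_pos h, one_mul]⟩

/-- The coefficients of the transposed operators of `F`. -/
def dressF : Dressing D where
  lt s a := a < s
  coef i lam a := if D.col a (lam a) = i then
    D.tail i lam a (max lam.exists_bdd.choose (a + 1)) (D.pos a (lam a)) else 0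
  tri a b h := by omega
  coef_zero i lam a h := if_neg h
  coef_eq N i a := by
    refine ⟨Finset.Ico (a + 1) (max N (a + 1)), fun z => D.rowB i (max N (a + 1)) 0 z,
      fun s hs => (Finset.mem_Ico.1 hs).1, fun s hs hs' => Finset.mem_Ico.2 ⟨hs, by omega⟩,
      fun lam hN h => ?_⟩
    rw [if_pos h, mul_comm]
    have hN0 := lam.exists_bdd.choose_spec
    set N0 := lam.exists_bdd.choose
    change _ = D.tail i lam a (max N (a + 1)) _
    rw [← D.tail_eq i (hN0.mono (le_max_left _ (a + 1))) (by omega)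
        (le_max_left (max N0 (a + 1)) (max N (a + 1))),
      ← D.tail_eq i (hN.mono (le_max_left _ (a + 1))) (by omega)
        (le_max_right (max N0 (a + 1)) (max N (a + 1)))]

theorem dressE_coef {i : ZMod n} {lam : RowSeq} {a : ℕ} (h : D.col a (lam a) = i) :
    D.dressE.coef i lam a = ∏ s ∈ Finset.range a, D.rowG i s (lam s) (D.pos a (lam a)) :=
  if_pos h

theorem dressF_coef {i : ZMod n} {lam : RowSeq} {a N : ℕ} (h : D.col a (lam a) = i)
    (hN : lam.Bdd N) (ha : a < N) : D.dressF.coef i lam a = D.tail i lam a N (D.pos a (lam a)) := by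
  have hN0 := lam.exists_bdd.choose_spec
  change (if D.col a (lam a) = i then _ else _) = _
  rw [if_pos h]
  set N0 := lam.exists_bdd.choose
  rw [← D.tail_eq i (hN0.mono (le_max_left _ (a + 1))) (by omega)
      (le_max_left (max N0 (a + 1)) N), ← D.tail_eq i hN ha (le_max_right (max N0 (a + 1)) N)]

theorem dressE_mul_dressF {i : ZMod n} {lam : RowSeq} {a N : ℕ} (h : D.col a (lam a) = i)
    (hN : lam.Bdd N) (ha : a < N) : D.dressE.coef i lam a * D.dressF.coef i lam a =
      (∏ s ∈ (Finset.range N).erase a, D.rowG i s (lam s) (D.pos a (lam a))) *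
        D.rowB i N 0 (D.pos a (lam a)) := by
  rw [D.dressE_coef h, D.dressF_coef h hN ha, tail, ← mul_assoc]
  congr 1
  have h1 : (Finset.range N).erase a = Finset.range a ∪ Finset.Ico (a + 1) N := by
    ext s; simp only [Finset.mem_erase, Finset.mem_union, Finset.mem_range, Finset.mem_Ico]; omega
  rw [h1, Finset.prod_union]
  rw [Finset.disjoint_left]
  intro s hs; simp only [Finset.mem_range, Finset.mem_Ico] at *; omega

theorem pos_sub_one_div_pos_succ (s : ℕ) (v : ℤ) :
    D.pos s (v - 1) / D.pos (s + 1) v = D.q ^ 2 := by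
  have := D.p₁_mul_p₃
  have h1 := D.p₁_ne
  have h3 := D.p₃_ne
  have hq := D.q_ne
  have hx := D.pos_ne_zero s v
  rw [pos_succ, pos_sub_one]
  field_simp at this ⊢
  linear_combination -this

theorem rowG_pos_succ {i : ZMod n} {s : ℕ} {v : ℤ} (h : D.col (s + 1) v = i) :
    D.rowG i s v (D.pos (s + 1) v) = 0 := by
  rw [rowG, rowA, if_pos (by rw [← h, col_succ]), pos_sub_one_div_pos_succ, psi_sq, zero_mul]

theorem rowG_succ_pos {i : ZMod n} {s : ℕ} {v : ℤ} (h : D.col s v = i) :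
    D.rowG i (s + 1) (v + 1) (D.pos s v) = 0 := by
  have := D.pos_sub_one_div_pos_succ s (v + 1)
  rw [add_sub_cancel_right] at this
  rw [rowG, rowB, if_pos (by rw [← h, col_succ, col_add_one]), this, psi_sq, mul_zero]

theorem rowG_ne_zero (i : ZMod n) {s a : ℕ} (hs : s ≠ a) {v w : ℤ} (h1 : ¬ (s + 1 = a ∧ v = w))
    (h2 : ¬ (s = a + 1 ∧ v = w + 1)) : D.rowG i s v (D.pos a w) ≠ 0 := by
  have key : ∀ {a b : ℤ}, D.p₁ ^ a * D.p₃ ^ b = D.q ^ 2 → a = -1 ∧ b = -1 := by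
    intro a b h
    have := D.zpow_mul_zpow_eq_one (a := a + 1) (c := b + 1) (by
      rw [zpow_add_one₀ D.p₁_ne, zpow_add_one₀ D.p₃_ne]
      have h3 := D.p₁_mul_p₃
      have hq := D.q_ne
      calc _ = (D.p₁ ^ a * D.p₃ ^ b) * (D.p₁ * D.p₃) := by ring
        _ = 1 := by rw [h, h3]; field_simp)
    omega
  rw [rowG]
  apply mul_ne_zero
  · rw [rowA]
    split_ifs with h
    · rw [Ne, D.psi_eq_zero_iff, pos_div_pos]
      · intro h3
        have := key h3
        omega
      · rw [Ne, div_eq_one_iff_eq (D.pos_ne_zero _ _)]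
        exact D.pos_ne hs _ _
    · exact one_ne_zero
  · rw [rowB]
    split_ifs with h
    · rw [Ne, D.psi_eq_zero_iff, pos_div_pos]
      · intro h3
        have := key h3
        omega
      · rw [Ne, div_eq_one_iff_eq (D.pos_ne_zero _ _)]
        exact D.pos_ne (Ne.symm hs) _ _
    · exact one_ne_zero

theorem dressE_coef_eq_zero (i : ZMod n) {lam : RowSeq} {a : ℕ} (h : lam a = lam (a + 1)) :
    D.dressE.coef i lam (a + 1) = 0 := by
  by_cases hc : D.col (a + 1) (lam (a + 1)) = i
  · rw [D.dressE_coef hc]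
    refine Finset.prod_eq_zero (Finset.mem_range.2 a.lt_succ_self) ?_
    rw [h]
    exact D.rowG_pos_succ hc
  · exact D.dressE.coef_zero _ _ _ hc

theorem dressF_coef_eq_zero (i : ZMod n) {lam : RowSeq} {a : ℕ} (h : lam (a + 1) = lam a + 1) :
    D.dressF.coef i lam a = 0 := by
  by_cases hc : D.col a (lam a) = i
  · obtain ⟨N, hN⟩ := lam.exists_bdd
    rw [D.dressF_coef hc (hN.mono (le_max_left N (a + 2))) (by omega), tail]
    have : a + 1 ∈ Finset.Ico (a + 1) (max N (a + 2)) := by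
      rw [Finset.mem_Ico]; omega
    rw [Finset.prod_eq_zero this, zero_mul]
    rw [h]
    exact D.rowG_succ_pos hc
  · exact D.dressF.coef_zero _ _ _ hc

theorem dressE_coef_ne_zero {i : ZMod n} {lam : RowSeq} {a : ℕ} (hc : D.col a (lam a) = i)
    (h : ∀ s, s + 1 = a → lam s ≠ lam a) : D.dressE.coef i lam a ≠ 0 := by
  rw [D.dressE_coef hc, Finset.prod_ne_zero_iff]
  intro s hs
  rw [Finset.mem_range] at hs
  exact D.rowG_ne_zero i (by omega) (fun h' => h s h'.1 h'.2) (by omega)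

theorem exists_rowB_eq_one (i : ZMod n) (N : ℕ) (v : ℤ) : ∃ M, N ≤ M ∧ D.col M v ≠ i := by
  by_cases h : D.col N v = i
  · exact ⟨N + 1, by omega, by rw [col_succ, h]; exact D.add_one_ne i⟩
  · exact ⟨N, le_rfl, h⟩

theorem dressF_coef_ne_zero {i : ZMod n} {lam : RowSeq} {a : ℕ} (hc : D.col a (lam a) = i)
    (h : lam (a + 1) ≠ lam a + 1) : D.dressF.coef i lam a ≠ 0 := by
  obtain ⟨N, hN⟩ := lam.exists_bdd
  obtain ⟨M, hM, hM'⟩ := D.exists_rowB_eq_one i (N + a + 1) 0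
  rw [D.dressF_coef hc (hN.mono (show N ≤ M by omega)) (by omega), tail, rowB,
    if_neg (Ne.symm hM'), mul_one, Finset.prod_ne_zero_iff]
  intro s hs
  rw [Finset.mem_Ico] at hs
  refine D.rowG_ne_zero i (by omega) (by omega) ?_
  rintro ⟨rfl, h'⟩
  exact h h'

theorem dressE_comm_dressF (i j : ZMod n) (r s : ℤ) (lam : RowSeq) {a b : ℕ} (hab : a ≠ b) :
    D.dressE.term i r (lam.inc b) a * D.dressF.term j s (lam.inc a) b =
      D.dressF.term j s lam b * D.dressE.term i r lam a := by
  have ea : lam.inc b a = lam a := lam.inc_of_ne (Ne.symm hab)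
  have eb : lam.inc a b = lam b := lam.inc_of_ne hab
  by_cases hi : D.col a (lam a) = i
  swap
  · have hi' : D.col a (lam.inc b a) ≠ i := by rwa [ea]
    rw [Dressing.term_zero _ hi, Dressing.term_zero _ hi']; ring
  by_cases hj : D.col b (lam b) = j
  swap
  · have hj' : D.col b (lam.inc a b) ≠ j := by rwa [eb]
    rw [Dressing.term_zero _ hj, Dressing.term_zero _ hj']; ring
  obtain ⟨R, hR⟩ := D.dressE.coef_agree_two i lam (Ne.symm hab)
  obtain ⟨R', hR'⟩ := D.dressF.coef_agree_two j lam hab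
  simp only [Dressing.term]
  rw [ea, eb, hR (lam.inc b) (fun _ h => lam.inc_of_ne h.symm), hR lam (fun _ _ => rfl),
    hR' (lam.inc a) (fun _ h => lam.inc_of_ne h.symm), hR' lam (fun _ _ => rfl),
    lam.inc_self, lam.inc_self]
  have key : D.dressE.theta i b a (lam b + 1) (D.pos a (lam a)) *
      D.dressF.theta j a b (lam a + 1) (D.pos b (lam b)) =
      D.dressE.theta i b a (lam b) (D.pos a (lam a)) *
      D.dressF.theta j a b (lam a) (D.pos b (lam b)) := by
    by_cases h : b < a
    · have h1 : D.dressE.lt b a := h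
      have h2 : D.dressF.lt a b := h
      simp only [Dressing.theta, if_pos h1, if_pos h2, rowG_add_one_eq_bef]
      rw [rowG_eq_bef, rowG_eq_bef, hi, hj, mul_comm]
    · have h1 : ¬ D.dressE.lt b a := h
      have h2 : ¬ D.dressF.lt a b := h
      simp only [Dressing.theta, if_neg h1, if_neg h2]
  linear_combination R * R' * D.pos a (lam a) ^ r * D.pos b (lam b) ^ s * key

end FockDatum

/-- The vector space with basis the row sequences. -/
abbrev RowSpace : Type := RowSeq →₀ ℂ

namespace RowSpace

/-- The basis vectors. -/
def vec (lam : RowSeq) : RowSpace := Finsupp.single lam 1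

theorem hom_ext {T T' : Module.End ℂ RowSpace} (h : ∀ lam, T (vec lam) = T' (vec lam)) :
    T = T' := by
  refine Finsupp.lhom_ext' fun lam => LinearMap.ext_ring ?_
  exact h lam

/-- The operator mapping `lam` to the sum over all rows `a` of `g lam a` times `σ lam a`. -/
def op (σ : RowSeq → ℕ → RowSeq) (g : RowSeq → ℕ → ℂ) : Module.End ℂ RowSpace :=
  Finsupp.linearCombination ℂ fun lam =>
    ∑ a ∈ Finset.range (lam.exists_bdd.choose + 1), g lam a • vec (σ lam a)

/-- The coefficients vanish far below the nonempty rows. -/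
def IsLocal (g : RowSeq → ℕ → ℂ) : Prop := ∀ lam N a, lam.Bdd N → N < a → g lam a = 0

/-- The map `σ` changes only the row concerned. -/
def IsRowMap (σ : RowSeq → ℕ → RowSeq) : Prop := ∀ lam N a, lam.Bdd N → a < N → (σ lam a).Bdd N

variable {σ σ' σ'' : RowSeq → ℕ → RowSeq} {g g' g'' : RowSeq → ℕ → ℂ}

theorem op_vec (hg : IsLocal g) {lam : RowSeq} {N M : ℕ} (hN : lam.Bdd N) (hM : N < M) :
    op σ g (vec lam) = ∑ a ∈ Finset.range M, g lam a • vec (σ lam a) := by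
  have hN0 := lam.exists_bdd.choose_spec
  rw [op, vec, Finsupp.linearCombination_single, one_smul]
  set N0 := lam.exists_bdd.choose
  have key : ∀ {N M L}, lam.Bdd N → N < M → M ≤ L →
      ∑ a ∈ Finset.range M, g lam a • vec (σ lam a) =
      ∑ a ∈ Finset.range L, g lam a • vec (σ lam a) := by
    intro N M L h1 h2 h3
    refine Finset.sum_subset (Finset.range_mono h3) fun a _ ha => ?_
    rw [Finset.mem_range, not_lt] at ha
    rw [hg lam N a h1 (by omega), zero_smul]
  rw [key hN0 (Nat.lt_succ_self _) (le_max_left (N0 + 1) M), key hN hM (le_max_right (N0 + 1) M)]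

theorem op_op_vec (hσ : IsRowMap σ) (hg : IsLocal g) (hg' : IsLocal g') {lam : RowSeq} {N M : ℕ}
    (hN : lam.Bdd N) (hM : N + 1 < M) :
    op σ' g' (op σ g (vec lam)) = ∑ b ∈ Finset.range M, ∑ a ∈ Finset.range M,
      (g lam b * g' (σ lam b) a) • vec (σ' (σ lam b) a) := by
  rw [op_vec hg hN (show N < M by omega), map_sum]
  refine Finset.sum_congr rfl fun b hb => ?_
  rw [map_smul]
  by_cases h : N < b
  · rw [hg lam N b hN h]; simp
  · rw [op_vec hg' (hσ lam (N + 1) b (hN.mono (by omega)) (by omega)) hM, Finset.smul_sum]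
    simp only [smul_smul]

theorem op_op_vec' (hσ : IsRowMap σ) (hg : IsLocal g) (hg' : IsLocal g') {lam : RowSeq} {N M : ℕ}
    (hN : lam.Bdd N) (hM : N + 1 < M) :
    op σ' g' (op σ g (vec lam)) = ∑ a ∈ Finset.range M, ∑ b ∈ Finset.range M,
      (g lam b * g' (σ lam b) a) • vec (σ' (σ lam b) a) := by
  rw [op_op_vec hσ hg hg' hN hM, Finset.sum_comm]

theorem op_op_op_vec (hσ : IsRowMap σ) (hσ' : IsRowMap σ') (hg : IsLocal g) (hg' : IsLocal g')
    (hg'' : IsLocal g'') {lam : RowSeq} {N M : ℕ} (hN : lam.Bdd N) (hM : N + 2 < M) :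
    op σ'' g'' (op σ' g' (op σ g (vec lam))) =
      ∑ c ∈ Finset.range M, ∑ b ∈ Finset.range M, ∑ a ∈ Finset.range M,
        (g lam c * g' (σ lam c) b * g'' (σ' (σ lam c) b) a) • vec (σ'' (σ' (σ lam c) b) a) := by
  rw [op_vec hg hN (show N < M by omega), map_sum, map_sum]
  refine Finset.sum_congr rfl fun c hc => ?_
  rw [map_smul, map_smul]
  by_cases h : N < c
  · rw [hg lam N c hN h]; simp
  · rw [op_op_vec hσ' hg' hg'' (hσ lam (N + 1) c (hN.mono (by omega)) (by omega))
      (by omega), Finset.smul_sum]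
    simp only [Finset.smul_sum, smul_smul, mul_assoc]

/-- The cubic relation for operators changing one row at a time, in terms of coefficients. -/
theorem op_serre (q : ℂ) (hσ : IsRowMap σ) (hcomm : ∀ lam a b, σ (σ lam a) b = σ (σ lam b) a)
    {x y : ℤ → RowSeq → ℕ → ℂ} (hx : ∀ m, IsLocal (x m)) (hy : ∀ m, IsLocal (y m)) (r s t : ℤ)
    (H : ∀ lam a b c, y t lam c * x s (σ lam c) b * x r (σ (σ lam c) b) a
      - (q + q⁻¹) * (x s lam b * y t (σ lam b) c * x r (σ (σ lam b) c) a)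
      + x s lam b * x r (σ lam b) a * y t (σ (σ lam b) a) c
      + (y t lam c * x r (σ lam c) a * x s (σ (σ lam c) a) b
      - (q + q⁻¹) * (x r lam a * y t (σ lam a) c * x s (σ (σ lam a) c) b)
      + x r lam a * x s (σ lam a) b * y t (σ (σ lam a) b) c) = 0) :
    serreTerm q (fun m => op σ (x m)) (fun m => op σ (y m)) r s t +
      serreTerm q (fun m => op σ (x m)) (fun m => op σ (y m)) s r t = 0 := by
  refine hom_ext fun lam => ?_
  obtain ⟨N, hN⟩ := lam.exists_bdd
  have e := fun {g g' g'' : RowSeq → ℕ → ℂ} (h : IsLocal g) (h' : IsLocal g')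
    (h'' : IsLocal g'') => op_op_op_vec (σ'' := σ) hσ hσ h h' h'' hN (show N + 2 < N + 3 by omega)
  simp only [serreTerm, LinearMap.add_apply, LinearMap.sub_apply, LinearMap.smul_apply,
    Module.End.mul_apply, LinearMap.zero_apply]
  generalize Finset.range (N + 3) = R at e
  have c4 : ∀ f : ℕ → ℕ → ℕ → RowSpace, ∑ c ∈ R, ∑ a ∈ R, ∑ b ∈ R, f c a b =
      ∑ a ∈ R, ∑ b ∈ R, ∑ c ∈ R, f c a b := by
    intro f
    rw [Finset.sum_comm]
    exact Finset.sum_congr rfl fun _ _ => Finset.sum_comm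
  have c1 : ∀ f : ℕ → ℕ → ℕ → RowSpace, ∑ c ∈ R, ∑ b ∈ R, ∑ a ∈ R, f c b a =
      ∑ a ∈ R, ∑ b ∈ R, ∑ c ∈ R, f c b a := by
    intro f
    rw [c4, Finset.sum_comm]
  have c2 : ∀ f : ℕ → ℕ → ℕ → RowSpace, ∑ b ∈ R, ∑ c ∈ R, ∑ a ∈ R, f b c a =
      ∑ a ∈ R, ∑ b ∈ R, ∑ c ∈ R, f b c a := by
    intro f
    rw [c4, c4]
  have c3 : ∀ f : ℕ → ℕ → ℕ → RowSpace, ∑ b ∈ R, ∑ a ∈ R, ∑ c ∈ R, f b a c =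
      ∑ a ∈ R, ∑ b ∈ R, ∑ c ∈ R, f b a c := fun f => Finset.sum_comm
  have c5 : ∀ f : ℕ → ℕ → ℕ → RowSpace, ∑ a ∈ R, ∑ c ∈ R, ∑ b ∈ R, f a c b =
      ∑ a ∈ R, ∑ b ∈ R, ∑ c ∈ R, f a c b := fun f =>
    Finset.sum_congr rfl fun _ _ => Finset.sum_comm
  rw [(e (hy t) (hx s) (hx r)).trans (c1 _), (e (hx s) (hy t) (hx r)).trans (c2 _),
    (e (hx s) (hx r) (hy t)).trans (c3 _), (e (hy t) (hx r) (hx s)).trans (c4 _),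
    (e (hx r) (hy t) (hx s)).trans (c5 _), e (hx r) (hx s) (hy t)]
  simp only [Finset.smul_sum, smul_smul, ← Finset.sum_sub_distrib, ← Finset.sum_add_distrib]
  refine Finset.sum_eq_zero fun a _ => Finset.sum_eq_zero fun b _ => Finset.sum_eq_zero fun c _ => ?_
  have h1 : σ (σ (σ lam b) c) a = σ (σ (σ lam c) b) a := by rw [hcomm lam]
  have h2 : σ (σ (σ lam b) a) c = σ (σ (σ lam c) b) a := by rw [hcomm (σ lam b), hcomm lam]
  have h3 : σ (σ (σ lam c) a) b = σ (σ (σ lam c) b) a := hcomm _ _ _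
  have h4 : σ (σ (σ lam a) c) b = σ (σ (σ lam c) b) a := by rw [hcomm lam, hcomm (σ lam c)]
  have h5 : σ (σ (σ lam a) b) c = σ (σ (σ lam c) b) a := by
    rw [hcomm lam, hcomm (σ lam b), hcomm lam]
  rw [h1, h2, h3, h4, h5, ← sub_smul, ← sub_smul, ← add_smul, ← add_smul,
    ← add_smul, H, zero_smul]

end RowSpace

namespace FockDatum

open RowSpace

variable {n : ℕ} (D : FockDatum n)

theorem isRowMap_inc : IsRowMap RowSeq.inc := fun _ _ _ h ha => h.inc ha

theorem isRowMap_dec : IsRowMap RowSeq.dec := fun _ _ _ h ha => h.dec ha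

/-- The coefficients of `F`. -/
def termF (i : ZMod n) (m : ℤ) (lam : RowSeq) (a : ℕ) : ℂ := D.dressF.term i m (lam.dec a) a

theorem isLocal_termE (i : ZMod n) (m : ℤ) : IsLocal (D.dressE.term i m) := by
  intro lam N a hN ha
  obtain ⟨b, rfl⟩ : ∃ b, a = b + 1 := ⟨a - 1, by omega⟩
  rw [Dressing.term, D.dressE_coef_eq_zero, zero_mul]
  rw [hN b (by omega), hN (b + 1) (by omega)]

theorem termF_eq_zero (i : ZMod n) (m : ℤ) {lam : RowSeq} {a : ℕ} (h : lam (a + 1) = lam a) :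
    D.termF i m lam a = 0 := by
  rw [termF, Dressing.term, D.dressF_coef_eq_zero, zero_mul]
  rw [lam.dec_self, lam.dec_of_ne (by omega), h]; ring

theorem isLocal_termF (i : ZMod n) (m : ℤ) : IsLocal (D.termF i m) := by
  intro lam N a hN ha
  rw [termF_eq_zero]
  rw [hN a (by omega), hN (a + 1) (by omega)]

/-- The operator `E_{i,m}` on the space of row sequences. -/
def opE (i : ZMod n) (m : ℤ) : Module.End ℂ RowSpace := op RowSeq.inc (D.dressE.term i m)

/-- The operator `F_{i,m}` on the space of row sequences. -/
def opF (i : ZMod n) (m : ℤ) : Module.End ℂ RowSpace := op RowSeq.dec (D.termF i m)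

theorem opE_exchange (i j : ZMod n) (r s : ℤ) :
    D.d ^ mMatrix i j • (D.opE i (r + 1) * D.opE j s) -
      D.q ^ cartan i j • (D.opE i r * D.opE j (s + 1)) =
    (D.d ^ mMatrix i j * D.q ^ cartan i j) • (D.opE j s * D.opE i (r + 1)) -
      D.opE j (s + 1) * D.opE i r := by
  refine hom_ext fun lam => ?_
  obtain ⟨N, hN⟩ := lam.exists_bdd
  have e1 := fun (i j : ZMod n) (r s : ℤ) => op_op_vec (σ' := RowSeq.inc) isRowMap_inc
    (D.isLocal_termE j s) (D.isLocal_termE i r) hN (show N + 1 < N + 2 by omega)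
  have e2 := fun (i j : ZMod n) (r s : ℤ) => op_op_vec' (σ' := RowSeq.inc) isRowMap_inc
    (D.isLocal_termE j s) (D.isLocal_termE i r) hN (show N + 1 < N + 2 by omega)
  simp only [LinearMap.sub_apply, LinearMap.smul_apply, Module.End.mul_apply, opE]
  rw [e1 i j, e1 i j, e2 j i, e2 j i]
  simp only [Finset.smul_sum, smul_smul, ← Finset.sum_sub_distrib]
  refine Finset.sum_congr rfl fun c _ => Finset.sum_congr rfl fun a _ => ?_
  rw [lam.inc_comm a c, ← sub_smul, ← sub_smul, D.dressE.exchange]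

theorem opF_exchange (i j : ZMod n) (r s : ℤ) :
    D.d ^ mMatrix i j • (D.opF i (r + 1) * D.opF j s) -
      D.q ^ (-cartan i j) • (D.opF i r * D.opF j (s + 1)) =
    (D.d ^ mMatrix i j * D.q ^ (-cartan i j)) • (D.opF j s * D.opF i (r + 1)) -
      D.opF j (s + 1) * D.opF i r := by
  refine hom_ext fun lam => ?_
  obtain ⟨N, hN⟩ := lam.exists_bdd
  have e1 := fun (i j : ZMod n) (r s : ℤ) => op_op_vec (σ' := RowSeq.dec) isRowMap_dec
    (D.isLocal_termF j s) (D.isLocal_termF i r) hN (show N + 1 < N + 2 by omega)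
  have e2 := fun (i j : ZMod n) (r s : ℤ) => op_op_vec' (σ' := RowSeq.dec) isRowMap_dec
    (D.isLocal_termF j s) (D.isLocal_termF i r) hN (show N + 1 < N + 2 by omega)
  simp only [LinearMap.sub_apply, LinearMap.smul_apply, Module.End.mul_apply, opF]
  rw [e1 i j, e1 i j, e2 j i, e2 j i]
  simp only [Finset.smul_sum, smul_smul, ← Finset.sum_sub_distrib]
  refine Finset.sum_congr rfl fun c _ => Finset.sum_congr rfl fun a _ => ?_
  have h := D.dressF.exchange i j r s ((lam.dec c).dec a) a c
  have ha : ((lam.dec c).dec a).inc a = lam.dec c := RowSeq.dec_inc _ _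
  have hc : ((lam.dec c).dec a).inc c = lam.dec a := by rw [lam.dec_comm, RowSeq.dec_inc]
  have hq : D.q ^ cartan i j ≠ 0 := zpow_ne_zero _ D.q_ne
  rw [lam.dec_comm a c, ← sub_smul, ← sub_smul]
  rw [ha, hc] at h
  congr 1
  simp only [termF]
  rw [lam.dec_comm a c, zpow_neg]
  field_simp
  linear_combination -h

theorem opE_commute {i j : ZMod n} (h0 : i ≠ j) (h1 : i ≠ j + 1) (h2 : i ≠ j - 1) (r s : ℤ) :
    D.opE i r * D.opE j s = D.opE j s * D.opE i r := by
  refine hom_ext fun lam => ?_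
  obtain ⟨N, hN⟩ := lam.exists_bdd
  have e1 := fun (i j : ZMod n) (r s : ℤ) => op_op_vec (σ' := RowSeq.inc) isRowMap_inc
    (D.isLocal_termE j s) (D.isLocal_termE i r) hN (show N + 1 < N + 2 by omega)
  have e2 := fun (i j : ZMod n) (r s : ℤ) => op_op_vec' (σ' := RowSeq.inc) isRowMap_inc
    (D.isLocal_termE j s) (D.isLocal_termE i r) hN (show N + 1 < N + 2 by omega)
  simp only [Module.End.mul_apply, opE]
  rw [e1 i j, e2 j i]
  refine Finset.sum_congr rfl fun c _ => Finset.sum_congr rfl fun a _ => ?_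
  rw [lam.inc_comm a c, D.dressE.commute_of_far h0 h1 h2]

theorem opF_commute {i j : ZMod n} (h0 : i ≠ j) (h1 : i ≠ j + 1) (h2 : i ≠ j - 1) (r s : ℤ) :
    D.opF i r * D.opF j s = D.opF j s * D.opF i r := by
  refine hom_ext fun lam => ?_
  obtain ⟨N, hN⟩ := lam.exists_bdd
  have e1 := fun (i j : ZMod n) (r s : ℤ) => op_op_vec (σ' := RowSeq.dec) isRowMap_dec
    (D.isLocal_termF j s) (D.isLocal_termF i r) hN (show N + 1 < N + 2 by omega)
  have e2 := fun (i j : ZMod n) (r s : ℤ) => op_op_vec' (σ' := RowSeq.dec) isRowMap_dec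
    (D.isLocal_termF j s) (D.isLocal_termF i r) hN (show N + 1 < N + 2 by omega)
  simp only [Module.End.mul_apply, opF]
  rw [e1 i j, e2 j i]
  refine Finset.sum_congr rfl fun c _ => Finset.sum_congr rfl fun a _ => ?_
  have h := D.dressF.commute_of_far h0 h1 h2 r s ((lam.dec c).dec a) a c
  have ha : ((lam.dec c).dec a).inc a = lam.dec c := RowSeq.dec_inc _ _
  have hc : ((lam.dec c).dec a).inc c = lam.dec a := by rw [lam.dec_comm, RowSeq.dec_inc]
  rw [ha, hc] at h
  simp only [termF]
  rw [lam.dec_comm a c, mul_comm, ← h, mul_comm]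

theorem opE_serre {i j : ZMod n} (hj : j = i + 1 ∨ j = i - 1) (r s t : ℤ) :
    serreTerm D.q (D.opE i) (D.opE j) r s t + serreTerm D.q (D.opE i) (D.opE j) s r t = 0 :=
  op_serre D.q isRowMap_inc (fun lam a b => lam.inc_comm a b) (D.isLocal_termE i)
    (D.isLocal_termE j) r s t (D.dressE.serre hj r s t)

theorem opF_serre {i j : ZMod n} (hj : j = i + 1 ∨ j = i - 1) (r s t : ℤ) :
    serreTerm D.q (D.opF i) (D.opF j) r s t + serreTerm D.q (D.opF i) (D.opF j) s r t = 0 := by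
  refine op_serre D.q isRowMap_dec (fun lam a b => lam.dec_comm a b) (D.isLocal_termF i)
    (D.isLocal_termF j) r s t fun lam a b c => ?_
  obtain ⟨nu, rfl⟩ : ∃ nu : RowSeq, lam = ((nu.inc a).inc b).inc c :=
    ⟨((lam.dec c).dec b).dec a, by simp only [RowSeq.dec_inc]⟩
  have h1 : ((nu.inc a).inc b).inc c = ((nu.inc a).inc c).inc b := (nu.inc a).inc_comm b c
  have h2 : ((nu.inc a).inc b).inc c = ((nu.inc c).inc b).inc a := by
    rw [nu.inc_comm, (nu.inc b).inc_comm, nu.inc_comm]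
  have d1 : (((nu.inc a).inc b).inc c).dec c = (nu.inc a).inc b := RowSeq.inc_dec _ _
  have d2 : (((nu.inc a).inc b).inc c).dec b = (nu.inc a).inc c := by rw [h1, RowSeq.inc_dec]
  have d3 : (((nu.inc a).inc b).inc c).dec a = (nu.inc c).inc b := by rw [h2, RowSeq.inc_dec]
  have f : ∀ x y : ℕ, ((nu.inc x).inc y).dec x = nu.inc y := fun x y => by
    rw [nu.inc_comm, RowSeq.inc_dec]
  simp only [termF, d1, d2, d3, RowSeq.inc_dec, f]
  have := D.dressF.serre hj r s t nu a b c
  rw [nu.inc_comm c b, nu.inc_comm a b, nu.inc_comm a c] at this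
  simp only [nu.inc_comm c b, nu.inc_comm a b, nu.inc_comm a c]
  linear_combination this

end FockDatum

/-! ### Partial fractions -/

theorem mul_eq_smul_add_smul {A : Type} [CommRing A] [Algebra ℂ A] {Z Y Wa Ws : A}
    {α β a s u v : ℂ} (h1 : u + v = α) (h2 : u * a + v * s = β)
    (ha : Wa * (Z - a • Y) = 1) (hs : Ws * (Z - s • Y) = 1) :
    (α • Z - β • Y) * Wa * (Z * Ws) = u • (Z * Ws) + v • (Z * Wa) := by
  subst h1 h2
  simp only [Algebra.smul_def, map_add, map_mul] at *
  linear_combination algebraMap ℂ A u * Z * Ws * ha + algebraMap ℂ A v * Z * Wa * hs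

theorem mul_eq_smul_one_add_smul {A : Type} [CommRing A] [Algebra ℂ A] {Z Y Wa : A}
    {α β a u v : ℂ} (h1 : u + v = α) (h2 : u * a = β) (ha : Wa * (Z - a • Y) = 1) :
    (α • Z - β • Y) * Wa = u • 1 + v • (Z * Wa) := by
  subst h1 h2
  simp only [Algebra.smul_def, map_add, map_mul] at *
  linear_combination algebraMap ℂ A u * ha

/-- Partial fractions for a product of quotients of linear forms with simple poles, the same
in all algebras in which the denominators are invertible. -/
theorem exists_partial_fractions {ι : Type} [DecidableEq ι] (S : Finset ι) (p α β : ι → ℂ)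
    (hp : ∀ s ∈ S, p s ≠ 0) (hinj : Set.InjOn p S) :
    ∃ c : ℂ, ∀ (A : Type) [CommRing A] [Algebra ℂ A] (Z Y : A) (W : ι → A),
      (∀ s ∈ S, W s * (Z - p s • Y) = 1) →
      ∏ s ∈ S, (α s • Z - β s • Y) * W s = c • (1 : A) + ∑ s ∈ S,
        ((α s - β s / p s) * ∏ t ∈ S.erase s, (α t * p s - β t) / (p s - p t)) • (Z * W s) := by
  induction S using Finset.induction_on with
  | empty => exact ⟨1, fun A _ _ Z Y W _ => by simp⟩
  | insert a S ha ih =>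
    obtain ⟨c, hc⟩ := ih (fun s hs => hp s (Finset.mem_insert_of_mem hs))
      (hinj.mono (by simp))
    have hpa := hp a (Finset.mem_insert_self a S)
    have hne : ∀ s ∈ S, p a - p s ≠ 0 := fun s hs => sub_ne_zero.2 fun h => ha (by
      rwa [hinj (Finset.mem_coe.2 (Finset.mem_insert_self a S))
        (Finset.mem_coe.2 (Finset.mem_insert_of_mem hs)) h])
    set R : ι → ℂ := fun s =>
      (α s - β s / p s) * ∏ t ∈ S.erase s, (α t * p s - β t) / (p s - p t) with hR
    have hval := hc ℂ (p a) 1 (fun s => (p a - p s)⁻¹) (fun s hs => by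
      rw [smul_eq_mul, mul_one, inv_mul_cancel₀ (hne s hs)])
    refine ⟨c * (β a / p a), fun A _ _ Z Y W hW => ?_⟩
    have hWa := hW a (Finset.mem_insert_self a S)
    have hWs := fun s hs => hW s (Finset.mem_insert_of_mem (a := s) hs)
    have e1 : ∀ s ∈ S, (α a • Z - β a • Y) * W a * (R s • (Z * W s)) =
        (R s * ((α a * p s - β a) / (p s - p a))) • (Z * W s) +
        ((α a - β a / p a) * (R s * (p a * (p a - p s)⁻¹))) • (Z * W a) := by
      intro s hs
      have h := hne s hs
      have h' : p s - p a ≠ 0 := by rw [← neg_sub]; exact neg_ne_zero.2 h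
      rw [mul_smul_comm, mul_eq_smul_add_smul (u := (α a * p s - β a) / (p s - p a))
        (v := (α a * p a - β a) / (p a - p s)) _ _ hWa (hWs s hs), smul_add, smul_smul, smul_smul]
      · congr 2
        field_simp
      · rw [← neg_sub (p a) (p s)] at h' ⊢
        field_simp
        ring
      · rw [← neg_sub (p a) (p s)] at h' ⊢
        field_simp
        ring
    rw [Finset.prod_insert ha, Finset.sum_insert ha, Finset.erase_insert ha, hc A Z Y W hWs,
      mul_add, Finset.mul_sum, Finset.sum_congr rfl e1, Finset.sum_add_distrib, mul_smul_comm,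
      mul_one, mul_eq_smul_one_add_smul (u := β a / p a) (v := α a - β a / p a) (by ring)
        (by field_simp) hWa]
    have e2 : ∏ t ∈ S, (α t * p a - β t) / (p a - p t) =
        c + ∑ s ∈ S, R s * (p a * (p a - p s)⁻¹) := by
      simpa [div_eq_mul_inv, hR] using hval
    have e3 : ∀ s ∈ S, ((α s - β s / p s) *
        ∏ t ∈ (insert a S).erase s, (α t * p s - β t) / (p s - p t)) • (Z * W s) =
        (R s * ((α a * p s - β a) / (p s - p a))) • (Z * W s) := by
      intro s hs
      have hsa : a ≠ s := fun h => ha (by rwa [h])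
      rw [Finset.erase_insert_of_ne hsa, Finset.prod_insert (by simp [ha])]
      congr 1
      simp only [hR]; ring
    rw [e2, Finset.sum_congr rfl e3, ← Finset.sum_smul, ← Finset.mul_sum]
    module

/-! ### Power series -/

open PowerSeries in
theorem mk_pow_mul (p : ℂ) : (mk fun t => p ^ t) * (1 - C p * X) = (1 : PowerSeries ℂ) := by
  ext t
  rw [mul_sub, mul_one, ← mul_assoc, map_sub]
  cases t with
  | zero => simp
  | succ t =>
    rw [coeff_succ_mul_X, mul_comm, coeff_C_mul, coeff_mk, coeff_mk, coeff_one]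
    simp [pow_succ']

open PowerSeries in
theorem mk_inv_pow_mul {p : ℂ} (hp : p ≠ 0) :
    (mk fun t => if t = 0 then 0 else -(p⁻¹) ^ t) * (X - C p) = (X : PowerSeries ℂ) := by
  ext t
  rw [mul_sub, map_sub, mul_comm _ (C p), coeff_C_mul, coeff_mk]
  cases t with
  | zero => simp
  | succ t =>
    rw [coeff_succ_mul_X, coeff_mk, coeff_X]
    rcases t with _ | t
    · simp [hp]
    · simp [pow_succ]
      field_simp
      ring

namespace FockDatum

variable {n : ℕ} (D : FockDatum n)

open PowerSeries in
/-- The coordinates `Z`, `Y` with `z = Z / Y`: both are power series in a local coordinate, and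
`z` is not a nonzero constant at the center of the expansion. -/
structure IsFrame (Z Y : PowerSeries ℂ) : Prop where
  unit : ∀ a : ℂ, a ≠ 0 → constantCoeff (Z - C a * Y) ≠ 0

open PowerSeries

theorem isFrame_infty : IsFrame 1 X := ⟨fun a _ => by simp⟩

theorem isFrame_zero : IsFrame X 1 := ⟨fun a h => by simpa using h⟩

variable (Z Y : PowerSeries ℂ)

/-- The expansion of `ψ(a/z)`. -/
def serPsi (a : ℂ) : PowerSeries ℂ := (C D.q * Z - C (D.q⁻¹ * a) * Y) * (Z - C a * Y)⁻¹

/-- The expansion of the contribution of the last box of a row. -/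
def serA (i : ZMod n) (s : ℕ) (v : ℤ) : PowerSeries ℂ :=
  if i = D.col s v + 1 then D.serPsi Z Y (D.pos s (v - 1)) else 1

/-- The expansion of the contribution of the box that can be added to a row. -/
def serB (i : ZMod n) (s : ℕ) (v : ℤ) : PowerSeries ℂ :=
  if i = D.col s v then (D.serPsi Z Y (D.q ^ 2 * D.pos s v))⁻¹ else 1

/-- The expansion of the contribution of a row. -/
def serG (i : ZMod n) (s : ℕ) (v : ℤ) : PowerSeries ℂ := D.serA Z Y i s v * D.serB Z Y i s v

variable {Z Y} (hZ : IsFrame Z Y)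

include hZ

theorem serPsi_ne {a : ℂ} (ha : a ≠ 0) : constantCoeff (D.serPsi Z Y (D.q ^ 2 * a)) ≠ 0 := by
  have hq := D.q_ne
  have e : C D.q * Z - C (D.q⁻¹ * (D.q ^ 2 * a)) * Y = C D.q * (Z - C a * Y) := by
    have : D.q⁻¹ * (D.q ^ 2 * a) = D.q * a := by field_simp
    rw [this, map_mul]; ring
  rw [serPsi, e, map_mul, map_mul, constantCoeff_C, constantCoeff_inv]
  exact mul_ne_zero (mul_ne_zero hq (hZ.unit a ha))
    (inv_ne_zero (hZ.unit _ (mul_ne_zero (pow_ne_zero 2 hq) ha)))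

theorem serPsi_inv {a : ℂ} (ha : a ≠ 0) : (D.serPsi Z Y (D.q ^ 2 * a))⁻¹ =
    (C D.q⁻¹ * Z - C (D.q * a) * Y) * (Z - C a * Y)⁻¹ := by
  have hq := D.q_ne
  have hc : C D.q * C D.q⁻¹ = (1 : PowerSeries ℂ) := by rw [← map_mul, mul_inv_cancel₀ hq, map_one]
  rw [PowerSeries.inv_eq_iff_mul_eq_one (D.serPsi_ne hZ ha), serPsi]
  have h1 := PowerSeries.mul_inv_cancel _ (hZ.unit a ha)
  have h2 := PowerSeries.mul_inv_cancel _ (hZ.unit (D.q ^ 2 * a)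
    (mul_ne_zero (pow_ne_zero 2 hq) ha))
  have e : D.q⁻¹ * (D.q ^ 2 * a) = D.q * a := by field_simp
  rw [e]
  simp only [map_mul, map_pow] at *
  generalize (Z - C a * Y)⁻¹ = U at *
  generalize (Z - C D.q ^ 2 * C a * Y)⁻¹ = V at *
  generalize C D.q⁻¹ = k at *
  generalize C D.q = K at *
  linear_combination Z * U * (Z - C a * Y) * V * hc + (Z - K ^ 2 * C a * Y) * V * h1 + h2

theorem serA_mul_serB_succ (i : ZMod n) (s : ℕ) (v : ℤ) :
    D.serA Z Y i s v * D.serB Z Y i (s + 1) v = 1 := by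
  rw [serA, serB, col_succ]
  split_ifs with h
  · have key : D.pos s (v - 1) = D.q ^ 2 * D.pos (s + 1) v := by
      rw [← D.pos_sub_one_div_pos_succ s v, div_mul_cancel₀ _ (D.pos_ne_zero _ _)]
    rw [key]
    exact PowerSeries.mul_inv_cancel _ (D.serPsi_ne hZ (D.pos_ne_zero _ _))
  · simp

theorem serG_add_one (i : ZMod n) (s : ℕ) (v : ℤ) :
    (C (D.q ^ cartan i (D.col s v) * D.pos s v) * Y - C (D.d ^ mMatrix i (D.col s v)) * Z) *
      D.serG Z Y i s (v + 1) =
    (C (D.pos s v) * Y - C (D.d ^ mMatrix i (D.col s v) * D.q ^ cartan i (D.col s v)) * Z) *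
      D.serG Z Y i s v := by
  have hq := D.q_ne
  have hd := D.d_ne
  have hp := D.p₁_ne
  have hp' : D.p₁ = D.d / D.q := rfl
  have hw := D.pos_ne_zero s v
  have e1 := D.add_one_ne
  have e2 := D.add_one_add_one_ne
  have hc : C D.q * C D.q⁻¹ = (1 : PowerSeries ℂ) := by rw [← map_mul, mul_inv_cancel₀ hq, map_one]
  have hcd : C D.d * C D.d⁻¹ = (1 : PowerSeries ℂ) := by rw [← map_mul, mul_inv_cancel₀ hd, map_one]
  have hj := D.col_add_one s v
  rw [serG, serG, serA, serB, serA, serB, col_add_one, add_sub_cancel_right]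
  generalize D.col s (v + 1) = j' at *
  generalize D.col s v = j at *
  subst hj
  by_cases h0 : i = j' + 1
  · subst h0
    rw [if_pos rfl, if_neg (e1 _), if_neg (Ne.symm (e1 _)), if_pos rfl, cartan_self,
      D.mMatrix_self, D.serPsi_inv hZ hw, serPsi, zpow_zero, one_mul, map_one, one_mul, mul_one,
      one_mul, zpow_ofNat]
    simp only [map_mul, map_pow]
    linear_combination (Z - C (D.pos s v) * Y)⁻¹ * C D.q *
      (Z ^ 2 - C (D.pos s v) ^ 2 * Y ^ 2) * hc
  by_cases h1 : i = j' + 1 + 1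
  · subst h1
    have hb : D.pos s v = D.d * D.q⁻¹ * D.pos s (v - 1) := by
      rw [pos_sub_one, hp']; field_simp
    have h := PowerSeries.mul_inv_cancel _ (hZ.unit (D.pos s (v - 1)) (D.pos_ne_zero _ _))
    rw [if_neg (e1 _), if_neg (e2 _), if_pos rfl, if_neg (e1 _), mul_one, mul_one, mul_one,
      cartan, mMatrix, if_neg (e1 _), if_pos (Or.inr rfl), if_neg (Ne.symm (e2 _)), if_pos rfl,
      zpow_one, zpow_neg_one, serPsi, hb]
    generalize D.pos s (v - 1) = b at *
    simp only [map_mul] at *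
    linear_combination C D.d * C D.q⁻¹ * (C D.q * Z - C D.q⁻¹ * C b * Y) * h + C D.d * Z * hc
  by_cases h2 : i = j'
  · subst h2
    have hb : D.pos s (v + 1) = D.d * D.q⁻¹ * D.pos s v := by
      rw [pos_add_one, hp']; field_simp
    have h := PowerSeries.mul_inv_cancel _ (hZ.unit (D.pos s (v + 1)) (D.pos_ne_zero _ _))
    rw [if_neg (Ne.symm (e1 _)), if_pos rfl, if_neg (Ne.symm (e2 _)), if_neg (Ne.symm (e1 _)),
      mul_one, mul_one, one_mul, cartan, mMatrix, if_neg (Ne.symm (e1 _)), if_pos (Or.inl rfl),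
      if_pos rfl, zpow_neg_one, zpow_neg_one, D.serPsi_inv hZ (D.pos_ne_zero _ _)]
    rw [hb] at h ⊢
    generalize D.pos s v = w at *
    simp only [map_mul] at *
    generalize (Z - C D.d * C D.q⁻¹ * C w * Y)⁻¹ = U at *
    linear_combination (-C D.d⁻¹ * (C D.q⁻¹ * Z - C D.q * (C D.d * C D.q⁻¹ * C w) * Y)) * h -
      (C D.q⁻¹ * C w * Y * (C D.q⁻¹ * Z - C D.q * (C D.d * C D.q⁻¹ * C w) * Y) * U) * hcd +
      C w * Y * (C D.d * C D.d⁻¹ * hc + hcd)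
  have h3 : ¬ (j' + 1 = i + 1 ∨ i = j' + 1 + 1) := by
    rintro (h | h)
    · exact h2 (add_right_cancel h).symm
    · exact h1 h
  rw [if_neg h0, if_neg h2, if_neg h1, if_neg h0, cartan, mMatrix, if_neg h0, if_neg h3,
    if_neg (fun h => h3 (Or.inl h)), if_neg h1]
  simp

end FockDatum

namespace FockDatum

open PowerSeries RowSpace

variable {n : ℕ} (D : FockDatum n)

section Series

variable (Z Y : PowerSeries ℂ)

/-- The eigenvalue of `K_i(z)`. -/
def ser (i : ZMod n) (lam : RowSeq) : PowerSeries ℂ :=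
  (∏ s ∈ Finset.range lam.exists_bdd.choose, D.serG Z Y i s (lam s)) *
    D.serB Z Y i lam.exists_bdd.choose 0

variable {Z Y} (hZ : IsFrame Z Y)

include hZ

theorem ser_eq (i : ZMod n) {lam : RowSeq} {N : ℕ} (hN : lam.Bdd N) :
    D.ser Z Y i lam = (∏ s ∈ Finset.range N, D.serG Z Y i s (lam s)) * D.serB Z Y i N 0 := by
  have key : ∀ {N N' : ℕ}, lam.Bdd N → N ≤ N' →
      (∏ s ∈ Finset.range N', D.serG Z Y i s (lam s)) * D.serB Z Y i N' 0 =
      (∏ s ∈ Finset.range N, D.serG Z Y i s (lam s)) * D.serB Z Y i N 0 := by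
    intro N N' hN h
    rw [← prod_Ico_mul_tail (fun s => D.serA Z Y i s 0) (fun s => D.serB Z Y i s 0) N
      (fun s _ => D.serA_mul_serB_succ hZ i s 0) h, ← Finset.prod_range_mul_prod_Ico _ h, mul_assoc]
    congr 2
    refine Finset.prod_congr rfl fun s hs => ?_
    rw [hN s (Finset.mem_Ico.1 hs).1]
    rfl
  have hN0 := lam.exists_bdd.choose_spec
  rw [ser, ← key hN0 (le_max_left _ N), ← key hN (le_max_right lam.exists_bdd.choose N)]

theorem ser_inc (i : ZMod n) (lam : RowSeq) (a : ℕ) :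
    (C (D.q ^ cartan i (D.col a (lam a)) * D.pos a (lam a)) * Y -
        C (D.d ^ mMatrix i (D.col a (lam a))) * Z) * D.ser Z Y i (lam.inc a) =
    (C (D.pos a (lam a)) * Y -
        C (D.d ^ mMatrix i (D.col a (lam a)) * D.q ^ cartan i (D.col a (lam a))) * Z) *
      D.ser Z Y i lam := by
  obtain ⟨N, hN⟩ := lam.exists_bdd
  have hN' := hN.mono (le_max_left N (a + 1))
  have ha : a < max N (a + 1) := by omega
  rw [D.ser_eq hZ i hN', D.ser_eq hZ i (hN'.inc ha),
    ← Finset.mul_prod_erase _ _ (Finset.mem_range.2 ha),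
    ← Finset.mul_prod_erase _ (fun s => D.serG Z Y i s (lam s)) (Finset.mem_range.2 ha),
    lam.inc_self, ← mul_assoc, ← mul_assoc, ← mul_assoc, ← mul_assoc, D.serG_add_one hZ]
  congr 2
  refine Finset.prod_congr rfl fun s hs => ?_
  rw [lam.inc_of_ne (Ne.symm (Finset.ne_of_mem_erase hs))]

end Series

theorem constantCoeff_serPsi_infty (a : ℂ) : constantCoeff (D.serPsi 1 X a) = D.q := by
  simp [serPsi]

theorem constantCoeff_serPsi_zero {a : ℂ} (ha : a ≠ 0) :
    constantCoeff (D.serPsi X 1 a) = D.q⁻¹ := by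
  simp [serPsi]
  field_simp

theorem constantCoeff_ser (i : ZMod n) (lam : RowSeq) :
    constantCoeff (D.ser 1 X i lam) * constantCoeff (D.ser X 1 i lam) = 1 := by
  have hq := D.q_ne
  have hB : ∀ s v, constantCoeff (D.serB 1 X i s v) * constantCoeff (D.serB X 1 i s v) = 1 := by
    intro s v
    rw [serB, serB]
    split_ifs
    · rw [constantCoeff_inv, constantCoeff_inv, constantCoeff_serPsi_infty,
        constantCoeff_serPsi_zero _ (mul_ne_zero (pow_ne_zero 2 hq) (D.pos_ne_zero _ _))]
      field_simp
    · simp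
  have hA : ∀ s v, constantCoeff (D.serA 1 X i s v) * constantCoeff (D.serA X 1 i s v) = 1 := by
    intro s v
    rw [serA, serA]
    split_ifs
    · rw [constantCoeff_serPsi_infty, constantCoeff_serPsi_zero _ (D.pos_ne_zero _ _)]
      field_simp
    · simp
  rw [ser, ser, map_mul, map_mul, mul_mul_mul_comm, hB, mul_one, map_prod, map_prod,
    ← Finset.prod_mul_distrib]
  refine Finset.prod_eq_one fun s _ => ?_
  rw [serG, serG, map_mul, map_mul, mul_mul_mul_comm, hA, hB, mul_one]

/-- The coefficient of `z^{-m}` of the expansion at infinity of the eigenvalue of `K_i(z)`. -/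
def kPlus (i : ZMod n) (lam : RowSeq) (m : ℤ) : ℂ :=
  if 0 ≤ m then coeff m.toNat (D.ser 1 X i lam) else 0

/-- The coefficient of `z^{-m}` of the expansion at zero of the eigenvalue of `K_i(z)`. -/
def kMinus (i : ZMod n) (lam : RowSeq) (m : ℤ) : ℂ :=
  if m ≤ 0 then coeff (-m).toNat (D.ser X 1 i lam) else 0

/-! ### Residues -/

/-- The pole of the contribution of the row `s`. -/
def pole (i : ZMod n) (lam : RowSeq) (s : ℕ) : ℂ :=
  if i = D.col s (lam s) + 1 then D.pos s (lam s - 1) else D.pos s (lam s)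

/-- The leading coefficient of the contribution of a row. -/
def lead (i : ZMod n) (lam : RowSeq) (s : ℕ) : ℂ :=
  if i = D.col s (lam s) + 1 then D.q else if i = D.col s (lam s) then D.q⁻¹ else 1

theorem pole_ne_zero (i : ZMod n) (lam : RowSeq) (s : ℕ) : D.pole i lam s ≠ 0 := by
  rw [pole]; split_ifs <;> exact D.pos_ne_zero _ _

theorem pole_ne (i : ZMod n) (lam mu : RowSeq) {s t : ℕ} (h : s ≠ t) :
    D.pole i lam s ≠ D.pole i mu t := by
  rw [pole, pole]; split_ifs <;> exact D.pos_ne h _ _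

theorem serG_eq_lead {Z Y : PowerSeries ℂ} (hZ : IsFrame Z Y) (i : ZMod n) (lam : RowSeq) (s : ℕ) :
    D.serG Z Y i s (lam s) =
      (D.lead i lam s • Z - ((D.lead i lam s)⁻¹ * D.pole i lam s) • Y) *
        (Z - D.pole i lam s • Y)⁻¹ := by
  have e1 := D.add_one_ne (D.col s (lam s))
  rw [serG, serA, serB, lead, pole]
  by_cases h1 : i = D.col s (lam s) + 1
  · subst h1
    rw [if_pos rfl, if_pos rfl, if_pos rfl, if_neg e1, mul_one, serPsi]
    simp only [smul_eq_C_mul]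
  · rw [if_neg h1, if_neg h1, if_neg h1]
    by_cases h2 : i = D.col s (lam s)
    · subst h2
      rw [if_pos rfl, if_pos rfl, one_mul, D.serPsi_inv hZ (D.pos_ne_zero _ _), inv_inv]
      simp only [smul_eq_C_mul]
    · rw [if_neg h2, if_neg h2, inv_one, one_mul, one_smul, one_mul, smul_eq_C_mul,
        PowerSeries.mul_inv_cancel _ (hZ.unit _ (D.pos_ne_zero _ _))]

theorem rowG_eq_lead (i : ZMod n) (lam : RowSeq) (s : ℕ) {z : ℂ} (hz : z ≠ 0)
    (h : z ≠ D.pole i lam s) : D.rowG i s (lam s) z =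
      (D.lead i lam s * z - (D.lead i lam s)⁻¹ * D.pole i lam s) / (z - D.pole i lam s) := by
  have e1 := D.add_one_ne (D.col s (lam s))
  rw [pole] at h ⊢
  rw [rowG, rowA, rowB, lead]
  by_cases h1 : i = D.col s (lam s) + 1
  · subst h1
    rw [if_pos rfl, if_pos rfl, if_pos rfl, if_neg e1, mul_one, D.psi_div hz]
  · rw [if_neg h1] at h
    rw [if_neg h1, if_neg h1, if_neg h1]
    have h' : z - D.pos s (lam s) ≠ 0 := sub_ne_zero.2 h
    by_cases h2 : i = D.col s (lam s)
    · subst h2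
      have h'' : D.pos s (lam s) - z ≠ 0 := sub_ne_zero.2 h.symm
      rw [if_pos rfl, if_pos rfl, one_mul, D.psi_div (D.pos_ne_zero _ _), inv_inv,
        ← neg_div_neg_eq]
      congr 1 <;> ring
    · rw [if_neg h2, if_neg h2, inv_one, one_mul, one_mul, one_mul, div_self h']

/-- The residue of the eigenvalue of `K_i(z)` at the pole of the row `s`, where `N` bounds the
rows. -/
def res (i : ZMod n) (lam : RowSeq) (N s : ℕ) : ℂ :=
  (D.lead i lam s - (D.lead i lam s)⁻¹) *
    ∏ t ∈ (Finset.range N).erase s, D.rowG i t (lam t) (D.pole i lam s)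

theorem kPlus_sub_kMinus (i : ZMod n) {lam : RowSeq} {N : ℕ} (hN : lam.Bdd N)
    (hi : D.col N 0 ≠ i) (m : ℤ) : D.kPlus i lam m - D.kMinus i lam m =
      ∑ s ∈ Finset.range N, D.res i lam N s * D.pole i lam s ^ m := by
  obtain ⟨c, hc⟩ := exists_partial_fractions (Finset.range N) (D.pole i lam) (D.lead i lam)
    (fun s => (D.lead i lam s)⁻¹ * D.pole i lam s) (fun s _ => D.pole_ne_zero i lam s)
    (fun s _ t _ h => by
      by_contra h'
      exact D.pole_ne i lam lam h' h)
  have hres : ∀ s, (D.lead i lam s - (D.lead i lam s)⁻¹ * D.pole i lam s / D.pole i lam s) *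
      ∏ t ∈ (Finset.range N).erase s, (D.lead i lam t * D.pole i lam s -
        (D.lead i lam t)⁻¹ * D.pole i lam t) / (D.pole i lam s - D.pole i lam t) =
      D.res i lam N s := by
    intro s
    rw [mul_div_cancel_right₀ _ (D.pole_ne_zero i lam s), res]
    congr 1
    refine Finset.prod_congr rfl fun t ht => ?_
    rw [D.rowG_eq_lead i lam t (D.pole_ne_zero i lam s)
      (D.pole_ne i lam lam (Ne.symm (Finset.ne_of_mem_erase ht)))]
  have key : ∀ {Z Y : PowerSeries ℂ}, IsFrame Z Y → D.ser Z Y i lam = C c +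
      ∑ s ∈ Finset.range N, C (D.res i lam N s) * (Z * (Z - C (D.pole i lam s) * Y)⁻¹) := by
    intro Z Y hZ
    have h := hc (PowerSeries ℂ) Z Y (fun s => (Z - D.pole i lam s • Y)⁻¹) (fun s _ => by
      rw [smul_eq_C_mul]
      exact PowerSeries.inv_mul_cancel _ (hZ.unit _ (D.pole_ne_zero i lam s)))
    rw [D.ser_eq hZ i hN, serB, if_neg (Ne.symm hi), mul_one,
      Finset.prod_congr rfl (fun s _ => D.serG_eq_lead hZ i lam s), h]
    simp only [hres, smul_eq_C_mul, mul_one]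
  have h1 : ∀ p : ℂ, (1 - C p * X)⁻¹ = PowerSeries.mk fun t => p ^ t := by
    intro p
    rw [PowerSeries.inv_eq_iff_mul_eq_one (by simp), mk_pow_mul]
  have h2 : ∀ p : ℂ, p ≠ 0 → X * (X - C p)⁻¹ =
      PowerSeries.mk fun t => if t = 0 then 0 else -(p⁻¹) ^ t := by
    intro p hp
    have h := mk_inv_pow_mul hp
    generalize PowerSeries.mk (fun t => if t = 0 then 0 else -(p⁻¹) ^ t) = f at h ⊢
    have h' := PowerSeries.mul_inv_cancel (X - C p) (by simpa using hp)
    generalize (X - C p)⁻¹ = g at h' ⊢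
    linear_combination f * h' - g * h
  have e1 := key isFrame_infty
  have e2 := key isFrame_zero
  simp only [one_mul, h1] at e1
  simp only [mul_one, h2 _ (D.pole_ne_zero i lam _)] at e2
  rw [kPlus, kMinus, e1, e2]
  simp only [map_add, map_sum, coeff_C_mul, coeff_mk]
  rcases lt_trichotomy m 0 with hm | rfl | hm
  · obtain ⟨t, ht⟩ : ∃ t : ℕ, m = -((t : ℤ) + 1) := ⟨(-m - 1).toNat, by omega⟩
    subst ht
    have : (-(-((t : ℤ) + 1))).toNat = t + 1 := by omega
    rw [if_neg (by omega), if_pos (by omega), this, coeff_C, if_neg (by omega), zero_add, zero_sub,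
      ← Finset.sum_neg_distrib]
    refine Finset.sum_congr rfl fun s _ => ?_
    rw [if_neg (by omega), zpow_neg, inv_pow]
    norm_cast
    ring
  · simp
  · obtain ⟨t, ht⟩ : ∃ t : ℕ, m = (t : ℤ) + 1 := ⟨(m - 1).toNat, by omega⟩
    subst ht
    have : ((t : ℤ) + 1).toNat = t + 1 := by omega
    rw [if_pos (by omega), if_neg (by omega), this, coeff_C, if_neg (by omega), zero_add, sub_zero]
    refine Finset.sum_congr rfl fun s _ => ?_
    norm_cast

theorem termF_mul_termE_sub (i : ZMod n) (r s : ℤ) {lam : RowSeq} {N : ℕ} (hN : lam.Bdd N)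
    (hi : D.col N 0 ≠ i) {a : ℕ} (ha : a < N) :
    D.termF i s lam a * D.dressE.term i r (lam.dec a) a -
      D.dressE.term i r lam a * D.termF i s (lam.inc a) a =
    (D.q - D.q⁻¹)⁻¹ * (D.res i lam N a * D.pole i lam a ^ (r + s)) := by
  have hq := D.q_ne
  have hqq := D.q_sub_inv_ne
  have hB : ∀ z, D.rowB i N 0 z = 1 := fun z => by rw [rowB, if_neg (Ne.symm hi)]
  have e1 := D.add_one_ne (D.col a (lam a))
  simp only [termF, RowSeq.inc_dec]
  by_cases h1 : D.col a (lam.dec a a) = i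
  · have h1' : i = D.col a (lam a) + 1 := by rw [← h1, lam.dec_self, col_sub_one]
    have h2 : D.col a (lam a) ≠ i := by rw [h1']; exact Ne.symm e1
    have h := D.dressE_mul_dressF h1 (hN.dec ha) ha
    rw [hB, mul_one] at h
    rw [D.dressE.term_zero h2, zero_mul, sub_zero, res, pole, lead, if_pos h1', if_pos h1']
    simp only [Dressing.term]
    rw [lam.dec_self] at h ⊢
    rw [zpow_add₀ (D.pos_ne_zero _ _)]
    have e : ∏ t ∈ (Finset.range N).erase a, D.rowG i t (lam.dec a t) (D.pos a (lam a - 1)) =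
        ∏ t ∈ (Finset.range N).erase a, D.rowG i t (lam t) (D.pos a (lam a - 1)) :=
      Finset.prod_congr rfl fun t ht => by
        rw [lam.dec_of_ne (Ne.symm (Finset.ne_of_mem_erase ht))]
    rw [← e, ← h]
    linear_combination (-D.dressF.coef i (lam.dec a) a * D.pos a (lam a - 1) ^ s *
      D.dressE.coef i (lam.dec a) a * D.pos a (lam a - 1) ^ r) * inv_mul_cancel₀ hqq
  · have h1' : ¬ i = D.col a (lam a) + 1 := by
      rw [lam.dec_self, col_sub_one] at h1
      exact Ne.symm h1
    rw [D.dressE.term_zero h1, mul_zero, zero_sub, res, pole, lead, if_neg h1', if_neg h1']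
    by_cases h2 : D.col a (lam a) = i
    · have h := D.dressE_mul_dressF h2 hN ha
      rw [hB, mul_one] at h
      rw [if_pos h2.symm, ← h, inv_inv, zpow_add₀ (D.pos_ne_zero _ _)]
      simp only [Dressing.term]
      linear_combination (D.dressE.coef i lam a * D.pos a (lam a) ^ r * D.dressF.coef i lam a *
        D.pos a (lam a) ^ s) * inv_mul_cancel₀ hqq
    · rw [if_neg (Ne.symm h2), D.dressE.term_zero h2]
      simp

theorem opE_opF (i j : ZMod n) (r s : ℤ) (lam : RowSeq) :
    (D.opE i r * D.opF j s - D.opF j s * D.opE i r) (vec lam) =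
      if i = j then ((D.q - D.q⁻¹)⁻¹ * (D.kPlus i lam (r + s) - D.kMinus i lam (r + s))) • vec lam
      else 0 := by
  obtain ⟨N, hN⟩ := lam.exists_bdd
  obtain ⟨M, hM, hi⟩ := D.exists_rowB_eq_one i (N + 2) 0
  have hM' : lam.Bdd M := hN.mono (by omega)
  rw [LinearMap.sub_apply, Module.End.mul_apply, Module.End.mul_apply, opE, opF,
    op_op_vec' isRowMap_dec (D.isLocal_termF j s) (D.isLocal_termE i r) hN (show N + 1 < M by omega),
    op_op_vec isRowMap_inc (D.isLocal_termE i r) (D.isLocal_termF j s) hN (show N + 1 < M by omega)]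
  simp only [← Finset.sum_sub_distrib]
  have key : ∀ a ∈ Finset.range M, ∑ b ∈ Finset.range M,
      ((D.termF j s lam b * D.dressE.term i r (lam.dec b) a) • vec ((lam.dec b).inc a) -
        (D.dressE.term i r lam a * D.termF j s (lam.inc a) b) • vec ((lam.inc a).dec b)) =
      (D.termF j s lam a * D.dressE.term i r (lam.dec a) a -
        D.dressE.term i r lam a * D.termF j s (lam.inc a) a) • vec lam := by
    intro a ha
    rw [Finset.sum_eq_single_of_mem a ha]
    · rw [RowSeq.dec_inc, RowSeq.inc_dec, ← sub_smul]
    · intro b _ hb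
      rw [RowSeq.inc_dec_comm, ← sub_smul]
      have h := D.dressE_comm_dressF i j r s (lam.dec b) (Ne.symm hb)
      rw [RowSeq.dec_inc] at h
      simp only [termF, RowSeq.inc_dec_comm]
      rw [h, sub_self, zero_smul]
  rw [Finset.sum_congr rfl key, ← Finset.sum_smul]
  split_ifs with hij
  · subst hij
    rw [Finset.sum_congr rfl fun a ha => D.termF_mul_termE_sub i r s hM' hi (Finset.mem_range.1 ha),
      ← Finset.mul_sum, D.kPlus_sub_kMinus i hM' hi]
  · rw [Finset.sum_eq_zero, zero_smul]
    intro a _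
    have h1 : D.termF j s lam a * D.dressE.term i r (lam.dec a) a = 0 := by
      by_cases h : D.col a (lam.dec a a) = j
      · rw [D.dressE.term_zero (by rw [h]; exact Ne.symm hij), mul_zero]
      · rw [termF, D.dressF.term_zero h, zero_mul]
    have h2 : D.dressE.term i r lam a * D.termF j s (lam.inc a) a = 0 := by
      rw [termF, RowSeq.inc_dec]
      by_cases h : D.col a (lam a) = j
      · rw [D.dressE.term_zero (by rw [h]; exact Ne.symm hij), zero_mul]
      · rw [D.dressF.term_zero h, mul_zero]
    rw [h1, h2, sub_self]

end FockDatum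

/-! ### Exponentials of power series -/

theorem map_coeff_expSeries {A B : Type} [Ring A] [Algebra ℂ A] [Ring B] [Algebra ℂ B]
    (φ : A →ₐ[ℂ] B) (f : PowerSeries A) (l : ℕ) :
    φ (PowerSeries.coeff l (expSeries f)) =
      PowerSeries.coeff l (expSeries (PowerSeries.map (φ : A →+* B) f)) := by
  simp only [expSeries, PowerSeries.coeff_mk, map_sum, map_smul, ← map_pow,
    PowerSeries.coeff_map]
  rfl

theorem map_coeff_expSeries_mk {A B : Type} [Ring A] [Algebra ℂ A] [Ring B] [Algebra ℂ B]
    (φ : A →ₐ[ℂ] B) (f : ℕ → A) (l : ℕ) :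
    φ (PowerSeries.coeff l (expSeries (PowerSeries.mk f))) =
      PowerSeries.coeff l (expSeries (PowerSeries.mk fun m => φ (f m))) := by
  rw [map_coeff_expSeries]
  congr 2

/-- The coefficients of the logarithm of a power series with constant term `1`. -/
def logCoeff (φ : PowerSeries ℂ) (l : ℕ) : ℂ :=
  if l = 0 then 0 else PowerSeries.coeff l φ - ∑ r ∈ Finset.Ico 2 (l + 1),
    ((r.factorial : ℂ)⁻¹) * PowerSeries.coeff l
      ((PowerSeries.mk fun m => if _h : m < l then logCoeff φ m else 0) ^ r)
termination_by l

theorem coeff_pow_congr {f g : PowerSeries ℂ} {l : ℕ} (hf : PowerSeries.X ∣ f)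
    (hg : PowerSeries.X ∣ g) (h : PowerSeries.X ^ l ∣ f - g) {r : ℕ} (hr : 2 ≤ r) :
    PowerSeries.coeff l (f ^ r) = PowerSeries.coeff l (g ^ r) := by
  have h1 : PowerSeries.X ^ (l + 1) ∣ f ^ r - g ^ r := by
    rw [← geom_sum₂_mul, pow_succ']
    refine mul_dvd_mul (Finset.dvd_sum fun i hi => ?_) h
    rw [Finset.mem_range] at hi
    by_cases hi0 : i = 0
    · subst hi0
      exact Dvd.dvd.mul_left (dvd_pow hg (by omega)) _
    · exact Dvd.dvd.mul_right (dvd_pow hf hi0) _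
  have := PowerSeries.X_pow_dvd_iff.1 h1 l (Nat.lt_succ_self l)
  rwa [map_sub, sub_eq_zero] at this

theorem logCoeff_zero (φ : PowerSeries ℂ) : logCoeff φ 0 = 0 := by rw [logCoeff]; simp

theorem expSeries_logCoeff {φ : PowerSeries ℂ} (h : PowerSeries.constantCoeff φ = 1) :
    expSeries (PowerSeries.mk (logCoeff φ)) = φ := by
  ext l
  rw [expSeries, PowerSeries.coeff_mk]
  rcases l with _ | l
  · simpa using h.symm
  · have hs : Finset.range (l + 1 + 1) = insert 0 (insert 1 (Finset.Ico 2 (l + 1 + 1))) := by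
      ext r; simp only [Finset.mem_range, Finset.mem_insert, Finset.mem_Ico]; omega
    rw [hs, Finset.sum_insert (by simp), Finset.sum_insert (by simp)]
    simp only [Nat.factorial_zero, Nat.cast_one, inv_one, pow_zero, one_smul, pow_one,
      Nat.factorial_one, PowerSeries.coeff_one, PowerSeries.coeff_mk]
    rw [logCoeff, if_neg (by omega), if_neg (by omega), zero_add, sub_add]
    convert sub_zero _
    rw [sub_eq_zero]
    refine Finset.sum_congr rfl fun r hr => ?_
    rw [smul_eq_mul]
    congr 1
    refine (coeff_pow_congr ?_ ?_ ?_ (Finset.mem_Ico.1 hr).1).symm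
    · rw [PowerSeries.X_dvd_iff]; simp [logCoeff_zero]
    · rw [PowerSeries.X_dvd_iff]; simp [logCoeff_zero]
    · rw [PowerSeries.X_pow_dvd_iff]
      intro m hm
      rw [map_sub, PowerSeries.coeff_mk, PowerSeries.coeff_mk, dif_pos hm, sub_self]

namespace RowSpace

/-- The diagonal operators. -/
def diag : (RowSeq → ℂ) →ₐ[ℂ] Module.End ℂ RowSpace :=
  AlgHom.ofLinearMap
    { toFun := fun f => Finsupp.linearCombination ℂ fun lam => f lam • vec lam
      map_add' := fun f g => hom_ext fun lam => by simp [vec, add_smul]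
      map_smul' := fun c f => hom_ext fun lam => by simp [vec] }
    (hom_ext fun lam => by simp [vec])
    (fun f g => hom_ext fun lam => by simp [vec, mul_comm])

theorem diag_vec (f : RowSeq → ℂ) (lam : RowSeq) : diag f (vec lam) = f lam • vec lam := by
  simp [diag, vec]

end RowSpace

namespace FockDatum

open PowerSeries RowSpace

variable {n : ℕ} (D : FockDatum n)

/-- The eigenvalue of `H_{i,l}`. -/
def eigenH (i : ZMod n) (l : ℤ) (lam : RowSeq) : ℂ :=
  if 0 ≤ l then (D.q - D.q⁻¹)⁻¹ *
    logCoeff (C (constantCoeff (D.ser 1 X i lam))⁻¹ * D.ser 1 X i lam) l.toNat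
  else (-(D.q - D.q⁻¹))⁻¹ *
    logCoeff (C (constantCoeff (D.ser X 1 i lam))⁻¹ * D.ser X 1 i lam) (-l).toNat

theorem eigenH_zero (i : ZMod n) : D.eigenH i 0 = 0 := by
  ext lam
  rw [eigenH, if_pos le_rfl, Int.toNat_zero, logCoeff_zero, mul_zero]; rfl

/-- The operators by which the generators act. -/
def genOp : Gen n → Module.End ℂ RowSpace
  | Gen.E i m => D.opE i m
  | Gen.F i m => D.opF i m
  | Gen.H i l => diag (D.eigenH i l)
  | Gen.K i => diag fun lam => constantCoeff (D.ser 1 X i lam)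
  | Gen.Kinv i => diag fun lam => constantCoeff (D.ser X 1 i lam)

/-- The action of the free algebra. -/
def rhoFree : Free n →ₐ[ℂ] Module.End ℂ RowSpace := FreeAlgebra.lift ℂ D.genOp

theorem rhoFree_E (i : ZMod n) (m : ℤ) : D.rhoFree (Free.E i m) = D.opE i m :=
  FreeAlgebra.lift_ι_apply _ _

theorem rhoFree_F (i : ZMod n) (m : ℤ) : D.rhoFree (Free.F i m) = D.opF i m :=
  FreeAlgebra.lift_ι_apply _ _

theorem rhoFree_K (i : ZMod n) :
    D.rhoFree (Free.K i) = diag fun lam => constantCoeff (D.ser 1 X i lam) :=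
  FreeAlgebra.lift_ι_apply _ _

theorem rhoFree_Kinv (i : ZMod n) :
    D.rhoFree (Free.Kinv i) = diag fun lam => constantCoeff (D.ser X 1 i lam) :=
  FreeAlgebra.lift_ι_apply _ _

theorem rhoFree_H (i : ZMod n) (l : ℤ) : D.rhoFree (Free.H i l) = diag (D.eigenH i l) := by
  rw [Free.H]
  split_ifs with h
  · exact FreeAlgebra.lift_ι_apply _ _
  · rw [not_not] at h
    rw [h, eigenH_zero, map_zero, map_zero]

theorem coeff_expSeries_diag (c : ℂ) (f : ℕ → RowSeq → ℂ) (l : ℕ) :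
    coeff l (expSeries (PowerSeries.mk fun m => c • diag (f m))) =
      diag fun lam => coeff l (expSeries (PowerSeries.mk fun m => c * f m lam)) := by
  have h1 := map_coeff_expSeries_mk (B := Module.End ℂ RowSpace) diag (fun m => c • f m) l
  simp only [map_smul] at h1
  rw [← h1]
  congr 1
  ext lam
  exact map_coeff_expSeries_mk (Pi.evalAlgHom ℂ (fun _ : RowSeq => ℂ) lam) (fun m => c • f m) l

theorem constantCoeff_ser_ne (i : ZMod n) (lam : RowSeq) :
    constantCoeff (D.ser 1 X i lam) ≠ 0 ∧ constantCoeff (D.ser X 1 i lam) ≠ 0 := by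
  have h := D.constantCoeff_ser i lam
  exact ⟨left_ne_zero_of_mul_eq_one h, right_ne_zero_of_mul_eq_one h⟩

theorem rhoFree_Kplus (i : ZMod n) (r : ℤ) :
    D.rhoFree (Free.Kplus D.q i r) = diag fun lam => D.kPlus i lam r := by
  have hqq := D.q_sub_inv_ne
  rw [Free.Kplus]
  split_ifs with hr
  swap
  · rw [map_zero, ← map_zero diag]
    congr 1
    ext lam
    rw [kPlus, if_neg hr]; rfl
  rw [map_mul, rhoFree_K, map_coeff_expSeries_mk (A := Free n) (B := Module.End ℂ RowSpace) D.rhoFree]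
  simp only [map_smul, rhoFree_H]
  rw [coeff_expSeries_diag, ← map_mul]
  congr 1
  ext lam
  have h0 := (D.constantCoeff_ser_ne i lam).1
  have e : ∀ m : ℕ, (D.q - D.q⁻¹) * D.eigenH i m lam =
      logCoeff (C (constantCoeff (D.ser 1 X i lam))⁻¹ * D.ser 1 X i lam) m := by
    intro m
    rw [eigenH, if_pos (by omega), Int.toNat_natCast, mul_inv_cancel_left₀ hqq]
  simp only [Pi.mul_apply, e]
  rw [kPlus, if_pos hr, expSeries_logCoeff (by simp [h0]), coeff_C_mul,
    mul_inv_cancel_left₀ h0]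

theorem rhoFree_Kminus (i : ZMod n) (r : ℤ) :
    D.rhoFree (Free.Kminus D.q i r) = diag fun lam => D.kMinus i lam r := by
  have hqq := neg_ne_zero.2 D.q_sub_inv_ne
  rw [Free.Kminus]
  split_ifs with hr
  swap
  · rw [map_zero, ← map_zero diag]
    congr 1
    ext lam
    rw [kMinus, if_neg hr]; rfl
  rw [map_mul, rhoFree_Kinv, map_coeff_expSeries_mk (A := Free n) (B := Module.End ℂ RowSpace) D.rhoFree]
  simp only [map_smul, rhoFree_H]
  rw [coeff_expSeries_diag, ← map_mul]
  congr 1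
  ext lam
  have h0 := (D.constantCoeff_ser_ne i lam).2
  have e : ∀ m : ℕ, (-(D.q - D.q⁻¹)) * D.eigenH i (-(m : ℤ)) lam =
      logCoeff (C (constantCoeff (D.ser X 1 i lam))⁻¹ * D.ser X 1 i lam) m := by
    intro m
    rcases m with _ | m
    · rw [Nat.cast_zero, neg_zero, eigenH_zero, logCoeff_zero]; simp
    · rw [eigenH, if_neg (by push_cast; omega), neg_neg, Int.toNat_natCast,
        mul_inv_cancel_left₀ hqq]
  simp only [Pi.mul_apply, e]
  rw [kMinus, if_pos hr, expSeries_logCoeff (by simp [h0]), coeff_C_mul,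
    mul_inv_cancel_left₀ h0]

theorem kPlus_inc (i : ZMod n) (lam : RowSeq) (a : ℕ) (r : ℤ) :
    D.q ^ cartan i (D.col a (lam a)) * D.pos a (lam a) * D.kPlus i (lam.inc a) r -
      D.d ^ mMatrix i (D.col a (lam a)) * D.kPlus i (lam.inc a) (r + 1) =
    D.pos a (lam a) * D.kPlus i lam r -
      D.d ^ mMatrix i (D.col a (lam a)) * D.q ^ cartan i (D.col a (lam a)) *
        D.kPlus i lam (r + 1) := by
  have h := D.ser_inc isFrame_infty i lam a
  have key : ∀ (x y : ℂ) (nu : RowSeq), x * D.kPlus i nu r - y * D.kPlus i nu (r + 1) =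
      if 0 ≤ r + 1 then coeff (r + 1).toNat ((C x * X - C y * 1) * D.ser 1 X i nu) else 0 := by
    intro x y nu
    rw [kPlus, kPlus]
    rcases lt_trichotomy (r + 1) 0 with hr | hr | hr
    · rw [if_neg (by omega), if_neg (by omega), if_neg (by omega)]; ring
    · rw [if_neg (by omega), if_pos hr.ge, if_pos hr.ge, hr]
      simp
    · obtain ⟨t, rfl⟩ : ∃ t : ℕ, r = t := ⟨r.toNat, by omega⟩
      have : ((t : ℤ) + 1).toNat = t + 1 := by omega
      rw [if_pos (by omega), if_pos (by omega), if_pos (by omega), this, Int.toNat_natCast, mul_one,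
        sub_mul, mul_assoc, map_sub, coeff_C_mul, coeff_C_mul, coeff_succ_X_mul]
  rw [key, key, h]

theorem kMinus_inc (i : ZMod n) (lam : RowSeq) (a : ℕ) (r : ℤ) :
    D.q ^ cartan i (D.col a (lam a)) * D.pos a (lam a) * D.kMinus i (lam.inc a) r -
      D.d ^ mMatrix i (D.col a (lam a)) * D.kMinus i (lam.inc a) (r + 1) =
    D.pos a (lam a) * D.kMinus i lam r -
      D.d ^ mMatrix i (D.col a (lam a)) * D.q ^ cartan i (D.col a (lam a)) *
        D.kMinus i lam (r + 1) := by
  have h := D.ser_inc isFrame_zero i lam a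
  have key : ∀ (x y : ℂ) (nu : RowSeq), x * D.kMinus i nu r - y * D.kMinus i nu (r + 1) =
      if r ≤ 0 then coeff (-r).toNat ((C x * 1 - C y * X) * D.ser X 1 i nu) else 0 := by
    intro x y nu
    rw [kMinus, kMinus]
    rcases lt_trichotomy r 0 with hr | hr | hr
    · obtain ⟨t, rfl⟩ : ∃ t : ℕ, r = -((t : ℤ) + 1) := ⟨(-r - 1).toNat, by omega⟩
      have e1 : (-(-((t : ℤ) + 1))).toNat = t + 1 := by omega
      have e2 : (-(-((t : ℤ) + 1) + 1)).toNat = t := by omega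
      rw [if_pos (by omega), if_pos (by omega), if_pos (by omega), e1, e2, mul_one,
        sub_mul, mul_assoc, map_sub, coeff_C_mul, coeff_C_mul, coeff_succ_X_mul]
    · subst hr
      simp
    · rw [if_neg (by omega), if_neg (by omega), if_neg (by omega)]; ring
  rw [key, key, h]

/-- The relations between a Cartan current and an operator adding boxes. -/
theorem diag_opE (i j : ZMod n) (s : ℤ) {f : RowSeq → ℤ → ℂ} {r : ℤ}
    (hf : ∀ lam a, D.q ^ cartan i (D.col a (lam a)) * D.pos a (lam a) * f (lam.inc a) r -
      D.d ^ mMatrix i (D.col a (lam a)) * f (lam.inc a) (r + 1) =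
      D.pos a (lam a) * f lam r - D.d ^ mMatrix i (D.col a (lam a)) *
        D.q ^ cartan i (D.col a (lam a)) * f lam (r + 1)) :
    D.q ^ cartan i j • (diag (fun lam => f lam r) * D.opE j (s + 1)) -
      D.d ^ mMatrix i j • (diag (fun lam => f lam (r + 1)) * D.opE j s) =
    D.opE j (s + 1) * diag (fun lam => f lam r) -
      (D.d ^ mMatrix i j * D.q ^ cartan i j) • (D.opE j s * diag (fun lam => f lam (r + 1))) := by
  refine hom_ext fun lam => ?_
  obtain ⟨N, hN⟩ := lam.exists_bdd
  simp only [LinearMap.sub_apply, LinearMap.smul_apply, Module.End.mul_apply, diag_vec, map_smul]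
  rw [opE, opE, op_vec (D.isLocal_termE _ _) hN (Nat.lt_succ_self N),
    op_vec (D.isLocal_termE _ _) hN (Nat.lt_succ_self N)]
  simp only [map_sum, map_smul, diag_vec, Finset.smul_sum, smul_smul, ← Finset.sum_sub_distrib,
    ← sub_smul]
  refine Finset.sum_congr rfl fun a _ => ?_
  congr 1
  by_cases hj : D.col a (lam a) = j
  · have h := hf lam a
    rw [hj] at h
    simp only [Dressing.term]
    rw [zpow_add_one₀ (D.pos_ne_zero _ _)]
    linear_combination D.dressE.coef j lam a * D.pos a (lam a) ^ s * h
  · rw [D.dressE.term_zero hj, D.dressE.term_zero hj]; ring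

/-- The relations between a Cartan current and an operator removing boxes. -/
theorem diag_opF (i j : ZMod n) (s : ℤ) {f : RowSeq → ℤ → ℂ} {r : ℤ}
    (hf : ∀ lam a, D.q ^ cartan i (D.col a (lam a)) * D.pos a (lam a) * f (lam.inc a) r -
      D.d ^ mMatrix i (D.col a (lam a)) * f (lam.inc a) (r + 1) =
      D.pos a (lam a) * f lam r - D.d ^ mMatrix i (D.col a (lam a)) *
        D.q ^ cartan i (D.col a (lam a)) * f lam (r + 1)) :
    diag (fun lam => f lam r) * D.opF j (s + 1) -
      (D.d ^ mMatrix i j * D.q ^ cartan i j) • (diag (fun lam => f lam (r + 1)) * D.opF j s) =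
    D.q ^ cartan i j • (D.opF j (s + 1) * diag (fun lam => f lam r)) -
      D.d ^ mMatrix i j • (D.opF j s * diag (fun lam => f lam (r + 1))) := by
  refine hom_ext fun lam => ?_
  obtain ⟨N, hN⟩ := lam.exists_bdd
  simp only [LinearMap.sub_apply, LinearMap.smul_apply, Module.End.mul_apply, diag_vec, map_smul]
  rw [opF, opF, op_vec (D.isLocal_termF _ _) hN (Nat.lt_succ_self N),
    op_vec (D.isLocal_termF _ _) hN (Nat.lt_succ_self N)]
  simp only [map_sum, map_smul, diag_vec, Finset.smul_sum, smul_smul, ← Finset.sum_sub_distrib,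
    ← sub_smul]
  refine Finset.sum_congr rfl fun a _ => ?_
  congr 1
  simp only [termF]
  by_cases hj : D.col a (lam.dec a a) = j
  · have h := hf (lam.dec a) a
    rw [hj, RowSeq.dec_inc] at h
    simp only [Dressing.term]
    rw [zpow_add_one₀ (D.pos_ne_zero _ _)]
    linear_combination -D.dressF.coef j (lam.dec a) a * D.pos a (lam.dec a a) ^ s * h
  · rw [D.dressF.term_zero hj, D.dressF.term_zero hj]; ring

theorem rhoFree_rel {x y : Free n} (h : Rel n D.q D.d x y) : D.rhoFree x = D.rhoFree y := by
  have hone : ∀ f : RowSeq → ℂ, (∀ lam, f lam = 1) → diag f = 1 := fun f hf => by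
    rw [← map_one diag]; congr 1; ext lam; exact hf lam
  have hcomm : ∀ f g : RowSeq → ℂ, diag f * diag g = diag g * diag f := fun f g => by
    rw [← map_mul, ← map_mul, mul_comm]
  cases h with
  | K_Kinv i =>
    rw [map_mul, rhoFree_K, rhoFree_Kinv, map_one, ← map_mul]
    exact hone _ fun lam => D.constantCoeff_ser i lam
  | Kinv_K i =>
    rw [map_mul, rhoFree_K, rhoFree_Kinv, map_one, hcomm, ← map_mul]
    exact hone _ fun lam => D.constantCoeff_ser i lam
  | Kplus_Kplus i j r s =>
    simp only [map_mul, rhoFree_Kplus]; exact hcomm _ _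
  | Kminus_Kminus i j r s =>
    simp only [map_mul, rhoFree_Kminus]; exact hcomm _ _
  | Kminus_Kplus i j r s =>
    simp only [map_mul, rhoFree_Kplus, rhoFree_Kminus]; exact hcomm _ _
  | Kplus_E i j r s =>
    simp only [map_sub, map_mul, map_smul, rhoFree_Kplus, rhoFree_E]
    exact D.diag_opE i j s fun lam a => D.kPlus_inc i lam a r
  | Kminus_E i j r s =>
    simp only [map_sub, map_mul, map_smul, rhoFree_Kminus, rhoFree_E]
    exact D.diag_opE i j s fun lam a => D.kMinus_inc i lam a r
  | Kplus_F i j r s =>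
    simp only [map_sub, map_mul, map_smul, rhoFree_Kplus, rhoFree_F]
    exact D.diag_opF i j s fun lam a => D.kPlus_inc i lam a r
  | Kminus_F i j r s =>
    simp only [map_sub, map_mul, map_smul, rhoFree_Kminus, rhoFree_F]
    exact D.diag_opF i j s fun lam a => D.kMinus_inc i lam a r
  | E_F i j r s =>
    refine hom_ext fun lam => ?_
    simp only [map_sub, map_mul, rhoFree_E, rhoFree_F]
    rw [D.opE_opF]
    split_ifs with hij
    · simp only [map_sub, map_smul, rhoFree_Kplus, rhoFree_Kminus, LinearMap.smul_apply,
        LinearMap.sub_apply, diag_vec, ← sub_smul, smul_smul]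
    · simp
  | E_E i j r s =>
    simp only [map_sub, map_mul, map_smul, rhoFree_E]
    exact D.opE_exchange i j r s
  | F_F i j r s =>
    simp only [map_sub, map_mul, map_smul, rhoFree_F]
    exact D.opF_exchange i j r s
  | E_E_far i j h0 h1 h2 r s =>
    simp only [map_mul, rhoFree_E]
    exact D.opE_commute h0 h1 h2 r s
  | F_F_far i j h0 h1 h2 r s =>
    simp only [map_mul, rhoFree_F]
    exact D.opF_commute h0 h1 h2 r s
  | serre_E i j hj r s t =>
    simp only [serreTerm, map_add, map_sub, map_mul, map_smul, rhoFree_E, map_zero]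
    exact D.opE_serre hj r s t
  | serre_F i j hj r s t =>
    simp only [serreTerm, map_add, map_sub, map_mul, map_smul, rhoFree_F, map_zero]
    exact D.opF_serre hj r s t

end FockDatum

namespace Fock

/-- A partition as a row sequence. -/
def Partition.toSeq (lam : Partition) : RowSeq := lam.1.mapRange (fun m : ℕ => (m : ℤ)) rfl

theorem Partition.toSeq_apply (lam : Partition) (s : ℕ) : lam.toSeq s = (lam.1 s : ℤ) := rfl

theorem Partition.toSeq_injective : Function.Injective Partition.toSeq := by
  intro lam mu h
  apply Subtype.ext
  ext s
  have := DFunLike.congr_fun h s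
  rw [toSeq_apply, toSeq_apply] at this
  exact_mod_cast this

/-- Add a box to a row of a partition. -/
def Partition.add (lam : Partition) (a : ℕ) (h : ∀ s, s + 1 = a → lam.1 s ≠ lam.1 a) :
    Partition := ⟨lam.1 + Finsupp.single a 1, by
  refine antitone_nat_of_succ_le fun s => ?_
  have h1 : lam.1 (s + 1) ≤ lam.1 s := lam.2 (Nat.le_succ s)
  simp only [Finsupp.add_apply, Finsupp.single_apply]
  by_cases ha : a = s + 1
  · have := h s ha.symm
    rw [ha] at this
    rw [if_pos ha, if_neg (by omega)]
    omega
  · rw [if_neg ha]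
    omega⟩

/-- Remove a box from a row of a partition. -/
def Partition.remove (lam : Partition) (a : ℕ) (h : lam.1 (a + 1) ≠ lam.1 a) :
    Partition := ⟨lam.1 - Finsupp.single a 1, by
  refine antitone_nat_of_succ_le fun s => ?_
  have h1 : lam.1 (s + 1) ≤ lam.1 s := lam.2 (Nat.le_succ s)
  simp only [Finsupp.tsub_apply, Finsupp.single_apply]
  by_cases ha : a = s
  · subst ha
    rw [if_pos rfl, if_neg (by omega)]
    omega
  · rw [if_neg ha]
    omega⟩

theorem Partition.toSeq_add (lam : Partition) (a : ℕ) (h : ∀ s, s + 1 = a → lam.1 s ≠ lam.1 a) :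
    (lam.add a h).toSeq = lam.toSeq.inc a := by
  ext s
  simp only [toSeq_apply, add, RowSeq.inc, Finsupp.add_apply, Finsupp.single_apply]
  split_ifs <;> simp

theorem Partition.toSeq_remove (lam : Partition) (a : ℕ) (h : lam.1 (a + 1) ≠ lam.1 a) :
    (lam.remove a h).toSeq = lam.toSeq.dec a := by
  have h1 : lam.1 (a + 1) ≤ lam.1 a := lam.2 (Nat.le_succ a)
  ext s
  simp only [toSeq_apply, remove, RowSeq.dec, Finsupp.sub_apply, Finsupp.single_apply,
    Finsupp.tsub_apply]
  split_ifs with hs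
  · subst hs; omega
  · simp

open RowSpace

/-- The embedding of the space with basis the partitions. -/
def iota : Space →ₗ[ℂ] RowSpace := Finsupp.lmapDomain ℂ ℂ Partition.toSeq

theorem iota_ket (lam : Partition) : iota (ket lam) = vec lam.toSeq := by
  simp [iota, ket, vec, Finsupp.mapDomain_single]

theorem iota_apply (v : Space) (mu : Partition) : iota v mu.toSeq = v mu :=
  Finsupp.mapDomain_apply Partition.toSeq_injective v mu

theorem iota_injective : Function.Injective iota :=
  Finsupp.mapDomain_injective Partition.toSeq_injective

/-- A left inverse of the embedding. -/
def retract : RowSpace →ₗ[ℂ] Space := Finsupp.lcomapDomain Partition.toSeq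
  Partition.toSeq_injective

theorem retract_iota (v : Space) : retract (iota v) = v := by
  ext mu
  exact iota_apply v mu

theorem space_induction {p : Submodule ℂ RowSpace} {T : Module.End ℂ RowSpace}
    (h : ∀ lam : Partition, T (vec lam.toSeq) ∈ p) (v : Space) : T (iota v) ∈ p := by
  induction v using Finsupp.induction_linear with
  | zero => simp
  | add v w hv hw => rw [map_add, map_add]; exact p.add_mem hv hw
  | single lam c =>
    have : (Finsupp.single lam c : Space) = c • ket lam := by simp [ket]
    rw [this, map_smul, map_smul, iota_ket]
    exact p.smul_mem _ (h lam)

end Fock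

namespace FockDatum

open RowSpace Fock

variable {n : ℕ} (D : FockDatum n)

theorem vec_mem_range (lam : Partition) : vec lam.toSeq ∈ LinearMap.range iota :=
  ⟨ket lam, iota_ket lam⟩

theorem genOp_mem_range (g : Gen n) (v : Space) : D.genOp g (iota v) ∈ LinearMap.range iota := by
  refine space_induction (fun lam => ?_) v
  obtain ⟨N, hN⟩ := lam.toSeq.exists_bdd
  have hdiag : ∀ f, diag f (vec lam.toSeq) ∈ LinearMap.range iota := fun f => by
    rw [diag_vec]; exact Submodule.smul_mem _ _ (vec_mem_range lam)
  cases g with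
  | E i m =>
    change D.opE i m _ ∈ _
    rw [opE, op_vec (D.isLocal_termE i m) hN (Nat.lt_succ_self N)]
    refine Submodule.sum_mem _ fun a _ => ?_
    by_cases h : ∀ s, s + 1 = a → lam.1 s ≠ lam.1 a
    · rw [← lam.toSeq_add a h]
      exact Submodule.smul_mem _ _ (vec_mem_range _)
    · push Not at h
      obtain ⟨s, rfl, h⟩ := h
      rw [Dressing.term, D.dressE_coef_eq_zero i (by rw [lam.toSeq_apply, lam.toSeq_apply, h]),
        zero_mul, zero_smul]
      exact Submodule.zero_mem _
  | F i m =>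
    change D.opF i m _ ∈ _
    rw [opF, op_vec (D.isLocal_termF i m) hN (Nat.lt_succ_self N)]
    refine Submodule.sum_mem _ fun a _ => ?_
    by_cases h : lam.1 (a + 1) = lam.1 a
    · rw [D.termF_eq_zero i m (by rw [lam.toSeq_apply, lam.toSeq_apply, h]), zero_smul]
      exact Submodule.zero_mem _
    · rw [← lam.toSeq_remove a h]
      exact Submodule.smul_mem _ _ (vec_mem_range _)
  | H i l => exact hdiag _
  | K i => exact hdiag _
  | Kinv i => exact hdiag _

/-- The action of the free algebra on the Fock space. -/
def fockFree : Free n →ₐ[ℂ] Module.End ℂ Space :=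
  FreeAlgebra.lift ℂ fun g => retract ∘ₗ D.genOp g ∘ₗ iota

theorem iota_fockFree (x : Free n) : ∀ v : Space, iota (D.fockFree x v) = D.rhoFree x (iota v) := by
  induction x using FreeAlgebra.induction with
  | grade0 c =>
    intro v
    rw [AlgHom.commutes, AlgHom.commutes, Module.algebraMap_end_apply, Module.algebraMap_end_apply,
      map_smul]
  | grade1 g =>
    intro v
    rw [fockFree, rhoFree, FreeAlgebra.lift_ι_apply, FreeAlgebra.lift_ι_apply]
    obtain ⟨w, hw⟩ := D.genOp_mem_range g v
    change iota (retract (D.genOp g (iota v))) = _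
    rw [← hw, retract_iota]
  | mul x y hx hy =>
    intro v
    rw [map_mul, map_mul, Module.End.mul_apply, Module.End.mul_apply, hx, hy]
  | add x y hx hy =>
    intro v
    rw [map_add, map_add, LinearMap.add_apply, LinearMap.add_apply, map_add, hx, hy]

/-- The action of the quantum toroidal algebra on the Fock space. -/
def fockRep : QToroidal n D.q D.d →ₐ[ℂ] Module.End ℂ Space :=
  RingQuot.liftAlgHom ℂ ⟨D.fockFree, fun x y h => by
    refine LinearMap.ext fun v => iota_injective ?_
    rw [iota_fockFree, iota_fockFree, D.rhoFree_rel h]⟩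

theorem iota_fockRep (x : Free n) (v : Space) :
    iota (D.fockRep (QToroidal.proj n D.q D.d x) v) = D.rhoFree x (iota v) := by
  rw [← iota_fockFree, fockRep, QToroidal.proj, RingQuot.liftAlgHom_mkAlgHom_apply]

/-- The Fock module. -/
abbrev fockModule : Module (QToroidal n D.q D.d) Space :=
  Module.compHom Space D.fockRep.toRingHom

theorem fockModule_isScalarTower :
    letI := D.fockModule
    IsScalarTower ℂ (QToroidal n D.q D.d) Space :=
  letI := D.fockModule
  ⟨fun c x v => by
    change D.fockRep (c • x) v = c • D.fockRep x v
    rw [map_smul, LinearMap.smul_apply]⟩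

theorem fockRep_E_apply (i : ZMod n) (m : ℤ) (lam mu : Partition) :
    D.fockRep (QToroidal.E n D.q D.d i m) (ket lam) mu = D.opE i m (vec lam.toSeq) mu.toSeq := by
  rw [← iota_apply, QToroidal.E, iota_fockRep, rhoFree_E, iota_ket]

theorem fockRep_F_apply (i : ZMod n) (m : ℤ) (lam mu : Partition) :
    D.fockRep (QToroidal.F n D.q D.d i m) (ket lam) mu = D.opF i m (vec lam.toSeq) mu.toSeq := by
  rw [← iota_apply, QToroidal.F, iota_fockRep, rhoFree_F, iota_ket]

theorem fockRep_Kplus_ket (i : ZMod n) (r : ℕ) (lam : Partition) :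
    D.fockRep (QToroidal.Kplus n D.q D.d i r) (ket lam) =
      PowerSeries.coeff r (D.ser 1 PowerSeries.X i lam.toSeq) • ket lam := by
  apply iota_injective
  rw [QToroidal.Kplus, iota_fockRep, rhoFree_Kplus, iota_ket, diag_vec, kPlus,
    if_pos (by omega), Int.toNat_natCast, map_smul, iota_ket]

theorem fockRep_Kminus_ket (i : ZMod n) (r : ℕ) (lam : Partition) :
    D.fockRep (QToroidal.Kminus n D.q D.d i r) (ket lam) =
      PowerSeries.coeff r (D.ser PowerSeries.X 1 i lam.toSeq) • ket lam := by
  apply iota_injective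
  rw [QToroidal.Kminus, iota_fockRep, rhoFree_Kminus, iota_ket, diag_vec, kMinus,
    if_pos (by omega), neg_neg, Int.toNat_natCast, map_smul, iota_ket]

theorem opE_vec_inc (i : ZMod n) (m : ℤ) (lam : RowSeq) (a : ℕ) :
    D.opE i m (vec lam) (lam.inc a) = D.dressE.term i m lam a := by
  obtain ⟨N, hN⟩ := lam.exists_bdd
  rw [opE, op_vec (D.isLocal_termE i m) hN (show N < N + a + 1 by omega), Finsupp.finsetSum_apply,
    Finset.sum_eq_single_of_mem a (Finset.mem_range.2 (by omega))]
  · simp [vec]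
  · intro b _ hb
    have : lam.inc b ≠ lam.inc a := fun h => by
      have h1 := DFunLike.congr_fun h a
      rw [lam.inc_self, lam.inc_of_ne hb] at h1
      omega
    simp [vec, this]

theorem opF_vec_dec (i : ZMod n) (m : ℤ) (lam : RowSeq) (a : ℕ) :
    D.opF i m (vec (lam.inc a)) lam = D.dressF.term i m lam a := by
  obtain ⟨N, hN⟩ := (lam.inc a).exists_bdd
  rw [opF, op_vec (D.isLocal_termF i m) hN (show N < N + a + 1 by omega), Finsupp.finsetSum_apply,
    Finset.sum_eq_single_of_mem a (Finset.mem_range.2 (by omega))]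
  · simp [vec, termF, RowSeq.inc_dec]
  · intro b _ hb
    have : (lam.inc a).dec b ≠ lam := fun h => by
      have h1 := DFunLike.congr_fun h a
      rw [RowSeq.dec_of_ne _ hb, lam.inc_self] at h1
      omega
    simp [vec, this]

theorem opE_vec_apply_eq_zero (i : ZMod n) (m : ℤ) {lam mu : RowSeq}
    (h : ∀ a, mu = lam.inc a → D.col a (lam a) ≠ i) : D.opE i m (vec lam) mu = 0 := by
  obtain ⟨N, hN⟩ := lam.exists_bdd
  rw [opE, op_vec (D.isLocal_termE i m) hN (Nat.lt_succ_self N), Finsupp.finsetSum_apply]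
  refine Finset.sum_eq_zero fun a _ => ?_
  by_cases h1 : mu = lam.inc a
  · rw [D.dressE.term_zero (h a h1)]; simp
  · simp [vec, Ne.symm h1]

theorem opF_vec_apply_eq_zero (i : ZMod n) (m : ℤ) {lam mu : RowSeq}
    (h : ∀ a, mu = lam.inc a → D.col a (lam a) ≠ i) : D.opF i m (vec mu) lam = 0 := by
  obtain ⟨N, hN⟩ := mu.exists_bdd
  rw [opF, op_vec (D.isLocal_termF i m) hN (Nat.lt_succ_self N), Finsupp.finsetSum_apply]
  refine Finset.sum_eq_zero fun a _ => ?_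
  by_cases h1 : mu.dec a = lam
  · have h2 := h a (by rw [← h1, RowSeq.dec_inc])
    rw [termF, h1, D.dressF.term_zero h2]; simp
  · simp [vec, h1]

/-! ### Matrix coefficients -/

theorem addsBox_iff (i : ZMod n) (lam mu : Partition) (j : ℕ) : AddsBox n D.k i lam mu j ↔
    mu.toSeq = lam.toSeq.inc j ∧ D.col j (lam.toSeq j) = i := by
  rw [AddsBox]
  apply and_congr
  · constructor
    · intro h
      ext s
      rw [mu.toSeq_apply, h, RowSeq.inc, Finsupp.add_apply, Finsupp.add_apply, lam.toSeq_apply,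
        Finsupp.single_apply, Finsupp.single_apply]
      split_ifs <;> simp
    · intro h
      ext s
      have h1 := DFunLike.congr_fun h s
      rw [mu.toSeq_apply, RowSeq.inc, Finsupp.add_apply, lam.toSeq_apply, Finsupp.single_apply] at h1
      rw [Finsupp.add_apply, Finsupp.single_apply]
      split_ifs at h1 ⊢ <;> omega
  · rw [col, lam.toSeq_apply]
    push_cast
    constructor
    · intro h; linear_combination h.symm
    · intro h; linear_combination h.symm

theorem condA_iff (lam : Partition) (i : ZMod n) (s : ℕ) :
    CondA n D.k lam i s ↔ i = D.col s (lam.toSeq s) + 1 := by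
  rw [CondA, col, lam.toSeq_apply]
  push_cast
  constructor
  · intro h; linear_combination h
  · intro h; linear_combination h

theorem condB_iff (lam : Partition) (i : ZMod n) (s : ℕ) :
    CondB n D.k lam i s ↔ i = D.col s (lam.toSeq s) := by
  rw [CondB, col, lam.toSeq_apply]
  push_cast
  constructor
  · intro h; linear_combination h
  · intro h; linear_combination h

theorem boxPos_eq (lam : Partition) (j : ℕ) :
    boxPos D.q D.d D.u lam j = D.pos j (lam.toSeq j) := by
  rw [boxPos, pos, lam.toSeq_apply, zpow_natCast]; rfl

theorem boxFactor_eq (lam : Partition) (i : ZMod n) (j : ℕ) (S : Finset ℕ) :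
    boxFactor n D.q D.d D.k lam i j S =
      ∏ s ∈ S, D.rowG i s (lam.toSeq s) (D.pos j (lam.toSeq j)) := by
  classical
  rw [boxFactor, Finset.prod_filter, Finset.prod_filter, ← Finset.prod_mul_distrib]
  refine Finset.prod_congr rfl fun s _ => ?_
  simp only [condA_iff, condB_iff]
  rw [rowG, rowA, rowB, D.pos_div_pos, D.pos_div_pos, sub_right_comm]
  rfl

theorem rowB_of_isCutoff {lam : Partition} {i : ZMod n} {r : ℕ} (h : IsCutoff n D.k lam i r) :
    i ≠ D.col r 0 := by
  rw [h.2, col]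
  push_cast
  intro h1
  exact D.one_ne_zero' (by linear_combination h1)

theorem bdd_of_isCutoff {lam : Partition} {i : ZMod n} {r : ℕ} (h : IsCutoff n D.k lam i r) :
    lam.toSeq.Bdd r := by
  intro s hs
  have h1 := lam.2 hs
  have h2 := h.1
  rw [lam.toSeq_apply]
  have : lam.1 s = 0 := by omega
  rw [this, Nat.cast_zero]

theorem cartanFactor_eq {Z Y : PowerSeries ℂ} (hZ : IsFrame Z Y) {lam : Partition} {i : ZMod n}
    {r : ℕ} (h : IsCutoff n D.k lam i r) :
    cartanFactor n D.q D.d D.u D.k (D.serPsi Z Y) lam i (Finset.range r) =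
      D.ser Z Y i lam.toSeq := by
  classical
  rw [D.ser_eq hZ i (D.bdd_of_isCutoff h), serB, if_neg (D.rowB_of_isCutoff h), mul_one,
    cartanFactor, Finset.prod_filter, Finset.prod_filter, ← Finset.prod_mul_distrib]
  refine Finset.prod_congr rfl fun s _ => ?_
  simp only [condA_iff, condB_iff]
  rw [serG, serA, serB]
  have e1 : q₁ D.q D.d ^ ((lam.1 s : ℤ) - 1) * q₃ D.q D.d ^ (s : ℤ) * D.u =
      D.pos s (lam.toSeq s - 1) := by
    rw [pos, lam.toSeq_apply, zpow_natCast]; rfl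
  have e2 : q₁ D.q D.d ^ ((lam.1 s : ℤ) - 1) * q₃ D.q D.d ^ ((s : ℤ) - 1) * D.u =
      D.q ^ 2 * D.pos s (lam.toSeq s) := by
    have h1 := D.p₁_mul_p₃
    have hp1 := D.p₁_ne
    have hp3 := D.p₃_ne
    have hq := D.q_ne
    change D.p₁ ^ ((lam.1 s : ℤ) - 1) * D.p₃ ^ ((s : ℤ) - 1) * D.u = _
    rw [pos, lam.toSeq_apply, zpow_sub_one₀ hp1, zpow_sub_one₀ hp3, zpow_natCast]
    have h2 : D.p₁⁻¹ * D.p₃⁻¹ = D.q ^ 2 := by rw [← mul_inv, h1, inv_inv]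
    rw [← h2, zpow_natCast]
    ring
  rw [e1, e2]

theorem psiAtInfty_eq : psiAtInfty D.q = D.serPsi 1 PowerSeries.X := by
  funext a
  simp [psiAtInfty, serPsi]

theorem psiAtZero_eq : psiAtZero D.q = D.serPsi PowerSeries.X 1 := by
  funext a
  simp [psiAtZero, serPsi]

theorem fockModule_isFockAction :
    letI := D.fockModule
    IsFockAction n D.q D.d D.u D.k := by
  let _ := D.fockModule
  refine ⟨?_, ?_, ?_, ?_, ?_, ?_, ?_, ?_⟩
  · intro i m lam mu j h
    rw [addsBox_iff] at h
    refine (D.fockRep_E_apply i m lam mu).trans ?_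
    rw [h.1, opE_vec_inc, Dressing.term, D.dressE_coef h.2, boxFactor_eq, boxPos_eq]
  · intro i m lam mu h
    refine (D.fockRep_E_apply i m lam mu).trans ?_
    exact D.opE_vec_apply_eq_zero i m fun a ha hc => h a ((D.addsBox_iff i lam mu a).2 ⟨ha, hc⟩)
  · intro i m lam mu j h r hr hcut
    rw [addsBox_iff] at h
    refine (D.fockRep_F_apply i m mu lam).trans ?_
    rw [h.1, opF_vec_dec, Dressing.term, D.dressF_coef h.2 (D.bdd_of_isCutoff hcut) hr,
      boxFactor_eq, boxPos_eq, tail, rowB, if_neg (D.rowB_of_isCutoff hcut), mul_one]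
  · intro i m lam mu h
    refine (D.fockRep_F_apply i m mu lam).trans ?_
    exact D.opF_vec_apply_eq_zero i m fun a ha hc => h a ((D.addsBox_iff i lam mu a).2 ⟨ha, hc⟩)
  · intro i m lam r hcut
    rw [psiAtInfty_eq, D.cartanFactor_eq isFrame_infty hcut]
    change D.fockRep (QToroidal.Kplus n D.q D.d i m) (ket lam) lam = _
    rw [fockRep_Kplus_ket]
    simp [ket]
  · intro i m lam mu hne
    change D.fockRep (QToroidal.Kplus n D.q D.d i m) (ket lam) mu = _
    rw [fockRep_Kplus_ket]
    simp [ket, Ne.symm hne]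
  · intro i m lam r hcut
    rw [psiAtZero_eq, D.cartanFactor_eq isFrame_zero hcut]
    change D.fockRep (QToroidal.Kminus n D.q D.d i m) (ket lam) lam = _
    rw [fockRep_Kminus_ket]
    simp [ket]
  · intro i m lam mu hne
    change D.fockRep (QToroidal.Kminus n D.q D.d i m) (ket lam) mu = _
    rw [fockRep_Kminus_ket]
    simp [ket, Ne.symm hne]

end FockDatum

namespace Fock

/-- The empty partition. -/
def Partition.empty : Partition := ⟨0, fun _ _ _ => le_rfl⟩

theorem Partition.toSeq_empty : Partition.empty.toSeq = 0 := by
  ext s; simp [Partition.toSeq_apply, Partition.empty]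

theorem Partition.induction {P : Partition → Prop} (h0 : P Partition.empty)
    (hadd : ∀ (lam mu : Partition) (a : ℕ), mu.toSeq = lam.toSeq.inc a → P lam → P mu)
    (lam : Partition) : P lam := by
  induction hm : lam.1.degree using Nat.strong_induction_on generalizing lam with
  | _ m ih =>
    by_cases h : lam.1 = 0
    · have : lam = Partition.empty := Subtype.ext h
      rwa [this]
    · have hne : lam.1.support.Nonempty := Finsupp.support_nonempty_iff.2 h
      set a := lam.1.support.max' hne with ha
      have h1 : lam.1 a ≠ 0 := Finsupp.mem_support_iff.1 (Finset.max'_mem _ hne)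
      have h2 : lam.1 (a + 1) = 0 := by
        by_contra h3
        have := Finset.le_max' _ _ (Finsupp.mem_support_iff.2 h3)
        omega
      have h3 : lam.1 (a + 1) ≠ lam.1 a := by omega
      have h4 : (lam.remove a h3).1 + Finsupp.single a 1 = lam.1 :=
        tsub_add_cancel_of_le (Finsupp.single_le_iff.2 (by omega))
      refine hadd (lam.remove a h3) lam a ?_ (ih _ ?_ _ rfl)
      · rw [lam.toSeq_remove, RowSeq.dec_inc]
      · rw [← hm, ← h4, map_add, Finsupp.degree_single]
        omega

theorem Partition.le_of_le (lam : Partition) {s t : ℕ} (h : s ≤ t) : lam.toSeq t ≤ lam.toSeq s := by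
  rw [toSeq_apply, toSeq_apply]
  exact_mod_cast lam.2 h

theorem span_ket : Submodule.span ℂ (Set.range ket) = ⊤ := by
  rw [eq_top_iff]
  intro v _
  induction v using Finsupp.induction_linear with
  | zero => exact Submodule.zero_mem _
  | add v w hv hw => exact Submodule.add_mem _ (hv trivial) (hw trivial)
  | single lam c =>
    have : (Finsupp.single lam c : Space) = c • ket lam := by simp [ket]
    rw [this]
    exact Submodule.smul_mem _ _ (Submodule.subset_span ⟨lam, rfl⟩)

end Fock

namespace FockDatum

open RowSpace Fock PowerSeries

variable {n : ℕ} (D : FockDatum n)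

/-! ### The spectrum of the Cartan currents -/

theorem res_eq_of_ser_eq (i : ZMod n) {lam mu : RowSeq} (h1 : D.ser 1 X i lam = D.ser 1 X i mu)
    (h2 : D.ser X 1 i lam = D.ser X 1 i mu) {N : ℕ} (hlam : lam.Bdd N) (hmu : mu.Bdd N)
    (hi : D.col N 0 ≠ i) {s : ℕ} (hs : s < N) (hres : D.res i lam N s ≠ 0) :
    D.pole i mu s = D.pole i lam s ∧ D.res i mu N s ≠ 0 := by
  have key : ∀ f : Polynomial ℂ, ∑ t ∈ Finset.range N, D.res i lam N t * f.eval (D.pole i lam t) =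
      ∑ t ∈ Finset.range N, D.res i mu N t * f.eval (D.pole i mu t) := by
    intro f
    induction f using Polynomial.induction_on' with
    | add f g hf hg => simp only [Polynomial.eval_add, mul_add, Finset.sum_add_distrib, hf, hg]
    | monomial m c =>
      have e1 := D.kPlus_sub_kMinus i hlam hi m
      have e2 := D.kPlus_sub_kMinus i hmu hi m
      rw [kPlus, kMinus, h1, h2, ← kPlus, ← kMinus, e2] at e1
      simp only [zpow_natCast] at e1
      simp only [Polynomial.eval_monomial, mul_left_comm _ c, ← Finset.mul_sum, e1]
  set f₀ : Polynomial ℂ := ∏ t ∈ (Finset.range N).erase s,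
    ((Polynomial.X - Polynomial.C (D.pole i lam t)) *
      (Polynomial.X - Polynomial.C (D.pole i mu t))) with hf₀
  have hroot : ∀ t, t ∈ Finset.range N → t ≠ s →
      f₀.eval (D.pole i lam t) = 0 ∧ f₀.eval (D.pole i mu t) = 0 := by
    intro t ht hts
    simp only [hf₀, Polynomial.eval_prod, Polynomial.eval_mul, Polynomial.eval_sub,
      Polynomial.eval_X, Polynomial.eval_C]
    constructor
    · exact Finset.prod_eq_zero (Finset.mem_erase.2 ⟨hts, ht⟩) (by rw [sub_self, zero_mul])
    · exact Finset.prod_eq_zero (Finset.mem_erase.2 ⟨hts, ht⟩) (by rw [sub_self, mul_zero])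
  have hval : f₀.eval (D.pole i lam s) ≠ 0 := by
    simp only [hf₀, Polynomial.eval_prod, Polynomial.eval_mul, Polynomial.eval_sub,
      Polynomial.eval_X, Polynomial.eval_C]
    refine Finset.prod_ne_zero_iff.2 fun t ht => ?_
    have hts := Ne.symm (Finset.ne_of_mem_erase ht)
    exact mul_ne_zero (sub_ne_zero.2 (D.pole_ne i lam lam hts))
      (sub_ne_zero.2 (D.pole_ne i lam mu hts))
  have main : ∀ g : Polynomial ℂ,
      D.res i lam N s * (f₀ * g).eval (D.pole i lam s) =
      D.res i mu N s * (f₀ * g).eval (D.pole i mu s) := by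
    intro g
    have h := key (f₀ * g)
    rwa [Finset.sum_eq_single_of_mem s (Finset.mem_range.2 hs),
      Finset.sum_eq_single_of_mem s (Finset.mem_range.2 hs)] at h
    · intro t ht hts
      rw [Polynomial.eval_mul, (hroot t ht hts).2]; ring
    · intro t ht hts
      rw [Polynomial.eval_mul, (hroot t ht hts).1]; ring
  have hpole : D.pole i mu s = D.pole i lam s := by
    by_contra hne
    have h := main (Polynomial.X - Polynomial.C (D.pole i mu s))
    simp only [Polynomial.eval_mul, Polynomial.eval_sub, Polynomial.eval_X, Polynomial.eval_C,
      sub_self, mul_zero] at h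
    exact mul_ne_zero hres (mul_ne_zero hval (sub_ne_zero.2 (Ne.symm hne))) h
  refine ⟨hpole, fun h0 => ?_⟩
  have h := main 1
  rw [h0, zero_mul, mul_one] at h
  exact mul_ne_zero hres hval h

theorem ser_separates_aux {lam mu : Partition} {s : ℕ} (hs : ∀ t, t < s → lam.1 t = mu.1 t)
    (hlt : mu.1 s < lam.1 s) (h1 : ∀ i, D.ser 1 X i lam.toSeq = D.ser 1 X i mu.toSeq)
    (h2 : ∀ i, D.ser X 1 i lam.toSeq = D.ser X 1 i mu.toSeq) : False := by
  obtain ⟨N₁, hN₁⟩ := lam.toSeq.exists_bdd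
  obtain ⟨N₂, hN₂⟩ := mu.toSeq.exists_bdd
  have hq := D.q_sub_inv_ne
  by_cases hc : ∃ t, t + 1 = s ∧ lam.1 t = lam.1 s
  · obtain ⟨t, rfl, ht⟩ := hc
    have hmt : mu.1 t = lam.1 t := (hs t (Nat.lt_succ_self t)).symm
    obtain ⟨v, hv⟩ : ∃ v : ℤ, v = lam.1 t := ⟨_, rfl⟩
    have e1 : lam.toSeq t = v := hv.symm
    have e2 : mu.toSeq t = v := by rw [mu.toSeq_apply, hmt, hv]
    have e3 : lam.toSeq (t + 1) = v := by rw [lam.toSeq_apply, ← ht, hv]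
    have e4 : mu.toSeq (t + 1) < v := by rw [mu.toSeq_apply]; omega
    set i := D.col t v + 1 with hi
    obtain ⟨N, hN, hNi⟩ := D.exists_rowB_eq_one i (N₁ + N₂ + t + 2) 0
    have hpole : D.pole i mu.toSeq t = D.pos t (v - 1) := by rw [pole, e2, if_pos hi]
    have hpole' : D.pole i lam.toSeq t = D.pos t (v - 1) := by rw [pole, e1, if_pos hi]
    have hres : D.res i mu.toSeq N t ≠ 0 := by
      rw [res, hpole, lead, e2, if_pos hi]
      refine mul_ne_zero hq (Finset.prod_ne_zero_iff.2 fun r hr => ?_)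
      refine D.rowG_ne_zero i (Finset.ne_of_mem_erase hr) ?_ ?_
      · rintro ⟨h, h'⟩
        have := mu.le_of_le (show r ≤ t by omega)
        omega
      · rintro ⟨rfl, h'⟩
        omega
    have h := (D.res_eq_of_ser_eq i (h1 i).symm (h2 i).symm (hN₂.mono (by omega))
      (hN₁.mono (by omega)) hNi (show t < N by omega) hres).2
    apply h
    rw [res, hpole', Finset.prod_eq_zero (i := t + 1), mul_zero]
    · rw [Finset.mem_erase, Finset.mem_range]; omega
    · have := D.rowG_succ_pos (i := i) (s := t) (v := v - 1) (by rw [col_sub_one])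
      rw [sub_add_cancel] at this
      rw [e3]
      exact this
  · push Not at hc
    set i := D.col s (lam.toSeq s) with hi
    have hi' : ¬ i = D.col s (lam.toSeq s) + 1 := Ne.symm (D.add_one_ne _)
    obtain ⟨N, hN, hNi⟩ := D.exists_rowB_eq_one i (N₁ + N₂ + s + 2) 0
    have hpole : D.pole i lam.toSeq s = D.pos s (lam.toSeq s) := by rw [pole, if_neg hi']
    have hres : D.res i lam.toSeq N s ≠ 0 := by
      rw [res, hpole, lead, if_neg hi', if_pos hi, inv_inv]
      refine mul_ne_zero (by rw [← neg_sub]; exact neg_ne_zero.2 hq)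
        (Finset.prod_ne_zero_iff.2 fun r hr => ?_)
      refine D.rowG_ne_zero i (Finset.ne_of_mem_erase hr) ?_ ?_
      · rintro ⟨h, h'⟩
        refine hc r h ?_
        rw [lam.toSeq_apply, lam.toSeq_apply] at h'
        exact_mod_cast h'
      · rintro ⟨rfl, h'⟩
        have := lam.le_of_le (show s ≤ s + 1 by omega)
        omega
    have h := (D.res_eq_of_ser_eq i (h1 i) (h2 i) (hN₁.mono (by omega))
      (hN₂.mono (by omega)) hNi (show s < N by omega) hres).1
    rw [hpole, pole] at h
    have hlt' : mu.toSeq s < lam.toSeq s := by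
      rw [mu.toSeq_apply, lam.toSeq_apply]; exact_mod_cast hlt
    split_ifs at h
    · have := (D.pos_inj h).2
      omega
    · have := (D.pos_inj h).2
      omega

theorem ser_separates {lam mu : Partition}
    (h1 : ∀ i, D.ser 1 X i lam.toSeq = D.ser 1 X i mu.toSeq)
    (h2 : ∀ i, D.ser X 1 i lam.toSeq = D.ser X 1 i mu.toSeq) : lam = mu := by
  classical
  by_contra hne
  have hex : ∃ s, lam.1 s ≠ mu.1 s := by
    by_contra! h
    exact hne (Subtype.ext (Finsupp.ext h))
  have hs : ∀ t, t < Nat.find hex → lam.1 t = mu.1 t := fun t ht => by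
    have := Nat.find_min hex ht
    rwa [not_not] at this
  rcases lt_or_gt_of_ne (Nat.find_spec hex) with h | h
  · exact D.ser_separates_aux (fun t ht => (hs t ht).symm) h (fun i => (h1 i).symm)
      (fun i => (h2 i).symm)
  · exact D.ser_separates_aux hs h h1 h2

theorem fockRep_apply_of_diag {x : QToroidal n D.q D.d} {c : Partition → ℂ}
    (h : ∀ nu, D.fockRep x (ket nu) = c nu • ket nu) (v : Space) (nu : Partition) :
    D.fockRep x v nu = c nu * v nu := by
  induction v using Finsupp.induction_linear with
  | zero => simp
  | add v w hv hw => rw [map_add, Finsupp.add_apply, hv, hw, Finsupp.add_apply, mul_add]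
  | single lam a =>
    have : (Finsupp.single lam a : Space) = a • ket lam := by simp [ket]
    rw [this, map_smul, h]
    by_cases hl : lam = nu
    · subst hl; simp [ket, mul_comm]
    · simp [ket, hl]

theorem exists_separating {lam mu : Partition} (hne : lam ≠ mu) :
    ∃ (x : QToroidal n D.q D.d) (c : Partition → ℂ),
      (∀ nu, D.fockRep x (ket nu) = c nu • ket nu) ∧ c lam ≠ c mu := by
  by_contra! h
  refine hne (D.ser_separates (fun i => ?_) fun i => ?_)
  · ext r
    exact h _ _ (D.fockRep_Kplus_ket i r)
  · ext r
    exact h _ _ (D.fockRep_Kminus_ket i r)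

/-! ### Irreducibility -/

theorem ket_mem {p : Submodule ℂ Space} (hp : ∀ x v, v ∈ p → D.fockRep x v ∈ p) {v : Space}
    (hv : v ∈ p) {lam : Partition} (hlam : v lam ≠ 0) : ket lam ∈ p := by
  classical
  induction hm : v.support.card using Nat.strong_induction_on generalizing v with
  | _ m ih =>
    by_cases hex : ∃ mu, mu ≠ lam ∧ v mu ≠ 0
    · obtain ⟨mu, hmu, hvmu⟩ := hex
      obtain ⟨x, c, hx, hc⟩ := D.exists_separating (Ne.symm hmu)
      have hw : ∀ nu, (D.fockRep x v - c mu • v) nu = (c nu - c mu) * v nu := by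
        intro nu
        rw [Finsupp.sub_apply, D.fockRep_apply_of_diag hx, Finsupp.smul_apply, smul_eq_mul, sub_mul]
      refine ih _ ?_ (p.sub_mem (hp x v hv) (p.smul_mem (c mu) hv)) ?_ rfl
      · rw [← hm]
        refine Finset.card_lt_card ⟨fun nu hnu => ?_, fun hsub => ?_⟩
        · rw [Finsupp.mem_support_iff, hw] at hnu
          exact Finsupp.mem_support_iff.2 (right_ne_zero_of_mul hnu)
        · have := hsub (Finsupp.mem_support_iff.2 hvmu)
          rw [Finsupp.mem_support_iff, hw, sub_self, zero_mul] at this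
          exact this rfl
      · rw [hw]
        exact mul_ne_zero (sub_ne_zero.2 hc) hlam
    · push Not at hex
      have : v = v lam • ket lam := by
        ext nu
        by_cases h : nu = lam
        · subst h; simp [ket]
        · rw [hex nu h]; simp [ket, Ne.symm h]
      have h2 : ket lam = (v lam)⁻¹ • v := by
        conv_rhs => rw [this]
        simp [ket, hlam]
      rw [h2]
      exact p.smul_mem _ hv

theorem ket_mem_iff_of_inc {p : Submodule ℂ Space} (hp : ∀ x v, v ∈ p → D.fockRep x v ∈ p)
    {lam mu : Partition} {a : ℕ} (h : mu.toSeq = lam.toSeq.inc a) : ket lam ∈ p ↔ ket mu ∈ p := by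
  have hpow : ∀ m : ℤ, D.pos a (lam.toSeq a) ^ m ≠ 0 := fun m => zpow_ne_zero m (D.pos_ne_zero _ _)
  constructor
  · intro hl
    refine D.ket_mem hp (hp (QToroidal.E n D.q D.d (D.col a (lam.toSeq a)) 0) _ hl) ?_
    rw [fockRep_E_apply, h, opE_vec_inc, Dressing.term]
    refine mul_ne_zero (D.dressE_coef_ne_zero rfl fun s hs => ?_) (hpow 0)
    have h1 := mu.le_of_le (show s ≤ a by omega)
    rw [h, lam.toSeq.inc_self, lam.toSeq.inc_of_ne (by omega)] at h1
    omega
  · intro hl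
    refine D.ket_mem hp (hp (QToroidal.F n D.q D.d (D.col a (lam.toSeq a)) 0) _ hl) ?_
    rw [fockRep_F_apply, h, opF_vec_dec, Dressing.term]
    refine mul_ne_zero (D.dressF_coef_ne_zero rfl ?_) (hpow 0)
    have h1 := lam.le_of_le (show a ≤ a + 1 by omega)
    omega

theorem ket_mem_iff {p : Submodule ℂ Space} (hp : ∀ x v, v ∈ p → D.fockRep x v ∈ p)
    (lam : Partition) : ket lam ∈ p ↔ ket Partition.empty ∈ p := by
  induction lam using Partition.induction with
  | h0 => rfl
  | hadd lam mu a h ih => rw [← D.ket_mem_iff_of_inc hp h, ih]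

theorem eq_top_of_mem {p : Submodule ℂ Space} (hp : ∀ x v, v ∈ p → D.fockRep x v ∈ p) {v : Space}
    (hv : v ∈ p) (h0 : v ≠ 0) : p = ⊤ := by
  obtain ⟨lam, hlam⟩ : ∃ lam, v lam ≠ 0 := by
    by_contra! h
    exact h0 (Finsupp.ext h)
  have h := (D.ket_mem_iff hp lam).1 (D.ket_mem hp hv hlam)
  rw [eq_top_iff, ← span_ket, Submodule.span_le]
  rintro _ ⟨mu, rfl⟩
  exact (D.ket_mem_iff hp mu).2 h

/-- Every nonzero vector lies in no proper submodule. -/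
theorem submodule_eq_top [Module (QToroidal n D.q D.d) Space]
    (hact : ∀ (x : QToroidal n D.q D.d) (v : Space), x • v = D.fockRep x v)
    {p : Submodule (QToroidal n D.q D.d) Space} {v : Space} (hv : v ∈ p) (h0 : v ≠ 0) : p = ⊤ := by
  have hsc : ∀ (c : ℂ) (w : Space), c • w = algebraMap ℂ (QToroidal n D.q D.d) c • w := by
    intro c w
    rw [hact, AlgHom.commutes, Module.algebraMap_end_apply]
  let p' : Submodule ℂ Space :=
    { p.toAddSubmonoid with smul_mem' := fun c w hw => by rw [hsc]; exact p.smul_mem _ hw }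
  have hp' : p' = ⊤ := D.eq_top_of_mem (p := p')
    (fun x w hw => by rw [← hact]; exact p.smul_mem x hw) hv h0
  rw [eq_top_iff]
  intro w _
  have : w ∈ p' := by rw [hp']; trivial
  exact this

theorem ket_ne_zero (lam : Partition) : ket lam ≠ 0 := by simp [ket]

theorem fockModule_isSimple :
    letI := D.fockModule
    IsSimpleModule (QToroidal n D.q D.d) Space := by
  let _ := D.fockModule
  have : Nontrivial Space := ⟨ket Partition.empty, 0, ket_ne_zero _⟩
  rw [isSimpleModule_iff]
  refine ⟨fun p => ?_⟩
  rw [or_iff_not_imp_left]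
  intro hp
  obtain ⟨v, hv, h0⟩ := p.exists_mem_ne_zero_of_ne_bot hp
  exact D.submodule_eq_top (fun _ _ => rfl) hv h0

/-! ### Tameness -/

theorem fockModule_isTame :
    letI := D.fockModule
    QToroidal.IsTame n D.q D.d Space := by
  let _ := D.fockModule
  refine ⟨?_, fun φ => ?_⟩
  · rw [QToroidal.IsWeighted, eq_top_iff, ← span_ket, Submodule.span_le]
    rintro _ ⟨lam, rfl⟩
    refine Submodule.mem_iSup_of_mem
      ⟨fun i => D.ser 1 X i lam.toSeq, fun i => D.ser X 1 i lam.toSeq⟩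
      (Submodule.subset_span fun i r => ⟨?_, ?_⟩)
    · exact D.fockRep_Kplus_ket i r lam
    · exact D.fockRep_Kminus_ket i r lam
  · have hval : ∀ v, QToroidal.HasWeight n D.q D.d Space φ v → ∀ nu, v nu ≠ 0 →
        (∀ i, φ.plus i = D.ser 1 X i nu.toSeq) ∧ (∀ i, φ.minus i = D.ser X 1 i nu.toSeq) := by
      intro v hv nu hnu
      constructor
      · intro i
        ext r
        have h1 : D.fockRep (QToroidal.Kplus n D.q D.d i r) v = coeff r (φ.plus i) • v :=
          (hv i r).1
        have h2 := D.fockRep_apply_of_diag (D.fockRep_Kplus_ket i r) v nu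
        rw [h1, Finsupp.smul_apply, smul_eq_mul] at h2
        exact mul_right_cancel₀ hnu h2
      · intro i
        ext r
        have h1 : D.fockRep (QToroidal.Kminus n D.q D.d i r) v = coeff r (φ.minus i) • v :=
          (hv i r).2
        have h2 := D.fockRep_apply_of_diag (D.fockRep_Kminus_ket i r) v nu
        rw [h1, Finsupp.smul_apply, smul_eq_mul] at h2
        exact mul_right_cancel₀ hnu h2
    obtain ⟨w, hw⟩ : ∃ w : Space, QToroidal.weightSpace n D.q D.d Space φ ≤
        Submodule.span ℂ {w} := by
      by_cases hex : ∃ v lam, QToroidal.HasWeight n D.q D.d Space φ v ∧ v lam ≠ 0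
      · obtain ⟨v₀, lam, hv₀, hlam⟩ := hex
        refine ⟨ket lam, Submodule.span_le.2 fun v hv => ?_⟩
        refine Submodule.mem_span_singleton.2 ⟨v lam, ?_⟩
        ext nu
        by_cases h : lam = nu
        · subst h; simp [ket]
        · have h0 : v nu = 0 := by
            by_contra hnu
            have e1 := hval v₀ hv₀ lam hlam
            have e2 := hval v hv nu hnu
            exact h (D.ser_separates (fun i => (e1.1 i).symm.trans (e2.1 i))
              fun i => (e1.2 i).symm.trans (e2.2 i))
          rw [h0]; simp [ket, h]
      · push Not at hex
        refine ⟨0, Submodule.span_le.2 fun v hv => ?_⟩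
        have : v = 0 := Finsupp.ext fun nu => hex v nu hv
        rw [this]
        exact Submodule.zero_mem _
    calc Module.rank ℂ (QToroidal.weightSpace n D.q D.d Space φ)
        ≤ Module.rank ℂ (Submodule.span ℂ {w}) := Submodule.rank_mono hw
      _ ≤ Cardinal.mk ({w} : Set Space) := rank_span_le _
      _ = 1 := Cardinal.mk_singleton w

/-! ### The lowest weight vector -/

theorem ser_zero {Z Y : PowerSeries ℂ} (hZ : IsFrame Z Y) (i : ZMod n) :
    D.ser Z Y i 0 = if i = D.k then (D.serPsi Z Y (q₂ D.q * D.u))⁻¹ else 1 := by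
  rw [D.ser_eq hZ i (N := 0) (fun _ _ => rfl), Finset.range_zero, Finset.prod_empty, one_mul, serB]
  simp [col, pos, q₂]

theorem fockModule_isLowestWeight :
    letI := D.fockModule
    QToroidal.IsLowestWeight n D.q D.d Space (lowestWeight n D.q D.u D.k) := by
  let _ := D.fockModule
  refine ⟨ket Partition.empty, fun i r => ?_, fun i r => ⟨?_, ?_⟩, ?_⟩
  · change D.fockRep (QToroidal.F n D.q D.d i r) (ket Partition.empty) = 0
    ext nu
    rw [fockRep_F_apply]
    refine D.opF_vec_apply_eq_zero i r fun a ha => ?_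
    have h1 := DFunLike.congr_fun ha a
    rw [Partition.toSeq_empty, RowSeq.inc_self, nu.toSeq_apply, Finsupp.zero_apply] at h1
    omega
  · refine (D.fockRep_Kplus_ket i r Partition.empty).trans ?_
    rw [Partition.toSeq_empty, D.ser_zero isFrame_infty, lowestWeight, psiAtInfty_eq]
  · refine (D.fockRep_Kminus_ket i r Partition.empty).trans ?_
    rw [Partition.toSeq_empty, D.ser_zero isFrame_zero, lowestWeight, psiAtZero_eq]
  · exact D.submodule_eq_top (fun _ _ => rfl) (Submodule.mem_span_singleton_self _) (ket_ne_zero _)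

end FockDatum

@[to_additive]
theorem prod_range_zmod {n : ℕ} [NeZero n] {M : Type*} [CommMonoid M] (f : ZMod n → M) :
    ∏ t ∈ Finset.range n, f (t : ZMod n) = ∏ i, f i := by
  refine Finset.prod_bij' (fun t _ => (t : ZMod n)) (fun i _ => i.val) ?_ ?_ ?_ ?_ ?_
  · exact fun _ _ => Finset.mem_univ _
  · exact fun i _ => Finset.mem_range.2 i.val_lt
  · exact fun t ht => ZMod.val_cast_of_lt (Finset.mem_range.1 ht)
  · exact fun i _ => ZMod.natCast_zmod_val i
  · exact fun _ _ => rfl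

namespace Fock

/-! ### The degrees -/

theorem vectorDeg_add_one {n : ℕ} [NeZero n] (k : ZMod n) (j : ℤ) :
    vectorDeg n k (j + 1) = vectorDeg n k j + Pi.single (k - (j + 1 : ℤ)) 1 := by
  have hn : (0 : ℤ) < n := by exact_mod_cast Nat.pos_of_ne_zero (NeZero.ne n)
  obtain ⟨m, r, hj, hrn⟩ : ∃ m : ℤ, ∃ r : ℕ, j = r + n * m ∧ r < n := by
    have h0 := Int.emod_nonneg j hn.ne'
    have h1 := Int.emod_lt_of_pos j hn
    exact ⟨j / n, (j % n).toNat, by rw [Int.toNat_of_nonneg h0, Int.emod_add_mul_ediv], by omega⟩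
  have hcast : ((j + 1 : ℤ) : ZMod n) = r + 1 := by rw [hj]; simp
  obtain ⟨e1, e2⟩ := (Int.ediv_emod_unique (a := j) (r := r) (q := m) hn).2
    ⟨hj.symm, by omega, by omega⟩
  rw [hcast]
  by_cases h : r + 1 < n
  · obtain ⟨e3, e4⟩ := (Int.ediv_emod_unique (a := j + 1) (r := r + 1) (q := m) hn).2
      ⟨by rw [hj]; ring, by omega, by omega⟩
    rw [vectorDeg, vectorDeg, e1, e2, e3, e4, Int.toNat_natCast,
      show ((r : ℤ) + 1).toNat = r + 1 by omega, Finset.sum_range_succ _ (r + 1), add_assoc]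
    push_cast
    rfl
  · have hr : r + 1 = n := by omega
    obtain ⟨e3, e4⟩ := (Int.ediv_emod_unique (a := j + 1) (r := 0) (q := m + 1) hn).2
      ⟨by rw [hj, ← hr]; push_cast; ring, by omega, by omega⟩
    have hz : (r : ZMod n) + 1 = 0 := by
      rw [← Nat.cast_succ, Nat.succ_eq_add_one, hr, ZMod.natCast_self]
    have hsum : ∑ t ∈ Finset.range n, (Pi.single (k - (t : ZMod n)) 1 : ZMod n → ℤ) = 1 := by
      rw [sum_range_zmod fun t : ZMod n => (Pi.single (k - t) 1 : ZMod n → ℤ),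
        ← Finset.univ_sum_single (1 : ZMod n → ℤ)]
      exact Equiv.sum_comp (Equiv.subLeft k) fun t : ZMod n => (Pi.single t 1 : ZMod n → ℤ)
    rw [vectorDeg, vectorDeg, e1, e2, e3, e4, Int.toNat_natCast, hr, hsum, hz]
    ext x
    simp [add_assoc]

theorem deg_eq_sum {n : ℕ} (k : ZMod n) {lam : Partition} {N : ℕ} (hN : lam.toSeq.Bdd N) :
    deg n k lam = ∑ t ∈ Finset.range N,
      (vectorDeg n k (lam.toSeq t - (t + 1)) - vectorDeg n k (-((t : ℤ) + 1))) := by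
  rw [deg]
  simp only [lam.toSeq_apply]
  refine Finset.sum_subset (fun t ht => ?_) fun t _ ht => ?_
  · rw [Finset.mem_range]
    by_contra h
    have h1 := hN t (by omega)
    rw [lam.toSeq_apply] at h1
    exact Finsupp.mem_support_iff.1 ht (by exact_mod_cast h1)
  · rw [Finsupp.notMem_support_iff.1 ht, Nat.cast_zero, zero_sub, sub_self]

end Fock

namespace FockDatum

open RowSpace Fock PowerSeries

variable {n : ℕ} (D : FockDatum n)

theorem neZero (D : FockDatum n) : NeZero n := ⟨by have := D.three_le; omega⟩

theorem deg_inc {lam mu : Partition} {a : ℕ} (h : mu.toSeq = lam.toSeq.inc a) :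
    deg n D.k mu = deg n D.k lam + Pi.single (D.col a (lam.toSeq a)) 1 := by
  have := D.neZero
  obtain ⟨N, hN⟩ := lam.toSeq.exists_bdd
  have hN' := hN.mono (le_max_left N (a + 1))
  have ha : a ∈ Finset.range (max N (a + 1)) := Finset.mem_range.2 (by omega)
  rw [deg_eq_sum D.k hN', deg_eq_sum D.k (N := max N (a + 1)) (by rw [h]; exact hN'.inc (by omega)),
    ← Finset.add_sum_erase _ _ ha, ← Finset.add_sum_erase _ (fun t : ℕ =>
      vectorDeg n D.k (lam.toSeq t - (t + 1)) - vectorDeg n D.k (-((t : ℤ) + 1))) ha, h,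
    lam.toSeq.inc_self, add_sub_right_comm, vectorDeg_add_one]
  rw [Finset.sum_congr rfl fun t ht => by
    rw [lam.toSeq.inc_of_ne (Ne.symm (Finset.ne_of_mem_erase ht))]]
  have e : D.k - ((lam.toSeq a - (a + 1) + 1 : ℤ) : ZMod n) = D.col a (lam.toSeq a) := by
    rw [col]; push_cast; ring
  rw [e]
  abel

theorem mem_component {β : ZMod n → ℤ} {v : Space} :
    v ∈ component n D.k β ↔ ∀ lam, v lam ≠ 0 → deg n D.k lam = β := by
  have h : component n D.k β = Finsupp.supported ℂ ℂ {lam | deg n D.k lam = β} := by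
    rw [component, Finsupp.supported_eq_span_single]
    congr 1
    ext v
    constructor
    · rintro ⟨lam, h, rfl⟩
      exact ⟨lam, h, rfl⟩
    · rintro ⟨lam, h, rfl⟩
      exact ⟨lam, h, rfl⟩
  rw [h, Finsupp.mem_supported]
  exact ⟨fun h lam hl => h (Finsupp.mem_support_iff.2 hl),
    fun h lam hl => h lam (Finsupp.mem_support_iff.1 hl)⟩

theorem iota_apply_genOp (g : Gen n) (v : Space) :
    iota (D.fockRep (QToroidal.proj n D.q D.d (FreeAlgebra.ι ℂ g)) v) = D.genOp g (iota v) := by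
  rw [iota_fockRep, rhoFree, FreeAlgebra.lift_ι_apply]

theorem gen_mem_component (g : Gen n) {β : ZMod n → ℤ} {v : Space}
    (hv : v ∈ component n D.k β) :
    D.fockRep (QToroidal.proj n D.q D.d (FreeAlgebra.ι ℂ g)) v ∈
      component n D.k (QToroidal.genDeg g + β) := by
  rw [component] at hv
  induction hv using Submodule.span_induction with
  | zero => rw [map_zero]; exact Submodule.zero_mem _
  | add x y _ _ hx hy => rw [map_add]; exact Submodule.add_mem _ hx hy
  | smul c x _ hx => rw [map_smul]; exact Submodule.smul_mem _ _ hx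
  | mem x hx =>
    obtain ⟨lam, rfl, rfl⟩ := hx
    rw [mem_component]
    intro mu hmu
    rw [← iota_apply, iota_apply_genOp, iota_ket] at hmu
    have hdiag : ∀ f : RowSeq → ℂ, diag f (vec lam.toSeq) mu.toSeq ≠ 0 → mu = lam := by
      intro f h
      by_contra hne
      rw [diag_vec] at h
      apply h
      simp [vec, Partition.toSeq_injective.ne (Ne.symm hne)]
    cases g with
    | E i m =>
      have h : ∃ a, mu.toSeq = lam.toSeq.inc a ∧ D.col a (lam.toSeq a) = i := by
        by_contra! h
        exact hmu (D.opE_vec_apply_eq_zero i m h)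
      obtain ⟨a, ha, rfl⟩ := h
      rw [D.deg_inc ha, add_comm]
      rfl
    | F i m =>
      have h : ∃ a, lam.toSeq = mu.toSeq.inc a ∧ D.col a (mu.toSeq a) = i := by
        by_contra! h
        exact hmu (D.opF_vec_apply_eq_zero i m h)
      obtain ⟨a, ha, rfl⟩ := h
      rw [D.deg_inc ha, add_comm]
      exact (add_neg_cancel_right _ _).symm
    | H i l => rw [hdiag _ hmu]; exact (zero_add _).symm
    | K i => rw [hdiag _ hmu]; exact (zero_add _).symm
    | Kinv i => rw [hdiag _ hmu]; exact (zero_add _).symm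

theorem list_prod_mem_component (l : List (Gen n)) {β : ZMod n → ℤ} {v : Space}
    (hv : v ∈ component n D.k β) :
    D.fockRep (l.map fun g => QToroidal.proj n D.q D.d (FreeAlgebra.ι ℂ g)).prod v ∈
      component n D.k ((l.map QToroidal.genDeg).sum + β) := by
  induction l with
  | nil => simpa using hv
  | cons g l ih =>
    simp only [List.map_cons, List.prod_cons, List.sum_cons, map_mul, add_assoc]
    exact D.gen_mem_component g ih

theorem fockModule_isGradedBy :
    letI := D.fockModule
    QToroidal.IsGradedBy n D.q D.d Space (component n D.k) := by
  classical
  let _ := D.fockModule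
  refine ⟨?_, fun α β x hx v hv => ?_⟩
  · rw [DirectSum.isInternal_submodule_iff_iSupIndep_and_iSup_eq_top]
    refine ⟨fun β => ?_, ?_⟩
    · have h : ⨆ γ, ⨆ (_ : γ ≠ β), component n D.k γ ≤
          Finsupp.supported ℂ ℂ {lam | deg n D.k lam ≠ β} := by
        refine iSup₂_le fun γ hγ v hv => (Finsupp.mem_supported _ _).2 fun lam hl => ?_
        have := D.mem_component.1 hv lam (Finsupp.mem_support_iff.1 hl)
        exact fun h => hγ (this.symm.trans h)
      rw [Submodule.disjoint_def]
      intro v hv hv'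
      ext lam
      by_contra hne
      exact (Finsupp.mem_supported _ _).1 (h hv') (Finsupp.mem_support_iff.2 hne)
        (D.mem_component.1 hv lam hne)
    · rw [eq_top_iff, ← span_ket, Submodule.span_le]
      rintro _ ⟨lam, rfl⟩
      exact Submodule.mem_iSup_of_mem _ (Submodule.subset_span ⟨lam, rfl, rfl⟩)
  · change D.fockRep x v ∈ _
    rw [QToroidal.homogeneous] at hx
    induction hx using Submodule.span_induction with
    | zero => rw [map_zero]; exact Submodule.zero_mem _
    | add x y _ _ hx hy => rw [map_add]; exact Submodule.add_mem _ hx hy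
    | smul c x _ hx => rw [map_smul]; exact Submodule.smul_mem _ _ hx
    | mem x hx =>
      obtain ⟨l, rfl, rfl⟩ := hx
      exact D.list_prod_mem_component l hv

/-! ### The level -/

theorem fockRep_Kinv_ket (i : ZMod n) (lam : Partition) :
    D.fockRep (QToroidal.Kinv n D.q D.d i) (ket lam) =
      constantCoeff (D.ser X 1 i lam.toSeq) • ket lam := by
  apply iota_injective
  rw [QToroidal.Kinv, iota_fockRep, rhoFree_Kinv, iota_ket, diag_vec, map_smul, iota_ket]

theorem prod_zpow_cartan (j : ZMod n) [NeZero n] : ∏ i, D.q ^ cartan i j = 1 := by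
  have h1 := D.add_one_ne j
  have h2 := D.add_one_add_one_ne (j - 1)
  have hq := D.q_ne
  have h3 : j ≠ j - 1 := fun h => D.add_one_ne (j - 1) (by rw [sub_add_cancel]; exact h)
  have h4 : j + 1 ≠ j - 1 := by rw [sub_add_cancel] at h2; exact h2
  have e : ∀ i, D.q ^ cartan i j = (if i = j then D.q ^ 2 else 1) *
      ((if i = j + 1 then D.q⁻¹ else 1) * if i = j - 1 then D.q⁻¹ else 1) := by
    intro i
    have hi : j = i + 1 ↔ i = j - 1 := ⟨fun h => by rw [h]; ring, fun h => by rw [h]; ring⟩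
    simp only [cartan, hi]
    by_cases c1 : i = j
    · subst c1
      rw [if_pos rfl, if_pos rfl, if_neg (Ne.symm h1), if_neg h3]
      norm_cast
      simp
    · rw [if_neg c1, if_neg c1]
      by_cases c2 : i = j + 1
      · subst c2
        rw [if_pos (Or.inr rfl), if_pos rfl, if_neg h4]
        simp
      · by_cases c3 : i = j - 1
        · rw [if_pos (Or.inl c3), if_neg c2, if_pos c3]; simp
        · rw [if_neg (by tauto), if_neg c2, if_neg c3]; simp
  simp only [e, Finset.prod_mul_distrib, Finset.prod_ite_eq', Finset.mem_univ, if_true]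
  field_simp

theorem constantCoeff_ser_inc (i : ZMod n) (lam : RowSeq) (a : ℕ) :
    D.q ^ cartan i (D.col a (lam a)) * constantCoeff (D.ser X 1 i (lam.inc a)) =
      constantCoeff (D.ser X 1 i lam) := by
  have h := congrArg constantCoeff (D.ser_inc isFrame_zero i lam a)
  simp only [map_mul, map_sub, constantCoeff_C, constantCoeff_X, mul_zero, sub_zero, mul_one]
    at h
  refine mul_left_cancel₀ (D.pos_ne_zero a (lam a)) ?_
  linear_combination h

theorem prod_constantCoeff_ser [NeZero n] (lam : Partition) :
    ∏ i, constantCoeff (D.ser X 1 i lam.toSeq) = D.q := by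
  induction lam using Partition.induction with
  | h0 =>
    have e : ∀ i, constantCoeff (D.ser X 1 i Partition.empty.toSeq) =
        if i = D.k then D.q else 1 := by
      intro i
      rw [Partition.toSeq_empty, D.ser_zero isFrame_zero]
      split_ifs
      · rw [constantCoeff_inv, D.constantCoeff_serPsi_zero, inv_inv]
        exact mul_ne_zero (pow_ne_zero 2 D.q_ne) D.u_ne
      · exact constantCoeff_one
    simp only [e, Finset.prod_ite_eq', Finset.mem_univ, if_true]
  | hadd lam mu a h ih =>
    rw [← ih, ← Finset.prod_congr rfl fun i _ => D.constantCoeff_ser_inc i lam.toSeq a,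
      Finset.prod_mul_distrib, D.prod_zpow_cartan, one_mul, h]

theorem fockRep_kappaInv_ket (lam : Partition) :
    D.fockRep (QToroidal.kappaInv n D.q D.d) (ket lam) = D.q • ket lam := by
  have := D.neZero
  have key : ∀ N : ℕ, D.fockRep ((List.range N).map fun i : ℕ =>
      QToroidal.Kinv n D.q D.d (i : ZMod n)).prod (ket lam) =
      (∏ i ∈ Finset.range N, constantCoeff (D.ser X 1 (i : ZMod n) lam.toSeq)) • ket lam := by
    intro N
    induction N with
    | zero => simp
    | succ N ih =>
      rw [List.range_succ, List.map_append, List.prod_append, map_mul, Module.End.mul_apply,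
        List.map_singleton, List.prod_singleton, fockRep_Kinv_ket, map_smul, ih, smul_smul,
        Finset.prod_range_succ, mul_comm]
  rw [QToroidal.kappaInv, key, prod_range_zmod fun i => constantCoeff (D.ser X 1 i lam.toSeq),
    D.prod_constantCoeff_ser]

theorem fockModule_hasLevel :
    letI := D.fockModule
    QToroidal.HasLevel n D.q D.d Space D.q := by
  let _ := D.fockModule
  intro v
  ext nu
  exact D.fockRep_apply_of_diag (c := fun _ => D.q) D.fockRep_kappaInv_ket v nu

end FockDatum

end

theorem mainTheorem6 (n : ℕ) (hn : 3 ≤ n) (q d : ℂ) (hq : q ≠ 0) (hd : d ≠ 0)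
    (hgen : QuantumToroidal.IsGeneric q d) (u : ℂ) (hu : u ≠ 0) (k : ZMod n) :
    ∃ (_ : Module (QToroidal n q d) Fock.Space)
      (_ : IsScalarTower ℂ (QToroidal n q d) Fock.Space),
      Fock.IsFockAction n q d u k ∧
      IsSimpleModule (QToroidal n q d) Fock.Space ∧
      QToroidal.IsTame n q d Fock.Space ∧
      QToroidal.IsLowestWeight n q d Fock.Space (Fock.lowestWeight n q u k) ∧
      QToroidal.IsGradedBy n q d Fock.Space (Fock.component n k) ∧
      QToroidal.HasLevel n q d Fock.Space q := by
  let D : FockDatum n := ⟨q, d, u, k, hn, hq, hd, hu, hgen⟩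
  exact ⟨D.fockModule, D.fockModule_isScalarTower, D.fockModule_isFockAction,
    D.fockModule_isSimple, D.fockModule_isTame, D.fockModule_isLowestWeight,
    D.fockModule_isGradedBy, D.fockModule_hasLevel⟩
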